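/- **Lemma (uniformly consistent estimators).** *Setting.* Let $(Y_i,X_i)$, $i\ge 1$, be i.i.d. copies of $(Y,X)\in\{0,1\}\times\mathbb R^k$ with $0<\pi=P(Y=1)<1$, and let $G(x,\beta)$ be a real predictive index, measurable in $x$, with parameter $\beta\in\mathbb R^p$. Put $$TP(c,\beta)=P(G(X,\beta)>c\mid Y=1),\qquad FP(c,\beta)=P(G(X,\beta)>c\mid Y=0).$$ $B^*(r)$ is the open ball of radius $r>0$ around $\beta^*$. *Assumptions.* 1. *First stage.* $\mathcal B\subset\mathbb R^p$ is compact, $\beta^*$ is an interior point of $\mathcal B$, $\hat\beta=\hat\beta_n\in\mathcal B$ maximizes $\frac1n\sum_{i\le n}q(Y_i,X_i,\beta)$ over $\mathcal B$, and $\sqrt n(\hat\beta_n-\beta^*)=\frac1{\sqrt n}\sum_{i\le n}\psi_\beta(Y_i,X_i,\beta^*)+o_p(1)$, where $E\psi_\beta(Y,X,\beta^*)=0$ and $E\|\psi_\beta(Y,X,\beta^*)\|^{2+\epsilon}<\infty$ for some $\epsilon>0$. 2. *Kernel and bandwidth.* $K\ge0$ is supported in $[-1,1]$, symmetric around $0$,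 continuously differentiable on $\mathbb R$, and $\int K=1$; the bandwidths $h=h_n$ satisfy $h\to0$, $nh^4\to\infty$, $nh/\log n\to\infty$. 3. *Index.* For every $x$, $G(x,\cdot)$ is twice continuously differentiable on $B^*(r)$. Almost surely, $\sup_{\beta\in B^*(r)}|\partial_{jj}G(X,\beta)|\le M$ for all $j$ and some constant $M$. There is a measurable $L$ with $E\,L(X)^2<\infty$ such that almost surely $\|\nabla_\beta G(X,\beta)\|\le L(X)$ for all $\beta\in B^*(r)$. 4. *Density given $Y=0$.* The conditional distribution of $G(X,\beta^*)$ given $Y=0$ has compact support $[a_0,b_0]$, $a_0<b_0$, and a density $f_0$ that is twice continuously differentiable on $[a_0,b_0]$, positive on $(a_0,b_0)$, and satisfies $f_0(c)\ge M(\min\{c-a_0,b_0-c\})^{\kappa}$ on $[a_0,b_0]$ for some $M>0$ and some integer $\kappa\ge1$. 5. *Density given $Y=1$.* The conditional distribution of $G(X,\beta^*)$ given $Y=1$ has compact support $[a_1,b_1]\subseteq[a_0,b_0]$ and a density $f_1$ that is twice continuously differentiable on $[a_1,b_1]$. The ratio $f_1/f_0$ is bounded on $(a_0,b_0)$ and is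 continuous on $[a_0,b_0]$, in the sense that it has a continuous extension from $(a_0,b_0)$ to $[a_0,b_0]$, still denoted $f_1/f_0$. 6. *Margin.* $\delta_n>0$, $\delta_n\to0$, and $\delta_nn^{\iota}\to\infty$ for every $\iota>0$. 7. *Rates.* For $R=TP$ and $R=FP$, $\nabla_\beta R(c,\beta)$ exists and is continuous and bounded on $[a_0,b_0]\times B^*(r)$. *Estimators.* Let $\hat\pi=\frac1n\sum_{i\le n}Y_i$, $K_i(c)=K\big((G(X_i,\hat\beta)-c)/h\big)$, and $$\nabla_\beta\widetilde{TP}(c)=\frac1{\hat\pi\,nh}\sum_{i\le n}Y_iK_i(c)\nabla_\beta G(X_i,\hat\beta),\qquad \nabla_\beta\widetilde{FP}(c)=\frac1{(1-\hat\pi)nh}\sum_{i\le n}(1-Y_i)K_i(c)\nabla_\beta G(X_i,\hat\beta),$$ $$\tilde f_1(c)=\frac1{\hat\pi\,nh}\sum_{i\le n}Y_iK_i(c),\qquad \tilde f_0(c)=\frac1{(1-\hat\pi)nh}\sum_{i\le n}(1-Y_i)K_i(c).$$ The boundary-modified estimators $\nabla_\beta\widehat{TP}$ and $\nabla_\beta\widehat{FP}$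 (with margin $d=h$), $\hat f_1$ and $\hat f_0$ (with margin $d=\delta_n$) equal the corresponding primary estimator on $[a_0+d,b_0-d]$, its value at $a_0+d$ on $[a_0,a_0+d]$, and its value at $b_0-d$ on $[b_0-d,b_0]$. With $\widehat{FP}(c,\beta)=\#\{i\le n:Y_i=0,\ G(X_i,\beta)>c\}/\#\{i\le n:Y_i=0\}$ let, for $t\in[0,1]$, $$c_t=\inf\{c\in[a_0,b_0]:FP(c,\beta^*)\le t\},\qquad \hat c_t=\inf\{c\in[a_0,b_0]:\widehat{FP}(c,\hat\beta)\le t\},$$ where the infimum of the empty set is $b_0$. *Conclusion.* Under these assumptions: * For all sufficiently large $n$ and every sample, $\nabla_\beta\widehat{FP}$ and $\nabla_\beta\widehat{TP}$ are Lipschitz continuous in $c$ on $[a_0,b_0]$. With probability tending to one, $\hat f_0>0$ on $[a_0,b_0]$ and $\hat f_1/\hat f_0$ is Lipschitz continuous in $c$ on $[a_0,b_0]$. (The Lipschitz constants may depend on $n$ and on the sample.) * The estimators are uniformly consistent: $$\sup_{c\in[a_0,b_0]}\|\nabla_\beta\widehat{FP}(c)-\nabla_\beta FP(c,\beta^*)\|=o_p(1),\qquad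 \sup_{c\in[a_0,b_0]}\|\nabla_\beta\widehat{TP}(c)-\nabla_\beta TP(c,\beta^*)\|=o_p(1),$$ $$\sup_{c\in[a_0,b_0]}\Big|\frac{\hat f_1(c)}{\hat f_0(c)}-\frac{f_1(c)}{f_0(c)}\Big|=o_p(1).$$ * The estimated cutoffs are uniformly consistent: $\sup_{t\in[0,1]}|\hat c_t-c_t|=o_p(1)$. -/

import Mathlib

open MeasureTheory ProbabilityTheory Filter Topology Set

noncomputable section

/-- The covariate space `ℝ^k` and the parameter space `ℝ^p`, with the Euclidean norm. -/
abbrev Vec (k : ℕ) : Type := EuclideanSpace ℝ (Fin k)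

/-! ### Population objects -/

/-- `TP(c, β) = P(G(X, β) > c | Y = 1)`. -/
def truePos {Ω : Type*} [MeasurableSpace Ω] {k p : ℕ} (μ : Measure Ω) (Y : Ω → ℝ) (X : Ω → Vec k)
    (G : Vec k → Vec p → ℝ) (c : ℝ) (β : Vec p) : ℝ :=
  (ProbabilityTheory.cond μ {ω | Y ω = 1}).real {ω | c < G (X ω) β}

/-- `FP(c, β) = P(G(X, β) > c | Y = 0)`. -/
def falsePos {Ω : Type*} [MeasurableSpace Ω] {k p : ℕ} (μ : Measure Ω) (Y : Ω → ℝ) (X : Ω → Vec k)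
    (G : Vec k → Vec p → ℝ) (c : ℝ) (β : Vec p) : ℝ :=
  (ProbabilityTheory.cond μ {ω | Y ω = 0}).real {ω | c < G (X ω) β}

/-- The cutoff in `[a, b]` attached to the false positive rate `t`: the infimum of the
`c ∈ [a, b]` with `F c ≤ t`, and `b` if there is no such `c`. -/
def cutoff (a b : ℝ) (F : ℝ → ℝ) (t : ℝ) : ℝ :=
  sInf ({c | c ∈ Icc a b ∧ F c ≤ t} ∪ {b})

/-- The second partial derivative `∂_jj g (β)`. -/
def secondPartial {p : ℕ} (g : Vec p → ℝ) (j : Fin p) (β : Vec p) : ℝ :=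
  fderiv ℝ (fun b => fderiv ℝ g b (EuclideanSpace.single j 1)) β (EuclideanSpace.single j 1)

/-! ### Sample objects

The observations are `(y 0, x 0), …, (y (n - 1), x (n - 1))`. -/

/-- `π̂`, the sample frequency of `Y = 1`. -/
def piHat (n : ℕ) (y : ℕ → ℝ) : ℝ := (1 / (n : ℝ)) * ∑ i ∈ Finset.range n, y i

open Classical in
/-- The empirical false positive rate: the fraction of the observations with `Y = 0` that have
`G(X, β) > c`. -/
def falsePosHat {k p : ℕ} (G : Vec k → Vec p → ℝ) (n : ℕ) (y : ℕ → ℝ) (x : ℕ → Vec k)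
    (c : ℝ) (β : Vec p) : ℝ :=
  (((Finset.range n).filter (fun i => c < G (x i) β ∧ y i = 0)).card : ℝ) /
    (((Finset.range n).filter (fun i => y i = 0)).card : ℝ)

/-- Primary kernel estimator of `∇_β TP(c, β)`. -/
def gradTPTilde {k p : ℕ} (K : ℝ → ℝ) (h : ℝ) (G : Vec k → Vec p → ℝ) (n : ℕ) (y : ℕ → ℝ)
    (x : ℕ → Vec k) (β : Vec p) (c : ℝ) : Vec p :=
  ((1 / piHat n y) * (1 / ((n : ℝ) * h))) •
    ∑ i ∈ Finset.range n, (y i * K ((G (x i) β - c) / h)) • gradient (G (x i)) β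

/-- Primary kernel estimator of `∇_β FP(c, β)`. -/
def gradFPTilde {k p : ℕ} (K : ℝ → ℝ) (h : ℝ) (G : Vec k → Vec p → ℝ) (n : ℕ) (y : ℕ → ℝ)
    (x : ℕ → Vec k) (β : Vec p) (c : ℝ) : Vec p :=
  ((1 / (1 - piHat n y)) * (1 / ((n : ℝ) * h))) •
    ∑ i ∈ Finset.range n, ((1 - y i) * K ((G (x i) β - c) / h)) • gradient (G (x i)) β

/-- Primary kernel estimator of the density `f₁(c)`. -/
def densOneTilde {k p : ℕ} (K : ℝ → ℝ) (h : ℝ) (G : Vec k → Vec p → ℝ) (n : ℕ) (y : ℕ → ℝ)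
    (x : ℕ → Vec k) (β : Vec p) (c : ℝ) : ℝ :=
  (1 / piHat n y) * (1 / ((n : ℝ) * h)) *
    ∑ i ∈ Finset.range n, y i * K ((G (x i) β - c) / h)

/-- Primary kernel estimator of the density `f₀(c)`. -/
def densZeroTilde {k p : ℕ} (K : ℝ → ℝ) (h : ℝ) (G : Vec k → Vec p → ℝ) (n : ℕ) (y : ℕ → ℝ)
    (x : ℕ → Vec k) (β : Vec p) (c : ℝ) : ℝ :=
  (1 / (1 - piHat n y)) * (1 / ((n : ℝ) * h)) *
    ∑ i ∈ Finset.range n, (1 - y i) * K ((G (x i) β - c) / h)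

/-- Boundary modification on `[a, b]` with margin `d`: the value at `a + d` is used on
`[a, a + d]`, and the value at `b - d` on `[b - d, b]`. -/
def boundaryMod {E : Type*} (a b d : ℝ) (g : ℝ → E) (c : ℝ) : E :=
  if c ≤ a + d then g (a + d) else if c ≤ b - d then g c else g (b - d)

/-! ### Assumptions -/

/-- Random sample: i.i.d. observations on `(Y, X) ∈ {0, 1} × ℝ^k`, both classes having positive
probability. -/
structure IIDSample {Ω : Type*} [MeasurableSpace Ω] {k : ℕ} (μ : Measure Ω)
    (Y : ℕ → Ω → ℝ) (X : ℕ → Ω → Vec k) : Prop where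
  measurable_Y : ∀ i, Measurable (Y i)
  measurable_X : ∀ i, Measurable (X i)
  binary : ∀ i, ∀ᵐ ω ∂μ, Y i ω = 0 ∨ Y i ω = 1
  indep : iIndepFun (fun i ω => (Y i ω, X i ω)) μ
  ident : ∀ i, IdentDistrib (fun ω => (Y i ω, X i ω)) (fun ω => (Y 0 ω, X 0 ω)) μ μ
  pos_one : 0 < μ {ω | Y 0 ω = 1}
  pos_zero : 0 < μ {ω | Y 0 ω = 0}

/-- The first stage estimator `βhat` is an M-estimator over the compact set `B`, and it is
asymptotically linear around the interior point `βs` with influence function `ψ`. -/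
structure FirstStage {Ω : Type*} [MeasurableSpace Ω] {k p : ℕ} (μ : Measure Ω)
    (Y : ℕ → Ω → ℝ) (X : ℕ → Ω → Vec k) (B : Set (Vec p)) (q : ℝ → Vec k → Vec p → ℝ)
    (ψ : ℝ → Vec k → Vec p → Vec p) (βs : Vec p) (βhat : ℕ → Ω → Vec p) : Prop where
  compact : IsCompact B
  interior : βs ∈ interior B
  mem : ∀ n : ℕ, ∀ᵐ ω ∂μ, βhat n ω ∈ B
  argmax : ∀ n : ℕ, ∀ᵐ ω ∂μ,
    IsMaxOn (fun β => (1 / (n : ℝ)) * ∑ i ∈ Finset.range n, q (Y i ω) (X i ω) β) B (βhat n ω)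
  measurable_psi : Measurable (fun z : ℝ × Vec k => ψ z.1 z.2 βs)
  moment : ∃ ε : ℝ, 0 < ε ∧
    MemLp (fun ω => ψ (Y 0 ω) (X 0 ω) βs) (ENNReal.ofReal (2 + ε)) μ
  centered : ∫ ω, ψ (Y 0 ω) (X 0 ω) βs ∂μ = 0
  linear : TendstoInMeasure μ
    (fun (n : ℕ) ω => Real.sqrt (n : ℝ) • (βhat n ω - βs) -
      (1 / Real.sqrt (n : ℝ)) • ∑ i ∈ Finset.range n, ψ (Y i ω) (X i ω) βs)
    atTop (fun _ => 0)

/-- Kernel and bandwidth conditions. -/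
structure KernelBandwidth (K : ℝ → ℝ) (h : ℕ → ℝ) : Prop where
  nonneg : ∀ u, 0 ≤ K u
  support : tsupport K ⊆ Icc (-1) 1
  symm : ∀ u, K (-u) = K u
  smooth : ContDiff ℝ 1 K
  integral_one : ∫ u, K u = 1
  bandwidth_zero : Tendsto h atTop (𝓝 0)
  bandwidth_four : Tendsto (fun n : ℕ => (n : ℝ) * h n ^ 4) atTop atTop
  bandwidth_log : Tendsto (fun n : ℕ => (n : ℝ) * h n / Real.log n) atTop atTop

/-- Smoothness of the index in `β` on the open ball of radius `r` around `βs`: it is twice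
continuously differentiable with bounded `∂_jj G`, and its gradient has a square integrable
envelope. -/
structure IndexSmooth {Ω : Type*} [MeasurableSpace Ω] {k p : ℕ} (μ : Measure Ω) (X : Ω → Vec k)
    (G : Vec k → Vec p → ℝ) (βs : Vec p) (r : ℝ) : Prop where
  measurable_G : ∀ β, Measurable (fun x => G x β)
  smooth : ∀ x, ContDiffOn ℝ 2 (G x) (Metric.ball βs r)
  second_bound : ∃ M : ℝ, 0 < M ∧
    ∀ᵐ ω ∂μ, ∀ β ∈ Metric.ball βs r, ∀ j, |secondPartial (G (X ω)) j β| ≤ M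
  envelope : ∃ L : Vec k → ℝ, Measurable L ∧ MemLp (fun ω => L (X ω)) 2 μ ∧
    ∀ᵐ ω ∂μ, ∀ β ∈ Metric.ball βs r, ‖gradient (G (X ω)) β‖ ≤ L (X ω)

/-- The gradient in `β` of the rate `R(c, β)` exists on `C × B(βs, r)`, and it is continuous and
bounded there. -/
structure GradientUnif {p : ℕ} (R : ℝ → Vec p → ℝ) (C : Set ℝ) (βs : Vec p) (r : ℝ) : Prop where
  differentiable : ∀ c ∈ C, ∀ β ∈ Metric.ball βs r, DifferentiableAt ℝ (R c) β
  continuous : ContinuousOn (fun z : ℝ × Vec p => gradient (R z.1) z.2) (C ×ˢ Metric.ball βs r)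
  bounded : ∃ M : ℝ, 0 < M ∧ ∀ c ∈ C, ∀ β ∈ Metric.ball βs r, ‖gradient (R c) β‖ ≤ M

/-- `f` is a density of the conditional distribution of `G(X, β)` given `Y = y`; that distribution
has the compact support `[a, b]`, and `f` is twice continuously differentiable there. -/
structure CondDensity {Ω : Type*} [MeasurableSpace Ω] {k p : ℕ} (μ : Measure Ω) (Y : Ω → ℝ)
    (X : Ω → Vec k) (G : Vec k → Vec p → ℝ) (β : Vec p) (y a b : ℝ) (f : ℝ → ℝ) : Prop where
  lt : a < b
  nonneg : ∀ c, 0 ≤ f c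
  support : tsupport f = Icc a b
  smooth : ContDiffOn ℝ 2 f (Icc a b)
  law : Measure.map (fun ω => G (X ω) β) (ProbabilityTheory.cond μ {ω | Y ω = y}) =
    (volume : Measure ℝ).withDensity (fun c => ENNReal.ofReal (f c))

/-- `f₀` is positive inside its support, and it decays at most polynomially at the end points. -/
structure DensityDecay (a b : ℝ) (f : ℝ → ℝ) : Prop where
  pos : ∀ c ∈ Ioo a b, 0 < f c
  decay : ∃ M : ℝ, 0 < M ∧ ∃ κ : ℕ, 0 < κ ∧ ∀ c ∈ Icc a b, M * min (c - a) (b - c) ^ κ ≤ f c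

/-- `lr` is the likelihood ratio `f₁ / f₀` on `[a, b]`: it is bounded, and continuous up to the end
points, where it is given by continuous extension (`f₀` may vanish there). -/
structure LikelihoodRatio (a b : ℝ) (f₀ f₁ lr : ℝ → ℝ) : Prop where
  bounded : ∃ M : ℝ, 0 < M ∧ ∀ c ∈ Ioo a b, |f₁ c / f₀ c| ≤ M
  eq : ∀ c ∈ Ioo a b, lr c = f₁ c / f₀ c
  continuous : ContinuousOn lr (Icc a b)

/-- The margin `δ_n` tends to zero, more slowly than every negative power of `n`. -/
structure MarginRate (δ : ℕ → ℝ) : Prop where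
  pos : ∀ n, 0 < δ n
  tendsto_zero : Tendsto δ atTop (𝓝 0)
  slow : ∀ ι : ℝ, 0 < ι → Tendsto (fun n : ℕ => δ n * (n : ℝ) ^ ι) atTop atTop

/-! ### Conclusions -/

/-- `sup_{c ∈ S} ‖est_n(c) - θ(c)‖ = o_p(1)`, where the event that the supremum exceeds `ε` is
measured by the outer probability if it is not measurable. -/
def UnifConsistent {Ω E : Type*} [MeasurableSpace Ω] [NormedAddCommGroup E] (μ : Measure Ω)
    (S : Set ℝ) (est : ℕ → Ω → ℝ → E) (θ : ℝ → E) : Prop :=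
  ∀ ε : ℝ, 0 < ε → Tendsto (fun n => μ {ω | ∃ c ∈ S, ε < ‖est n ω c - θ c‖}) atTop (𝓝 0)

/-- `g` is Lipschitz continuous on `S`. -/
def LipOn {E : Type*} [NormedAddCommGroup E] (S : Set ℝ) (g : ℝ → E) : Prop :=
  ∃ M : NNReal, LipschitzOnWith M g S

end

/-! All probabilistic statements are phrased with the filter `inProb`: finitely many events of
probability tending to one are intersected, and the rest of each argument is deterministic on a
single sample.

Rates are measured in w = n^(1/32) and x = n^(1/4) h. The condition n h^4 → ∞ says exactly that x →
∞, and h = x / w^8. Chebyshev's inequality applied to the influence function places `βhat` within Δ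
= x / √n = h / w^8 of `βs` (`FirstStage.eventually_norm_le`). Kernel averages at the fixed parameter
`βs` concentrate uniformly in the location by Chebyshev on a grid, a union bound and Lipschitz
interpolation (`IsIID.uniform_kernel_lln`).

Gradients. Replacing `βhat` by `βs` costs o(h) before normalisation: the kernel arguments move by L
Δ / h, and the partial derivatives of the index move by O(√Δ), because they are Hölder of order 1/2
(`IndexBound.abs_gradient_sub_le`). The mean that remains is identified by a weak form of
differentiation (`integral_mul_partial_eq`): if Ψ' = φ, then E[Ψ(G(X, β)) | Y] = ∫ φ(u) R(u, β) du
by Fubini, and differentiating both sides in β gives E[φ(G) ∂_j G | Y] = ∫ φ ∂_j R. For φ a rescaled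
kernel with window inside [a₀, b₀], the right side is a local average of the continuous function ∂_j
R.

Likelihood ratio. Since f₀ may vanish at the end points, every error must be small relative to the
smoothed density m₀ = ∫ K((u - c)/h) f₀(u) du. The bias is relative automatically, because f₁ = lr
f₀ almost everywhere (`LikelihoodRatio.abs_integral_sub_le`). The stochastic errors are at most h /
w (`eventually_densSummand_concentrate`, `eventually_densSummand_sub_le`), whereas m₀ is at least of
order h δ^κ inside the margin (`KernelBandwidth.le_integral_mul`). The margin decays more slowly
than any power of n, so w δ^κ → ∞ and m₀ dominates.

Cutoffs. The empirical false positive rate is sandwiched between averages of Lipschitz ramps, hence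
is uniformly consistent (`eventually_falsePosHat_consistent`). The polynomial lower bound on f₀
makes the population rate drop by a fixed amount over every interval of fixed length in [a₀, b₀],
and this permits inversion (`abs_cutoff_sub_le`).

The boundary modification is composition with a 1-Lipschitz projection onto the inner interval. It
therefore preserves Lipschitz continuity, and it carries consistency from the inner interval to [a₀,
b₀] because the limits are continuous there (`unifConsistent_boundaryMod`). -/

noncomputable section

/-! ### Events of probability tending to one -/

/-- The filter of events `E n` whose outer probability tends to one. -/
def inProb {Ω : Type*} [MeasurableSpace Ω] (μ : Measure Ω) : Filter (ℕ × Ω) where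
  sets := {S | Tendsto (fun n => μ {ω | (n, ω) ∉ S}) atTop (𝓝 0)}
  univ_sets := by simp
  sets_of_superset := by
    intro S T hS hST
    refine tendsto_of_tendsto_of_tendsto_of_le_of_le tendsto_const_nhds hS
      (fun n => zero_le) (fun n => measure_mono fun ω hω h => hω (hST h))
  -- Subadditivity of the outer measure suffices, so no event has to be measurable.
  inter_sets := by
    intro S T hS hT
    have h := Tendsto.add hS hT
    rw [add_zero] at h
    refine tendsto_of_tendsto_of_tendsto_of_le_of_le tendsto_const_nhds h
      (fun n => zero_le) (fun n => (measure_mono fun ω hω => ?_).trans (measure_union_le _ _))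
    simp only [mem_inter_iff, not_and_or, mem_ofPred_eq] at hω
    exact hω

section InProb

variable {Ω : Type*} [MeasurableSpace Ω] {μ : Measure Ω}

theorem eventually_inProb_iff {P : ℕ → Ω → Prop} :
    (∀ᶠ z in inProb μ, P z.1 z.2) ↔ Tendsto (fun n => μ {ω | ¬ P n ω}) atTop (𝓝 0) :=
  Iff.rfl

theorem eventually_inProb_of_eventually {P : ℕ → Prop} (h : ∀ᶠ n in atTop, P n) :
    ∀ᶠ z in inProb μ, P z.1 := by
  refine (eventually_inProb_iff (P := fun n _ => P n)).2 (tendsto_const_nhds.congr' ?_)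
  filter_upwards [h] with n hn
  simp [hn]

theorem tendsto_fst_inProb : Tendsto (fun z : ℕ × Ω => z.1) (inProb μ) atTop :=
  fun _ hs => eventually_inProb_of_eventually hs

theorem eventually_inProb_of_ae {P : ℕ → Ω → Prop} (h : ∀ n, ∀ᵐ ω ∂μ, P n ω) :
    ∀ᶠ z in inProb μ, P z.1 z.2 := by
  refine eventually_inProb_iff.2 (tendsto_const_nhds.congr fun n => ?_)
  exact (ae_iff.1 (h n)).symm

theorem eventually_norm_le_of_tendstoInMeasure {E : Type*} [NormedAddCommGroup E] {f : ℕ → Ω → E}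
    (h : TendstoInMeasure μ f atTop (fun _ => 0)) {ε : ℝ} (hε : 0 < ε) :
    ∀ᶠ z in inProb μ, ‖f z.1 z.2‖ ≤ ε := by
  refine (eventually_inProb_iff (P := fun n ω => ‖f n ω‖ ≤ ε)).2 ?_
  rw [tendstoInMeasure_iff_norm] at h
  refine tendsto_of_tendsto_of_tendsto_of_le_of_le tendsto_const_nhds (h ε hε)
    (fun n => zero_le) (fun n => measure_mono fun ω hω => ?_)
  simp only [mem_ofPred_eq, not_le] at hω
  simpa using hω.le

theorem tendsto_inProb_of_tendstoInMeasure {f : ℕ → Ω → ℝ} {c : ℝ}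
    (h : TendstoInMeasure μ f atTop (fun _ => c)) :
    Tendsto (fun z : ℕ × Ω => f z.1 z.2) (inProb μ) (𝓝 c) := by
  rw [Metric.tendsto_nhds]
  intro ε hε
  refine (eventually_inProb_iff (P := fun n ω => dist (f n ω) c < ε)).2 ?_
  rw [tendstoInMeasure_iff_dist] at h
  refine (h ε hε).congr fun n => ?_
  simp

theorem unifConsistent_iff {E : Type*} [NormedAddCommGroup E] {S : Set ℝ} {est : ℕ → Ω → ℝ → E}
    {θ : ℝ → E} : UnifConsistent μ S est θ ↔
      ∀ ε : ℝ, 0 < ε → ∀ᶠ z in inProb μ, ∀ c ∈ S, ‖est z.1 z.2 c - θ c‖ ≤ ε := by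
  refine forall₂_congr fun ε _ => ?_
  rw [eventually_inProb_iff (P := fun n ω => ∀ c ∈ S, ‖est n ω c - θ c‖ ≤ ε)]
  simp only [not_forall, not_le, exists_prop]

end InProb

/-! ### Sample means -/

/-- The mean of `F` over the first `n` observations. -/
def sampleMean {Ω α : Type*} (Z : ℕ → Ω → α) (n : ℕ) (F : α → ℝ) (ω : Ω) : ℝ :=
  (1 / (n : ℝ)) * ∑ i ∈ Finset.range n, F (Z i ω)

/-- Independent and identically distributed observations. -/
structure IsIID {Ω α : Type*} [MeasurableSpace Ω] [MeasurableSpace α] (μ : Measure Ω)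
    (Z : ℕ → Ω → α) : Prop where
  measurable : ∀ i, Measurable (Z i)
  indep : iIndepFun Z μ
  ident : ∀ i, IdentDistrib (Z i) (Z 0) μ μ

section SampleMean

variable {Ω α : Type*}

theorem sampleMean_mono {Z : ℕ → Ω → α} {n : ℕ} {F F' : α → ℝ} {ω : Ω}
    (h : ∀ i < n, F (Z i ω) ≤ F' (Z i ω)) : sampleMean Z n F ω ≤ sampleMean Z n F' ω := by
  unfold sampleMean
  gcongr with i hi
  exact h i (Finset.mem_range.1 hi)

theorem sampleMean_add (Z : ℕ → Ω → α) (n : ℕ) (F F' : α → ℝ) (ω : Ω) :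
    sampleMean Z n (fun z => F z + F' z) ω = sampleMean Z n F ω + sampleMean Z n F' ω := by
  simp [sampleMean, Finset.sum_add_distrib, mul_add]

theorem sampleMean_sub (Z : ℕ → Ω → α) (n : ℕ) (F F' : α → ℝ) (ω : Ω) :
    sampleMean Z n (fun z => F z - F' z) ω = sampleMean Z n F ω - sampleMean Z n F' ω := by
  simp [sampleMean, Finset.sum_sub_distrib, mul_sub]

theorem sampleMean_const_mul (Z : ℕ → Ω → α) (n : ℕ) (a : ℝ) (F : α → ℝ) (ω : Ω) :
    sampleMean Z n (fun z => a * F z) ω = a * sampleMean Z n F ω := by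
  simp only [sampleMean, ← Finset.mul_sum]
  ring

theorem sampleMean_const_le {Z : ℕ → Ω → α} {n : ℕ} {a : ℝ} (ha : 0 ≤ a) {ω : Ω} :
    sampleMean Z n (fun _ => a) ω ≤ a := by
  rcases Nat.eq_zero_or_pos n with rfl | hn
  · simpa [sampleMean] using ha
  · have : (n : ℝ) ≠ 0 := by positivity
    simp [sampleMean, this]

theorem abs_sampleMean_le (Z : ℕ → Ω → α) (n : ℕ) (F : α → ℝ) (ω : Ω) :
    |sampleMean Z n F ω| ≤ sampleMean Z n (fun z => |F z|) ω := by
  unfold sampleMean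
  rw [abs_mul, abs_of_nonneg (by positivity : (0 : ℝ) ≤ 1 / n)]
  gcongr
  exact Finset.abs_sum_le_sum_abs _ _

theorem abs_sampleMean_sub_le {Z : ℕ → Ω → α} {n : ℕ} {F F' D : α → ℝ} {ω : Ω}
    (h : ∀ i < n, |F (Z i ω) - F' (Z i ω)| ≤ D (Z i ω)) :
    |sampleMean Z n F ω - sampleMean Z n F' ω| ≤ sampleMean Z n D ω := by
  rw [← sampleMean_sub]
  exact (abs_sampleMean_le _ _ _ _).trans (sampleMean_mono h)

variable [MeasurableSpace Ω] [MeasurableSpace α] {μ : Measure Ω}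
  {Z : ℕ → Ω → α}

theorem IsIID.identDistrib_comp (hZ : IsIID μ Z) {F : α → ℝ} (hF : Measurable F) (i : ℕ) :
    IdentDistrib (fun ω => F (Z i ω)) (fun ω => F (Z 0 ω)) μ μ :=
  (hZ.ident i).comp hF

theorem IsIID.indepFun_comp (hZ : IsIID μ Z) {F : α → ℝ} (hF : Measurable F) {i j : ℕ}
    (hij : i ≠ j) : IndepFun (fun ω => F (Z i ω)) (fun ω => F (Z j ω)) μ :=
  (hZ.indep.indepFun hij).comp hF hF

/-- The weak law of large numbers. -/
theorem IsIID.tendsto_sampleMean [IsProbabilityMeasure μ] (hZ : IsIID μ Z) {F : α → ℝ}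
    (hF : Measurable F) (hint : Integrable (fun ω => F (Z 0 ω)) μ) :
    Tendsto (fun z : ℕ × Ω => sampleMean Z z.1 F z.2) (inProb μ) (𝓝 (∫ ω, F (Z 0 ω) ∂μ)) := by
  refine tendsto_inProb_of_tendstoInMeasure (f := fun n ω => sampleMean Z n F ω) ?_
  refine tendstoInMeasure_of_tendsto_ae (fun n => ?_) ?_
  · refine Measurable.aestronglyMeasurable ?_
    unfold sampleMean
    exact (Finset.measurable_fun_sum _ fun i _ => hF.comp (hZ.measurable i)).const_mul _
  · filter_upwards [strong_law_ae_real (fun i ω => F (Z i ω)) hint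
      (fun i j hij => hZ.indepFun_comp hF hij) (hZ.identDistrib_comp hF)] with ω hω
    refine hω.congr fun n => ?_
    unfold sampleMean
    ring

theorem IsIID.eventually_sampleMean_le [IsProbabilityMeasure μ] (hZ : IsIID μ Z) {F : α → ℝ}
    (hF : Measurable F) (hint : Integrable (fun ω => F (Z 0 ω)) μ) :
    ∀ᶠ z in inProb μ, sampleMean Z z.1 F z.2 ≤ ∫ ω, F (Z 0 ω) ∂μ + 1 :=
  (hZ.tendsto_sampleMean hF hint).eventually_le_const (by linarith)

/-- Chebyshev's inequality for sample means. -/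
theorem IsIID.chebyshev [IsProbabilityMeasure μ] (hZ : IsIID μ Z) {F : α → ℝ}
    (hF : Measurable F) (hmem : MemLp (fun ω => F (Z 0 ω)) 2 μ) {v ε : ℝ} (hε : 0 < ε)
    (hv : ∫ ω, F (Z 0 ω) ^ 2 ∂μ ≤ v) {n : ℕ} (hn : 0 < n) :
    μ {ω | ε ≤ |sampleMean Z n F ω - ∫ ω, F (Z 0 ω) ∂μ|} ≤ ENNReal.ofReal (v / (n * ε ^ 2)) := by
  have hn' : (0 : ℝ) < n := by exact_mod_cast hn
  have hmemi : ∀ i, MemLp (fun ω => F (Z i ω)) 2 μ := fun i =>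
    (hZ.identDistrib_comp hF i).symm.memLp_snd hmem
  set S : Ω → ℝ := ∑ i ∈ Finset.range n, fun ω => F (Z i ω) with hS
  have hSm : MemLp S 2 μ := memLp_finsetSum' _ fun i _ => hmemi i
  have hmean : ∫ ω, S ω ∂μ = n * ∫ ω, F (Z 0 ω) ∂μ := by
    simp only [hS, Finset.sum_apply]
    rw [integral_finsetSum _ fun i _ => (hmemi i).integrable (by norm_num)]
    rw [Finset.sum_congr rfl fun i _ => (hZ.identDistrib_comp hF i).integral_eq]
    simp
  have hvar : variance S μ ≤ n * v := by
    rw [hS, IndepFun.variance_sum (fun i _ => hmemi i)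
      (fun i _ j _ hij => hZ.indepFun_comp hF hij)]
    rw [Finset.sum_congr rfl fun i _ => (hZ.identDistrib_comp hF i).variance_eq]
    simp only [Finset.sum_const, Finset.card_range, nsmul_eq_mul]
    gcongr
    exact (variance_le_expectation_sq hmem.1).trans hv
  have h := meas_ge_le_variance_div_sq hSm (c := n * ε) (by positivity)
  refine (measure_mono fun ω hω => ?_).trans (h.trans (ENNReal.ofReal_le_ofReal ?_))
  · simp only [mem_ofPred_eq] at hω ⊢
    rw [hmean]
    have : S ω - n * ∫ ω, F (Z 0 ω) ∂μ = n * (sampleMean Z n F ω - ∫ ω, F (Z 0 ω) ∂μ) := by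
      simp only [hS, Finset.sum_apply, sampleMean]
      field_simp
    rw [this, abs_mul, abs_of_pos hn']
    gcongr
  · calc variance S μ / (n * ε) ^ 2 ≤ n * v / (n * ε) ^ 2 := by gcongr
      _ = v / (n * ε ^ 2) := by field_simp

end SampleMean

/-! ### Uniform law of large numbers for kernel averages -/

section UniformLLN

theorem exists_grid_point {a b c : ℝ} (hab : a < b) (hc : c ∈ Icc a b) {m : ℕ} (hm : 0 < m) :
    ∃ k ∈ Finset.range (m + 1), |c - (a + (b - a) * k / m)| ≤ (b - a) / m ∧
      a + (b - a) * k / m ∈ Icc a b := by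
  have hm' : (0 : ℝ) < m := by exact_mod_cast hm
  have hba : 0 < b - a := sub_pos.2 hab
  set x : ℝ := (c - a) / (b - a) * m with hx
  have hx0 : 0 ≤ x := by
    have : 0 ≤ c - a := sub_nonneg.2 hc.1
    positivity
  have hxm : x ≤ m := by
    have : (c - a) / (b - a) ≤ 1 := by rw [div_le_one hba]; linarith [hc.2]
    calc x ≤ 1 * m := by rw [hx]; gcongr
      _ = m := one_mul _
  have hfl : (⌊x⌋₊ : ℝ) ≤ x := Nat.floor_le hx0
  have hfl' : x < ⌊x⌋₊ + 1 := Nat.lt_floor_add_one x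
  have hcx : c = a + (b - a) * x / m := by rw [hx]; field_simp; ring
  refine ⟨⌊x⌋₊, ?_, ?_, ?_, ?_⟩
  · rw [Finset.mem_range, Nat.lt_succ_iff]
    exact Nat.floor_le_of_le hxm
  · have : c - (a + (b - a) * ⌊x⌋₊ / m) = (b - a) / m * (x - ⌊x⌋₊) := by
      nth_rewrite 1 [hcx]; ring
    rw [this, abs_of_nonneg (mul_nonneg (by positivity) (by linarith))]
    calc (b - a) / m * (x - ⌊x⌋₊) ≤ (b - a) / m * 1 := by gcongr; linarith
      _ = _ := mul_one _
  · have : 0 ≤ (b - a) * ⌊x⌋₊ / m := by positivity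
    linarith
  · have : (b - a) * ⌊x⌋₊ / m ≤ (b - a) * m / m := by
      gcongr
      exact Nat.floor_le_of_le hxm
    rw [mul_div_cancel_right₀ _ hm'.ne'] at this
    linarith

variable {Ω α : Type*} [MeasurableSpace Ω] [MeasurableSpace α] {μ : Measure Ω}
  {Z : ℕ → Ω → α}

/-- A uniform law of large numbers for kernel averages. -/
theorem IsIID.uniform_kernel_lln [IsProbabilityMeasure μ] (hZ : IsIID μ Z) {V g : α → ℝ}
    (hV : Measurable V) (hg : Measurable g) (hV2 : MemLp (fun ω => V (Z 0 ω)) 2 μ)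
    {K : ℝ → ℝ} (hKc : Continuous K) {CK LK : ℝ} (hKb : ∀ u, |K u| ≤ CK)
    (hKl : ∀ u v, |K u - K v| ≤ LK * |u - v|) {a b : ℝ} (hab : a < b) {h ε A v : ℕ → ℝ}
    (hh : ∀ᶠ n in atTop, 0 < h n) (hε : ∀ᶠ n in atTop, 0 < ε n) (hA : Tendsto A atTop atTop)
    (hv : ∀ᶠ n in atTop, ∀ c ∈ Icc a b,
      ∫ ω, (V (Z 0 ω) * K ((g (Z 0 ω) - c) / h n)) ^ 2 ∂μ ≤ v n)
    (h1 : Tendsto (fun n => 1 / (A n * ε n * h n)) atTop (𝓝 0))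
    (h2 : Tendsto (fun n => A n * v n / (n * ε n ^ 2)) atTop (𝓝 0)) :
    ∀ᶠ z in inProb μ, ∀ c ∈ Icc a b,
      |sampleMean Z z.1 (fun x => V x * K ((g x - c) / h z.1)) z.2 -
        ∫ ω, V (Z 0 ω) * K ((g (Z 0 ω) - c) / h z.1) ∂μ| ≤ ε z.1 := by
  have hLK : 0 ≤ LK := by
    have := (abs_nonneg _).trans (hKl 0 1)
    norm_num at this
    exact this
  have hφm : ∀ (c t : ℝ), Measurable (fun x => V x * K ((g x - c) / t)) := fun c t =>
    hV.mul (hKc.measurable.comp ((hg.sub_const c).div_const t))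
  have hφ2 : ∀ (c t : ℝ), MemLp (fun ω => V (Z 0 ω) * K ((g (Z 0 ω) - c) / t)) 2 μ := by
    intro c t
    refine (hV2.const_mul CK).of_le
      (((hφm c t).comp (hZ.measurable 0)).aestronglyMeasurable) (ae_of_all _ fun ω => ?_)
    rw [norm_mul, norm_mul, mul_comm]
    gcongr
    exact (hKb _).trans (le_abs_self _)
  set dev : ℕ → Ω → ℝ → ℝ := fun n ω c =>
    |sampleMean Z n (fun x => V x * K ((g x - c) / h n)) ω -
        ∫ ω, V (Z 0 ω) * K ((g (Z 0 ω) - c) / h n) ∂μ| with hdev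
  -- `A n` is the number of grid cells. The assumption `h1` makes the interpolation error between
  -- grid points negligible against `ε n`, and `h2` does the same for the union bound over the grid.
  set m : ℕ → ℕ := fun n => ⌈A n⌉₊ with hm
  have hA1 : ∀ᶠ n in atTop, 1 ≤ A n := hA.eventually_ge_atTop 1
  have hgrid : ∀ᶠ z in inProb μ, ∀ k ∈ Finset.range (m z.1 + 1),
      a + (b - a) * k / m z.1 ∈ Icc a b → dev z.1 z.2 (a + (b - a) * k / m z.1) ≤ ε z.1 / 2 := by
    refine (eventually_inProb_iff (P := fun n ω => ∀ k ∈ Finset.range (m n + 1),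
      a + (b - a) * k / m n ∈ Icc a b → dev n ω (a + (b - a) * k / m n) ≤ ε n / 2)).2 ?_
    have hlim : Tendsto (fun n => ENNReal.ofReal (12 * (A n * v n / (n * ε n ^ 2)))) atTop
        (𝓝 0) := by
      have := ENNReal.tendsto_ofReal (h2.const_mul 12)
      simpa using this
    refine tendsto_of_tendsto_of_tendsto_of_le_of_le' tendsto_const_nhds hlim
      (Eventually.of_forall fun n => zero_le) ?_
    filter_upwards [hh, hε, hA1, hv, eventually_gt_atTop 0] with n hhn hεn hAn hvn hn
    have hv0 : 0 ≤ v n := (integral_nonneg fun ω => sq_nonneg _).trans (hvn a ⟨le_rfl, hab.le⟩)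
    have hn' : (0 : ℝ) < n := by exact_mod_cast hn
    calc μ {ω | ¬ ∀ k ∈ Finset.range (m n + 1),
          a + (b - a) * k / m n ∈ Icc a b → dev n ω (a + (b - a) * k / m n) ≤ ε n / 2}
        ≤ μ (⋃ k ∈ Finset.range (m n + 1), {ω | a + (b - a) * k / m n ∈ Icc a b ∧
            ε n / 2 ≤ dev n ω (a + (b - a) * k / m n)}) := by
          refine measure_mono fun ω hω => ?_
          simp only [mem_ofPred_eq, not_forall, not_le] at hω
          obtain ⟨k, hk, hk1, hk2⟩ := hω
          simp only [mem_iUnion]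
          exact ⟨k, hk, hk1, hk2.le⟩
      _ ≤ ∑ k ∈ Finset.range (m n + 1), μ {ω | a + (b - a) * k / m n ∈ Icc a b ∧
            ε n / 2 ≤ dev n ω (a + (b - a) * k / m n)} := measure_biUnion_finset_le _ _
      _ ≤ ∑ k ∈ Finset.range (m n + 1), ENNReal.ofReal (v n / (n * (ε n / 2) ^ 2)) := by
          refine Finset.sum_le_sum fun k _ => ?_
          by_cases hk : a + (b - a) * k / m n ∈ Icc a b
          · simp only [hk, true_and, hdev]
            exact hZ.chebyshev (hφm _ _) (hφ2 _ _) (half_pos hεn) (hvn _ hk) hn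
          · simp [hk]
      _ = ENNReal.ofReal ((m n + 1 : ℕ) * (v n / (n * (ε n / 2) ^ 2))) := by
          rw [Finset.sum_const, Finset.card_range, nsmul_eq_mul, ENNReal.ofReal_mul (by positivity),
            ENNReal.ofReal_natCast]
      -- The constant is 12 = 3 · 4: at most 3 `A n` grid points since `A n ≥ 1`, and a factor 4
      -- from the tolerance `ε n / 2`.
      _ ≤ ENNReal.ofReal (12 * (A n * v n / (n * ε n ^ 2))) := by
          refine ENNReal.ofReal_le_ofReal ?_
          have h3 : ((m n + 1 : ℕ) : ℝ) ≤ 3 * A n := by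
            have := Nat.ceil_lt_add_one (a := A n) (by linarith)
            push_cast
            linarith
          calc ((m n + 1 : ℕ) : ℝ) * (v n / (n * (ε n / 2) ^ 2))
              ≤ 3 * A n * (v n / (n * (ε n / 2) ^ 2)) := by gcongr
            _ = _ := by field_simp; ring
  set D : ℝ := ∫ ω, |V (Z 0 ω)| ∂μ with hD
  have hVint : Integrable (fun ω => |V (Z 0 ω)|) μ := (hV2.integrable (by norm_num)).abs
  have hD0 : 0 ≤ D := integral_nonneg fun _ => abs_nonneg _
  have hmean := hZ.eventually_sampleMean_le (F := fun x => |V x|) hV.abs hVint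
  have hsmall : ∀ᶠ n in atTop, LK * (b - a) * (2 * D + 1) * (1 / (A n * ε n * h n)) ≤ 1 / 2 := by
    have := h1.const_mul (LK * (b - a) * (2 * D + 1))
    rw [mul_zero] at this
    exact this.eventually_le_const (by norm_num)
  filter_upwards [hgrid, hmean, tendsto_fst_inProb.eventually hsmall,
    tendsto_fst_inProb.eventually hh, tendsto_fst_inProb.eventually hε,
    tendsto_fst_inProb.eventually hA1] with ⟨n, ω⟩ hgr hme hsm hhn hεn hAn c hc
  simp only at hgr hme hsm hhn hεn hAn ⊢
  have hAm : A n ≤ m n := Nat.le_ceil _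
  have hm0 : 0 < m n := Nat.ceil_pos.2 (by linarith)
  have hm0' : (0 : ℝ) < m n := by exact_mod_cast hm0
  obtain ⟨k, hk, hck, hkI⟩ := exists_grid_point hab hc hm0
  have hdk := hgr k hk hkI
  set c' := a + (b - a) * k / m n with hc'
  have hA0 : 0 < A n := by linarith
  have hba : 0 < b - a := sub_pos.2 hab
  -- `Λ |V|` bounds the change of a summand when the location moves to the nearest chosen grid
  -- point. It enters through the sample mean, at most `D + 1`, and through the expectation, `D`,
  -- whence the factor `2 * D + 1`.
  set Λ : ℝ := LK * (b - a) / (m n * h n) with hΛ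
  have hΛ0 : 0 ≤ Λ := by positivity
  have hlip : ∀ x, |V x * K ((g x - c) / h n) - V x * K ((g x - c') / h n)| ≤ Λ * |V x| := by
    intro x
    rw [← mul_sub, abs_mul, mul_comm]
    refine mul_le_mul_of_nonneg_right ((hKl _ _).trans ?_) (abs_nonneg _)
    have : (g x - c) / h n - (g x - c') / h n = -((c - c') / h n) := by ring
    rw [this, abs_neg, abs_div, abs_of_pos hhn]
    calc LK * (|c - c'| / h n) ≤ LK * (((b - a) / m n) / h n) := by gcongr
      _ = Λ := by rw [hΛ]; field_simp
  have e1 : |sampleMean Z n (fun x => V x * K ((g x - c) / h n)) ω -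
      sampleMean Z n (fun x => V x * K ((g x - c') / h n)) ω| ≤ Λ * (D + 1) := by
    refine (abs_sampleMean_sub_le (D := fun x => Λ * |V x|) fun i _ => hlip _).trans ?_
    rw [sampleMean_const_mul]
    gcongr
  have e2 : |∫ ω, V (Z 0 ω) * K ((g (Z 0 ω) - c) / h n) ∂μ -
      ∫ ω, V (Z 0 ω) * K ((g (Z 0 ω) - c') / h n) ∂μ| ≤ Λ * D := by
    rw [← integral_sub ((hφ2 c _).integrable (by norm_num)) ((hφ2 c' _).integrable (by norm_num)),
      hD, ← integral_const_mul]
    refine (abs_integral_le_integral_abs).trans ?_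
    exact integral_mono_of_nonneg (ae_of_all _ fun _ => abs_nonneg _) (hVint.const_mul Λ)
      (ae_of_all _ fun ω => hlip _)
  have e3 : Λ * (2 * D + 1) ≤ ε n / 2 := by
    have : Λ * (2 * D + 1) ≤ LK * (b - a) / (A n * h n) * (2 * D + 1) := by
      rw [hΛ]; gcongr
    refine this.trans ?_
    have h4 : LK * (b - a) / (A n * h n) * (2 * D + 1) =
      LK * (b - a) * (2 * D + 1) * (1 / (A n * ε n * h n)) * ε n := by field_simp
    rw [h4]
    calc _ ≤ 1 / 2 * ε n := by gcongr
      _ = _ := by ring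
  simp only [hdev] at hdk
  rw [abs_le] at hdk e1 e2 ⊢
  constructor <;> linarith [hdk.1, hdk.2, e1.1, e1.2, e2.1, e2.2]

end UniformLLN

/-! ### Regularity and measurability of the index -/

section IndexRegularity

variable {p : ℕ}

/-- A twice continuously differentiable function on the ball of radius `r` around `βs` with
gradient bounded by `L` and pure second partial derivatives bounded by `M`. -/
structure IndexBound (g : Vec p → ℝ) (βs : Vec p) (r L M : ℝ) : Prop where
  smooth : ContDiffOn ℝ 2 g (Metric.ball βs r)
  grad : ∀ β ∈ Metric.ball βs r, ‖gradient g β‖ ≤ L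
  second : ∀ β ∈ Metric.ball βs r, ∀ j, |secondPartial g j β| ≤ M

theorem gradient_apply (g : Vec p → ℝ) (β : Vec p) (j : Fin p) :
    gradient g β j = fderiv ℝ g β (EuclideanSpace.single j 1) := by
  rw [← inner_gradient_left (𝕜 := ℝ), EuclideanSpace.inner_single_right]
  simp

theorem norm_le_sum_abs (v : Vec p) : ‖v‖ ≤ ∑ j, |v j| := by
  rw [EuclideanSpace.norm_eq]
  refine Real.sqrt_le_iff.2 ⟨Finset.sum_nonneg fun _ _ => abs_nonneg _, ?_⟩
  simpa using Finset.sum_sq_le_sq_sum_of_nonneg (s := Finset.univ) (f := fun j => |v j|)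
    fun _ _ => abs_nonneg _

theorem abs_apply_le_norm (v : Vec p) (j : Fin p) : |v j| ≤ ‖v‖ := by
  simpa using PiLp.norm_apply_le v j

theorem differentiableAt_of_contDiffOn_ball {g : Vec p → ℝ} {βs β : Vec p} {r : ℝ}
    (h : ContDiffOn ℝ 2 g (Metric.ball βs r)) (hβ : β ∈ Metric.ball βs r) :
    DifferentiableAt ℝ g β :=
  (h.differentiableOn (by norm_num)).differentiableAt (Metric.isOpen_ball.mem_nhds hβ)

theorem contDiffOn_partial {g : Vec p → ℝ} {βs : Vec p} {r : ℝ}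
    (h : ContDiffOn ℝ 2 g (Metric.ball βs r)) (v : Vec p) :
    ContDiffOn ℝ 1 (fun b => fderiv ℝ g b v) (Metric.ball βs r) :=
  (h.fderiv_of_isOpen Metric.isOpen_ball (by norm_num)).clm_apply contDiffOn_const

theorem IndexBound.abs_sub_le {g : Vec p → ℝ} {βs : Vec p} {r L M : ℝ}
    (h : IndexBound g βs r L M) {β β' : Vec p} (hβ : β ∈ Metric.ball βs r)
    (hβ' : β' ∈ Metric.ball βs r) : |g β - g β'| ≤ L * ‖β - β'‖ := by
  have := (convex_ball βs r).norm_image_sub_le_of_norm_fderiv_le (𝕜 := ℝ) (f := g) (C := L)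
    (fun b hb => differentiableAt_of_contDiffOn_ball h.smooth hb)
    (fun b hb => by
      rw [← toDual_gradient, LinearIsometryEquiv.norm_map]
      exact h.grad b hb) hβ' hβ
  simpa using this

/-- First order Taylor bound along a coordinate direction. -/
theorem IndexBound.abs_taylor_le {g : Vec p → ℝ} {βs : Vec p} {r L M : ℝ}
    (h : IndexBound g βs r L M) (j : Fin p) {β : Vec p} {s : ℝ} (hs : 0 ≤ s)
    (hβ : ‖β - βs‖ + s < r) :
    |g (β + s • EuclideanSpace.single j 1) - g β - s * gradient g β j| ≤ M * s ^ 2 := by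
  set e : Vec p := EuclideanSpace.single j 1 with he
  have hen : ‖e‖ = 1 := by simp [he]
  have hmem : ∀ t ∈ Icc 0 s, β + t • e ∈ Metric.ball βs r := by
    intro t ht
    rw [mem_ball_iff_norm]
    calc ‖β + t • e - βs‖ = ‖(β - βs) + t • e‖ := by congr 1; abel
      _ ≤ ‖β - βs‖ + t := by
        refine (norm_add_le _ _).trans ?_
        rw [norm_smul, hen, mul_one, Real.norm_of_nonneg ht.1]
      _ < r := by linarith [ht.2]
  have hline : ∀ t : ℝ, HasDerivAt (fun t : ℝ => β + t • e) e t := fun t => by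
    simpa using ((hasDerivAt_id t).smul_const e).const_add β
  have hM : 0 ≤ M := (abs_nonneg _).trans
    (h.second β (by simpa using hmem 0 ⟨le_rfl, hs⟩) j)
  set D : Vec p → ℝ := fun b => fderiv ℝ g b e with hD
  have hDd : ∀ t ∈ Icc 0 s, HasDerivAt (fun t : ℝ => D (β + t • e))
      (secondPartial g j (β + t • e)) t := by
    intro t ht
    have h1 : DifferentiableAt ℝ D (β + t • e) :=
      ((contDiffOn_partial h.smooth e).differentiableOn (by norm_num)).differentiableAt
        (Metric.isOpen_ball.mem_nhds (hmem t ht))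
    exact h1.hasFDerivAt.comp_hasDerivAt t (hline t)
  have hDb : ∀ t ∈ Icc 0 s, |D (β + t • e) - D β| ≤ M * s := by
    intro t ht
    have := (convex_Icc (0 : ℝ) s).norm_image_sub_le_of_norm_hasDerivWithin_le (C := M)
      (fun u hu => (hDd u hu).hasDerivWithinAt)
      (fun u hu => by simpa using h.second _ (hmem u hu) j) ⟨le_rfl, hs⟩ ht
    simp only [zero_smul, add_zero, sub_zero, Real.norm_eq_abs] at this
    rw [abs_of_nonneg ht.1] at this
    exact this.trans (mul_le_mul_of_nonneg_left ht.2 hM)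
  have hφ : ∀ t ∈ Icc 0 s, HasDerivAt (fun t : ℝ => g (β + t • e) - t * D β)
      (D (β + t • e) - D β) t := by
    intro t ht
    have h1 := (differentiableAt_of_contDiffOn_ball h.smooth (hmem t ht)).hasFDerivAt.comp_hasDerivAt
      t (hline t)
    have h2 := (hasDerivAt_id t).mul_const (D β)
    simp only [id, one_mul] at h2
    exact h1.sub h2
  have := (convex_Icc (0 : ℝ) s).norm_image_sub_le_of_norm_hasDerivWithin_le (C := M * s)
      (fun u hu => (hφ u hu).hasDerivWithinAt)
      (fun u hu => by simpa using hDb u hu) ⟨le_rfl, hs⟩ ⟨hs, le_rfl⟩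
  simp only [zero_smul, add_zero, sub_zero, zero_mul, Real.norm_eq_abs] at this
  rw [abs_of_nonneg hs] at this
  rw [gradient_apply]
  calc _ = |g (β + s • e) - s * D β - g β| := by congr 1; ring
    _ ≤ M * s * s := this
    _ = _ := by ring

/-- The gradient is Hölder continuous of order `1 / 2`. -/
theorem IndexBound.abs_gradient_sub_le {g : Vec p → ℝ} {βs : Vec p} {r L M : ℝ}
    (h : IndexBound g βs r L M) (j : Fin p) {β : Vec p} {Δ : ℝ} (hΔ : 0 < Δ)
    (hβ : ‖β - βs‖ ≤ Δ) (hr : Δ + Real.sqrt Δ < r) :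
    |gradient g β j - gradient g βs j| ≤ 2 * (L + M) * Real.sqrt Δ := by
  -- Mixed second derivatives are not controlled, so the two partial derivatives are compared
  -- through difference quotients of step s in direction j. The quotients differ by at most 2 L Δ /
  -- s, and each has Taylor error at most M s; the step √Δ balances these.
  set s := Real.sqrt Δ with hs
  have hs0 : 0 < s := Real.sqrt_pos.2 hΔ
  have hsq : s ^ 2 = Δ := Real.sq_sqrt hΔ.le
  set e : Vec p := EuclideanSpace.single j 1 with he
  have hen : ‖e‖ = 1 := by simp [he]
  have t1 := h.abs_taylor_le j hs0.le (β := β) (by linarith)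
  have t2 := h.abs_taylor_le j hs0.le (β := βs) (by simp; linarith)
  rw [← he] at t1 t2
  have hse : ‖s • e‖ = s := by rw [norm_smul, hen, mul_one, Real.norm_of_nonneg hs0.le]
  have m1 : β ∈ Metric.ball βs r := by rw [mem_ball_iff_norm]; linarith
  have m2 : βs ∈ Metric.ball βs r := Metric.mem_ball_self (by linarith)
  have m3 : β + s • e ∈ Metric.ball βs r := by
    rw [mem_ball_iff_norm]
    calc ‖β + s • e - βs‖ = ‖(β - βs) + s • e‖ := by congr 1; abel
      _ ≤ ‖β - βs‖ + ‖s • e‖ := norm_add_le _ _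
      _ < r := by linarith
  have m4 : βs + s • e ∈ Metric.ball βs r := by
    rw [mem_ball_iff_norm, add_sub_cancel_left, hse]; linarith
  have hL : 0 ≤ L := (norm_nonneg _).trans (h.grad _ m1)
  have d1 : |g β - g βs| ≤ L * Δ := (h.abs_sub_le m1 m2).trans (by gcongr)
  have d2 : |g (β + s • e) - g (βs + s • e)| ≤ L * Δ := by
    refine (h.abs_sub_le m3 m4).trans ?_
    rw [add_sub_add_right_eq_sub]
    gcongr
  have key : s * |gradient g β j - gradient g βs j| ≤ s * (2 * (L + M) * s) := by
    have : s * (2 * (L + M) * s) = 2 * (L + M) * Δ := by rw [← hsq]; ring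
    rw [this]
    have habs : s * |gradient g β j - gradient g βs j| =
        |s * (gradient g β j - gradient g βs j)| := by rw [abs_mul, abs_of_pos hs0]
    rw [habs]
    rw [hsq] at t1 t2
    rw [abs_le] at t1 t2 d1 d2 ⊢
    constructor <;> linarith [t1.1, t1.2, t2.1, t2.2, d1.1, d1.2, d2.1, d2.2]
  exact le_of_mul_le_mul_left key hs0

/-- The directional derivative is a pointwise limit of difference quotients along a sequence of
steps. Measurability near `β` suffices, which allows a second application to partial derivatives
that are known to be measurable only for parameters in the ball. -/
theorem measurable_fderiv_apply_of_eventually {α E : Type*} [MeasurableSpace α]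
    [NormedAddCommGroup E] [NormedSpace ℝ E] {g : α → E → ℝ} {β : E} (v : E)
    (hm : ∀ᶠ b in 𝓝 β, Measurable (fun x => g x b)) (hd : ∀ x, DifferentiableAt ℝ (g x) β) :
    Measurable (fun x => fderiv ℝ (g x) β v) := by
  have ht : Tendsto (fun n : ℕ => (1 : ℝ) / ((n : ℝ) + 1)) atTop (𝓝[≠] 0) := by
    refine tendsto_nhdsWithin_iff.2 ⟨tendsto_one_div_add_atTop_nhds_zero_nat, ?_⟩
    exact Eventually.of_forall fun n => by
      have : (0 : ℝ) < 1 / ((n : ℝ) + 1) := by positivity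
      exact this.ne'
  have htb : Tendsto (fun n : ℕ => β + ((1 : ℝ) / ((n : ℝ) + 1)) • v) atTop (𝓝 β) := by
    have := (tendsto_one_div_add_atTop_nhds_zero_nat (𝕜 := ℝ)).smul_const v
    simpa using this.const_add β
  obtain ⟨N, hN⟩ := eventually_atTop.1 (htb.eventually hm)
  refine measurable_of_tendsto_metrizable (f := fun n x =>
    ((1 : ℝ) / (((n + N : ℕ) : ℝ) + 1))⁻¹ •
      (g x (β + ((1 : ℝ) / (((n + N : ℕ) : ℝ) + 1)) • v) - g x β))
    (fun n => ((hN (n + N) (by omega)).sub hm.self_of_nhds).const_smul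
      ((1 : ℝ) / (((n + N : ℕ) : ℝ) + 1))⁻¹) ?_
  refine tendsto_pi_nhds.2 fun x => ?_
  have := ((hd x).hasFDerivAt.hasLineDerivAt v).tendsto_slope_zero
  exact (this.comp ht).comp (tendsto_add_atTop_nat N)

theorem forall_le_of_dense {E : Type*} [TopologicalSpace E] {U D : Set E} (hU : IsOpen U)
    (hD : Dense D) {φ : E → ℝ} (hφ : ContinuousOn φ U) {c : ℝ} (h : ∀ b ∈ D ∩ U, φ b ≤ c) :
    ∀ b ∈ U, φ b ≤ c := by
  intro b hb
  by_contra! hlt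
  have hopen : IsOpen (U ∩ φ ⁻¹' Ioi c) := hφ.isOpen_inter_preimage hU isOpen_Ioi
  obtain ⟨d, ⟨hd1, hd2⟩, hd⟩ := hD.inter_open_nonempty _ hopen ⟨b, hb, hlt⟩
  exact absurd (h d ⟨hd, hd1⟩) (not_le.2 hd2)

/-- By continuity in the parameter, the uncountable intersection reduces to one over a countable
dense set. -/
theorem measurableSet_forall_le {α E : Type*} [MeasurableSpace α] [TopologicalSpace E]
    [SecondCountableTopology E] {U : Set E} (hU : IsOpen U) {φ : α → E → ℝ} {L : α → ℝ}
    (hL : Measurable L) (hm : ∀ b ∈ U, Measurable fun x => φ x b)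
    (hc : ∀ x, ContinuousOn (φ x) U) : MeasurableSet {x | ∀ b ∈ U, φ x b ≤ L x} := by
  obtain ⟨D, hDc, hDd⟩ := TopologicalSpace.exists_countable_dense E
  have : {x | ∀ b ∈ U, φ x b ≤ L x} = ⋂ b ∈ D ∩ U, {x | φ x b ≤ L x} := by
    ext x
    simp only [mem_ofPred_eq, mem_iInter]
    exact ⟨fun h b hb => h b hb.2, fun h => forall_le_of_dense hU hDd (hc x) h⟩
  rw [this]
  exact MeasurableSet.biInter (hDc.mono inter_subset_left) fun b hb =>
    measurableSet_le (hm b hb.2) hL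

variable {Ω : Type*} [MeasurableSpace Ω] {μ : Measure Ω} {k : ℕ} {G : Vec k → Vec p → ℝ}
  {βs : Vec p} {r : ℝ}

theorem measurable_partial (hm : ∀ β, Measurable (fun x => G x β))
    (hs : ∀ x, ContDiffOn ℝ 2 (G x) (Metric.ball βs r)) {β : Vec p}
    (hβ : β ∈ Metric.ball βs r) (v : Vec p) : Measurable (fun x => fderiv ℝ (G x) β v) :=
  measurable_fderiv_apply_of_eventually v (Eventually.of_forall hm)
    fun x => differentiableAt_of_contDiffOn_ball (hs x) hβ

theorem measurable_gradient_apply (hm : ∀ β, Measurable (fun x => G x β))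
    (hs : ∀ x, ContDiffOn ℝ 2 (G x) (Metric.ball βs r)) {β : Vec p}
    (hβ : β ∈ Metric.ball βs r) (j : Fin p) : Measurable (fun x => gradient (G x) β j) := by
  simp only [gradient_apply]
  exact measurable_partial hm hs hβ _

/-- The index bounds hold along the whole sample. -/
theorem IndexSmooth.ae_indexBound {X : ℕ → Ω → Vec k} (hG : IndexSmooth μ (X 0) G βs r)
    (hX : ∀ i, IdentDistrib (X i) (X 0) μ μ) :
    ∃ (L : Vec k → ℝ) (M : ℝ), Measurable L ∧ 0 < M ∧ MemLp (fun ω => L (X 0 ω)) 2 μ ∧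
      ∀ᵐ ω ∂μ, ∀ i, IndexBound (G (X i ω)) βs r (L (X i ω)) M := by
  obtain ⟨M, hM, hsec⟩ := hG.second_bound
  obtain ⟨L, hL, hL2, hgr⟩ := hG.envelope
  refine ⟨L, M, hL, hM, hL2, ?_⟩
  have hball : IsOpen (Metric.ball βs r) := Metric.isOpen_ball
  -- The bounds are assumed almost surely for the first observation only. Equality in law transfers
  -- them to every observation once they are known to define measurable sets of covariates.
  have m1 : MeasurableSet {x | ∀ β ∈ Metric.ball βs r, ‖gradient (G x) β‖ ≤ L x} := by
    refine measurableSet_forall_le hball hL (fun b hb => ?_) fun x => ?_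
    · simp only [EuclideanSpace.norm_eq]
      refine (Finset.measurable_fun_sum _ fun j _ => ?_).sqrt
      exact ((measurable_gradient_apply hG.measurable_G hG.smooth hb j).norm).pow_const 2
    · have : (fun β => ‖gradient (G x) β‖) = fun β => ‖fderiv ℝ (G x) β‖ := by
        funext β
        rw [← toDual_gradient, LinearIsometryEquiv.norm_map]
      rw [this]
      exact ((hG.smooth x).continuousOn_fderiv_of_isOpen hball (by norm_num)).norm
  have m2 : ∀ j, MeasurableSet {x | ∀ β ∈ Metric.ball βs r, |secondPartial (G x) j β| ≤ M} := by
    intro j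
    refine measurableSet_forall_le (φ := fun x β => |secondPartial (G x) j β|) (L := fun _ => M)
      hball measurable_const (fun b hb => ?_) fun x => ?_
    · refine Measurable.abs ?_
      refine measurable_fderiv_apply_of_eventually _ ?_ fun x => ?_
      · filter_upwards [hball.mem_nhds hb] with b' hb'
        exact measurable_partial hG.measurable_G hG.smooth hb' _
      · exact ((contDiffOn_partial (hG.smooth x) _).differentiableOn
          (by norm_num)).differentiableAt (hball.mem_nhds hb)
    · exact (((contDiffOn_partial (hG.smooth x) _).continuousOn_fderiv_of_isOpen hball
        (by norm_num)).clm_apply continuousOn_const).abs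
  have m3 : MeasurableSet {x | ∀ j, ∀ β ∈ Metric.ball βs r, |secondPartial (G x) j β| ≤ M} := by
    simp only [ofPred_forall]
    simpa only [ofPred_forall] using MeasurableSet.iInter m2
  have h1 : ∀ᵐ ω ∂μ, ∀ i, ∀ β ∈ Metric.ball βs r, ‖gradient (G (X i ω)) β‖ ≤ L (X i ω) :=
    ae_all_iff.2 fun i => (hX i).symm.ae_snd m1 hgr
  have h2 : ∀ᵐ ω ∂μ, ∀ i, ∀ j, ∀ β ∈ Metric.ball βs r, |secondPartial (G (X i ω)) j β| ≤ M :=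
    ae_all_iff.2 fun i => (hX i).symm.ae_snd m3 (hsec.mono fun ω h j β hβ => h β hβ j)
  filter_upwards [h1, h2] with ω h1 h2 i
  exact ⟨hG.smooth _, h1 i, fun β hβ j => h2 i j β hβ⟩

end IndexRegularity

/-! ### The population gradient in weak form -/

section PopulationGradient

variable {Ω : Type*} [MeasurableSpace Ω]

theorem hasDerivAt_integral_Iic {φ : ℝ → ℝ} (hφ : Continuous φ) (hi : Integrable φ) (x : ℝ) :
    HasDerivAt (fun x => ∫ u in Iic x, φ u) (φ x) x := by
  have h : (fun x => ∫ u in Iic x, φ u) = fun x => (∫ u in (0 : ℝ)..x, φ u) + ∫ u in Iic 0, φ u := by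
    funext x
    rw [← intervalIntegral.integral_Iic_sub_Iic hi.integrableOn hi.integrableOn]
    ring
  rw [h]
  exact ((hφ.integral_hasStrictDerivAt 0 x).hasDerivAt).add_const _

theorem abs_setIntegral_le_integral_abs {φ : ℝ → ℝ} (hi : Integrable φ) (s : Set ℝ) :
    |∫ u in s, φ u| ≤ ∫ u, |φ u| :=
  abs_integral_le_integral_abs.trans
    (setIntegral_le_integral hi.abs (ae_of_all _ fun _ => abs_nonneg _))

/-- Fubini for φ(u) 1{u < g(ω)}. The end point of the inner interval is null, which reconciles `Iic`
with the strict inequality defining the rates. -/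
theorem integral_integral_Iic_eq (ν : Measure Ω) [IsProbabilityMeasure ν] {g : Ω → ℝ}
    (hg : Measurable g) {φ : ℝ → ℝ} (hφ : Continuous φ) {a b C : ℝ} (hC : ∀ u, |φ u| ≤ C)
    (h0 : ∀ u, u ∉ Icc a b → φ u = 0) :
    ∫ ω, (∫ u in Iic (g ω), φ u) ∂ν = ∫ u in Icc a b, φ u * ν.real {ω | u < g ω} := by
  have h1 : ∀ x, ∫ u in Iic x, φ u = ∫ u in Icc a b, φ u * (Iio x).indicator (fun _ => 1) u := by
    intro x
    rw [setIntegral_eq_integral_of_forall_compl_eq_zero (s := Icc a b)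
        fun u hu => by rw [h0 u hu, zero_mul],
      integral_Iic_eq_integral_Iio, ← integral_indicator measurableSet_Iio]
    refine integral_congr_ae (ae_of_all _ fun u => ?_)
    by_cases hu : u ∈ Iio x <;> simp [hu]
  simp only [h1]
  have hset : MeasurableSet {z : Ω × ℝ | z.2 < g z.1} :=
    measurableSet_lt measurable_snd (hg.comp measurable_fst)
  have hC0 : 0 ≤ C := (abs_nonneg _).trans (hC 0)
  rw [integral_integral_swap]
  · refine integral_congr_ae (ae_of_all _ fun u => ?_)
    simp only
    rw [integral_const_mul]
    congr 1
    have : (fun ω => (Iio (g ω)).indicator (fun _ => (1 : ℝ)) u) =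
        {ω | u < g ω}.indicator (fun _ => 1) := by
      funext ω
      simp [indicator]
    rw [this, integral_indicator (measurableSet_lt measurable_const hg)]
    simp
  · refine Integrable.of_bound (C := C) ?_ (ae_of_all _ fun z => ?_)
    · refine Measurable.aestronglyMeasurable ?_
      have : (Function.uncurry fun ω u => φ u * (Iio (g ω)).indicator (fun _ => (1 : ℝ)) u) =
          fun z : Ω × ℝ => φ z.2 * {z : Ω × ℝ | z.2 < g z.1}.indicator (fun _ => 1) z := by
        funext z
        simp [Function.uncurry, indicator]
      rw [this]
      exact (hφ.measurable.comp measurable_snd).mul (measurable_const.indicator hset)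
    · simp only [Function.uncurry, norm_mul]
      calc ‖φ z.2‖ * ‖(Iio (g z.1)).indicator (fun _ => (1 : ℝ)) z.2‖ ≤ C * 1 := by
            gcongr
            · exact hC _
            · by_cases h : z.2 ∈ Iio (g z.1) <;> simp [h]
        _ = C := mul_one C

/-- Differentiation of a rate function in the parameter, tested against a continuous function
supported in `[a, b]`. -/
theorem integral_mul_partial_eq {k p : ℕ} (ν : Measure Ω) [IsProbabilityMeasure ν]
    {X : Ω → Vec k} (hX : Measurable X) {G : Vec k → Vec p → ℝ}
    (hm : ∀ β, Measurable (fun x => G x β)) {βs : Vec p} {r M : ℝ} {L : Vec k → ℝ} (hr : 0 < r)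
    (hs : ∀ x, ContDiffOn ℝ 2 (G x) (Metric.ball βs r))
    (hb : ∀ᵐ ω ∂ν, IndexBound (G (X ω)) βs r (L (X ω)) M)
    (hL : Integrable (fun ω => L (X ω)) ν) {a b : ℝ} {R : ℝ → Vec p → ℝ}
    (hR : ∀ c β, R c β = ν.real {ω | c < G (X ω) β}) (hgrad : GradientUnif R (Icc a b) βs r)
    {φ : ℝ → ℝ} (hφ : Continuous φ) {C : ℝ} (hC : ∀ u, |φ u| ≤ C)
    (h0 : ∀ u, u ∉ Icc a b → φ u = 0) (j : Fin p) :
    ∫ ω, φ (G (X ω) βs) * gradient (G (X ω)) βs j ∂ν =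
      ∫ u in Icc a b, φ u * gradient (R u) βs j := by
  have hC0 : 0 ≤ C := (abs_nonneg _).trans (hC 0)
  set e : Vec p := EuclideanSpace.single j 1 with he
  have hen : ‖e‖ = 1 := by simp [he]
  have hmem : ∀ t ∈ Metric.ball (0 : ℝ) r, βs + t • e ∈ Metric.ball βs r := by
    intro t ht
    rw [mem_ball_iff_norm, add_sub_cancel_left, norm_smul, hen, mul_one]
    simpa using ht
  have hline : ∀ t : ℝ, HasDerivAt (fun t : ℝ => βs + t • e) e t := fun t => by
    simpa using ((hasDerivAt_id t).smul_const e).const_add βs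
  have hi : Integrable φ := hφ.integrable_of_hasCompactSupport
    (HasCompactSupport.intro isCompact_Icc h0)
  -- Along the line t ↦ βs + t e_j, both E Ψ(G(X, ·)) and ∫ φ R(u, ·) du are differentiated under
  -- the integral sign, with dominating functions C L and the constant C `MR`. As they are the same
  -- function of t, their derivatives at 0 agree.
  set Ψ : ℝ → ℝ := fun x => ∫ u in Iic x, φ u with hΨ
  have hΨd : ∀ x, HasDerivAt Ψ (φ x) x := hasDerivAt_integral_Iic hφ hi
  have hΨc : Continuous Ψ := continuous_iff_continuousAt.2 fun x => (hΨd x).continuousAt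
  have hGX : ∀ β, Measurable fun ω => G (X ω) β := fun β => (hm β).comp hX
  have hβs : βs ∈ Metric.ball βs r := Metric.mem_ball_self hr
  have d1 := hasDerivAt_integral_of_dominated_loc_of_deriv_le (μ := ν)
    (F := fun (t : ℝ) ω => Ψ (G (X ω) (βs + t • e)))
    (F' := fun (t : ℝ) ω => φ (G (X ω) (βs + t • e)) * gradient (G (X ω)) (βs + t • e) j)
    (x₀ := 0) (bound := fun ω => C * L (X ω)) (Metric.ball_mem_nhds (0 : ℝ) hr)
    (Eventually.of_forall fun t => (hΨc.measurable.comp (hGX _)).aestronglyMeasurable)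
    (Integrable.of_bound (C := ∫ u, |φ u|) (hΨc.measurable.comp (hGX _)).aestronglyMeasurable
      (ae_of_all _ fun ω => abs_setIntegral_le_integral_abs hi _))
    (by
      simp only [zero_smul, add_zero]
      exact ((hφ.measurable.comp (hGX _)).mul
        ((measurable_gradient_apply hm hs hβs j).comp hX)).aestronglyMeasurable)
    (by
      filter_upwards [hb] with ω hω t ht
      rw [norm_mul]
      gcongr
      · exact hC _
      · exact (abs_apply_le_norm _ _).trans (hω.grad _ (hmem t ht)))
    (hL.const_mul C)
    (by
      refine ae_of_all _ fun ω t ht => ?_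
      have h1 := (differentiableAt_of_contDiffOn_ball (hs (X ω)) (hmem t ht)).hasFDerivAt
        |>.comp_hasDerivAt t (hline t)
      rw [gradient_apply]
      exact (hΨd _).comp t h1)
  obtain ⟨MR, hMR, hRb⟩ := hgrad.bounded
  have hRm : ∀ β, Measurable fun u => R u β := by
    intro β
    -- As a tail probability, the rate is monotone in the threshold, so it is measurable in u for
    -- every parameter value.
    refine Antitone.measurable fun u v huv => ?_
    rw [hR, hR]
    exact measureReal_mono fun ω hω => lt_of_le_of_lt huv hω
  have hRle : ∀ u β, |R u β| ≤ 1 := by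
    intro u β
    rw [hR, abs_of_nonneg measureReal_nonneg]
    exact measureReal_le_one
  have d2 := hasDerivAt_integral_of_dominated_loc_of_deriv_le (μ := volume.restrict (Icc a b))
    (F := fun (t : ℝ) u => φ u * R u (βs + t • e))
    (F' := fun (t : ℝ) u => φ u * gradient (R u) (βs + t • e) j)
    (x₀ := 0) (bound := fun _ => C * MR) (Metric.ball_mem_nhds (0 : ℝ) hr)
    (Eventually.of_forall fun t => (hφ.measurable.mul (hRm _)).aestronglyMeasurable)
    (Integrable.of_bound (C := C * 1) (hφ.measurable.mul (hRm _)).aestronglyMeasurable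
      (ae_of_all _ fun u => by
        rw [norm_mul]
        gcongr
        · exact hC _
        · exact hRle _ _))
    (by
      simp only [zero_smul, add_zero]
      refine ContinuousOn.aestronglyMeasurable ?_ measurableSet_Icc
      refine hφ.continuousOn.mul ?_
      have h1 : ContinuousOn (fun u : ℝ => gradient (R u) βs) (Icc a b) :=
        hgrad.continuous.comp (f := fun u : ℝ => (u, βs))
          (Continuous.continuousOn (by fun_prop)) fun u hu => ⟨hu, hβs⟩
      exact (EuclideanSpace.proj (𝕜 := ℝ) j).continuous.comp_continuousOn h1)
    (by
      filter_upwards [ae_restrict_mem measurableSet_Icc] with u hu t ht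
      rw [norm_mul]
      gcongr
      · exact hC _
      · exact (abs_apply_le_norm _ _).trans (hRb u hu _ (hmem t ht)))
    (integrable_const _)
    (by
      filter_upwards [ae_restrict_mem measurableSet_Icc] with u hu t ht
      have h1 := (hgrad.differentiable u hu _ (hmem t ht)).hasFDerivAt
        |>.comp_hasDerivAt t (hline t)
      rw [gradient_apply]
      exact h1.const_mul _)
  have heq : (fun t : ℝ => ∫ ω, Ψ (G (X ω) (βs + t • e)) ∂ν) =
      fun t : ℝ => ∫ u in Icc a b, φ u * R u (βs + t • e) := by
    funext t
    simp only [hR]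
    exact integral_integral_Iic_eq ν (hGX _) hφ hC h0
  have d3 := d1.2
  rw [heq] at d3
  have := d3.unique d2.2
  simpa using this

end PopulationGradient

/-! ### Kernel, bandwidth and the polynomial scale -/

section Kernel

variable {K : ℝ → ℝ} {h : ℕ → ℝ}

theorem KernelBandwidth.hasCompactSupport (hK : KernelBandwidth K h) : HasCompactSupport K :=
  isCompact_Icc.of_isClosed_subset (isClosed_tsupport K) hK.support

theorem KernelBandwidth.continuous (hK : KernelBandwidth K h) : Continuous K :=
  hK.smooth.continuous

theorem KernelBandwidth.eq_zero (hK : KernelBandwidth K h) {u : ℝ} (hu : 1 < |u|) : K u = 0 := by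
  refine image_eq_zero_of_notMem_tsupport fun hmem => ?_
  have := abs_le.2 (hK.support hmem)
  linarith

theorem KernelBandwidth.exists_bound (hK : KernelBandwidth K h) :
    ∃ C : ℝ, 0 < C ∧ (∀ u, |K u| ≤ C) ∧ ∀ u v, |K u - K v| ≤ C * |u - v| := by
  obtain ⟨C₁, h₁⟩ := hK.hasCompactSupport.exists_bound_of_continuous hK.continuous
  obtain ⟨C₂, h₂⟩ := hK.smooth.lipschitzWith_of_hasCompactSupport hK.hasCompactSupport (by simp)
  refine ⟨max (max C₁ C₂) 1, by positivity, fun u => (h₁ u).trans (by simp), fun u v => ?_⟩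
  refine (h₂.dist_le_mul u v).trans ?_
  rw [Real.dist_eq]
  gcongr
  simp

theorem KernelBandwidth.integral_scaled (hK : KernelBandwidth K h) (c : ℝ) {t : ℝ} (ht : 0 < t) :
    ∫ u, K ((u - c) / t) = t := by
  rw [integral_sub_right_eq_self (fun u => K (u / t)) c, Measure.integral_comp_div, hK.integral_one,
    abs_of_pos ht, smul_eq_mul, mul_one]

theorem KernelBandwidth.integrable_scaled (hK : KernelBandwidth K h) (c : ℝ) {t : ℝ} (ht : 0 < t) :
    Integrable (fun u => K ((u - c) / t)) :=
  ((hK.continuous.integrable_of_hasCompactSupport hK.hasCompactSupport).comp_div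
    ht.ne').comp_sub_right c

theorem KernelBandwidth.scaled_eq_zero (hK : KernelBandwidth K h) {c t u : ℝ} (ht : 0 < t)
    (hu : t < |u - c|) : K ((u - c) / t) = 0 := by
  refine hK.eq_zero ?_
  rwa [abs_div, abs_of_pos ht, one_lt_div ht]

/-- Positivity of the bandwidth is not an axiom of `KernelBandwidth`; it is forced by n h / log n →
∞, as log n ≥ 0. -/
theorem KernelBandwidth.eventually_pos (hK : KernelBandwidth K h) : ∀ᶠ n in atTop, 0 < h n := by
  filter_upwards [hK.bandwidth_log.eventually_gt_atTop 0, eventually_gt_atTop 1] with n hn hn1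
  have hn' : (1 : ℝ) < n := by exact_mod_cast hn1
  by_contra! hneg
  have : (n : ℝ) * h n / Real.log n ≤ 0 :=
    div_nonpos_of_nonpos_of_nonneg (mul_nonpos_of_nonneg_of_nonpos (by linarith) hneg)
      (Real.log_nonneg hn'.le)
  linarith

/-- The polynomial scale `n ^ (1 / 32)`, in which all rates are expressed. -/
def rateBase (n : ℕ) : ℝ := (n : ℝ) ^ (1 / 32 : ℝ)

theorem rateBase_pow (n : ℕ) : rateBase n ^ 32 = n := by
  rw [rateBase, ← Real.rpow_natCast, ← Real.rpow_mul (Nat.cast_nonneg n)]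
  norm_num

theorem tendsto_rateBase : Tendsto rateBase atTop atTop :=
  (tendsto_rpow_atTop (by norm_num)).comp tendsto_natCast_atTop_atTop

/-- The rate bound for the first stage estimator. -/
def firstRate (h : ℕ → ℝ) (n : ℕ) : ℝ := h n / rateBase n ^ 8

/-- The fourth power of n^(1/4) h is n h^4, which tends to infinity. -/
theorem KernelBandwidth.tendsto_rateBase_mul (hK : KernelBandwidth K h) :
    Tendsto (fun n => rateBase n ^ 8 * h n) atTop atTop := by
  refine tendsto_atTop.2 fun C => ?_
  filter_upwards [hK.bandwidth_four.eventually_ge_atTop (C ^ 4), hK.eventually_pos,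
    tendsto_rateBase.eventually_gt_atTop 0] with n hn hh hw
  refine le_of_pow_le_pow_left₀ (n := 4) (by norm_num) (by positivity) (hn.trans_eq ?_)
  rw [mul_pow, ← pow_mul, rateBase_pow]

/-- All asymptotic relations between sample size and bandwidth are derived from this
parametrisation, with `x` tending to infinity. -/
theorem KernelBandwidth.eventually_param (hK : KernelBandwidth K h) (T : ℝ) :
    ∀ᶠ n in atTop, ∃ w x : ℝ, T ≤ w ∧ 1 ≤ w ∧ 1 ≤ x ∧ rateBase n = w ∧ (n : ℝ) = w ^ 32 ∧
      h n = x / w ^ 8 ∧ rateBase n ^ 8 * h n = x ∧ firstRate h n = x / w ^ 16 := by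
  filter_upwards [hK.tendsto_rateBase_mul.eventually_ge_atTop 1,
    tendsto_rateBase.eventually_ge_atTop (max T 1)] with n hx hw
  have hw1 : 1 ≤ rateBase n := (le_max_right _ _).trans hw
  have hw0 : rateBase n ≠ 0 := by linarith
  refine ⟨rateBase n, rateBase n ^ 8 * h n, (le_max_left _ _).trans hw, hw1, hx, rfl,
    (rateBase_pow n).symm, ?_, rfl, ?_⟩
  · field_simp
  · rw [firstRate]; field_simp

end Kernel

/-! ### Rate of the first-stage estimator -/

section FirstStageRate

variable {Ω : Type*} [MeasurableSpace Ω] {μ : Measure Ω} {k p : ℕ} {Y : ℕ → Ω → ℝ}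
  {X : ℕ → Ω → Vec k}

theorem IIDSample.isIID (h : IIDSample μ Y X) : IsIID μ (fun i ω => (Y i ω, X i ω)) :=
  ⟨fun i => (h.measurable_Y i).prodMk (h.measurable_X i), h.indep, h.ident⟩

theorem IIDSample.identDistrib_X (h : IIDSample μ Y X) (i : ℕ) :
    IdentDistrib (X i) (X 0) μ μ :=
  (h.ident i).comp measurable_snd

/-- The first stage estimator is close to `βs`, at a rate slightly slower than `n ^ (-1/2)`. -/
theorem FirstStage.eventually_norm_le [IsProbabilityMeasure μ] {B : Set (Vec p)}
    {q : ℝ → Vec k → Vec p → ℝ} {ψ : ℝ → Vec k → Vec p → Vec p} {βs : Vec p}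
    {βhat : ℕ → Ω → Vec p} (hβ : FirstStage μ Y X B q ψ βs βhat) (hiid : IIDSample μ Y X)
    {K : ℝ → ℝ} {h : ℕ → ℝ} (hK : KernelBandwidth K h) :
    ∀ᶠ z in inProb μ, ‖βhat z.1 z.2 - βs‖ ≤ firstRate h z.1 := by
  set Z : ℕ → Ω → ℝ × Vec k := fun i ω => (Y i ω, X i ω) with hZdef
  have hZ : IsIID μ Z := hiid.isIID
  obtain ⟨ε, hε, hmom⟩ := hβ.moment
  have hψ2 : MemLp (fun ω => ψ (Y 0 ω) (X 0 ω) βs) 2 μ := by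
    refine hmom.mono_exponent ?_
    rw [← ENNReal.ofReal_ofNat]
    exact ENNReal.ofReal_le_ofReal (by linarith)
  have hint := hψ2.integrable (by norm_num)
  set F : Fin p → ℝ × Vec k → ℝ := fun j z => ψ z.1 z.2 βs j with hF
  have hFm : ∀ j, Measurable (F j) := fun j =>
    (EuclideanSpace.proj (𝕜 := ℝ) j).measurable.comp hβ.measurable_psi
  have hF2 : ∀ j, MemLp (fun ω => F j (Z 0 ω)) 2 μ := fun j =>
    (EuclideanSpace.proj (𝕜 := ℝ) j).comp_memLp' hψ2
  have hF0 : ∀ j, ∫ ω, F j (Z 0 ω) ∂μ = 0 := by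
    intro j
    have := (EuclideanSpace.proj (𝕜 := ℝ) j).integral_comp_comm hint
    rw [hβ.centered, map_zero] at this
    exact this
  -- The target rate is x / √n with x → ∞, so Chebyshev bounds the failure probability by O(1/x²).
  -- Half of the rate is shared among the p coordinates; dividing by p + 1 also covers p = 0.
  have hcheb : ∀ j, ∀ᶠ z in inProb μ,
      |sampleMean Z z.1 (F j) z.2| ≤ firstRate h z.1 / (2 * (p + 1)) := by
    intro j
    refine (eventually_inProb_iff
      (P := fun n ω => |sampleMean Z n (F j) ω| ≤ firstRate h n / (2 * (p + 1)))).2 ?_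
    set v := ∫ ω, F j (Z 0 ω) ^ 2 ∂μ with hv
    have hlim : Tendsto (fun n => ENNReal.ofReal
        (v * (2 * (p + 1)) ^ 2 / (rateBase n ^ 8 * h n) ^ 2)) atTop (𝓝 0) := by
      have h1 : Tendsto (fun n => v * (2 * (p + 1)) ^ 2 / (rateBase n ^ 8 * h n) ^ 2) atTop
          (𝓝 0) := tendsto_const_nhds.div_atTop
            ((tendsto_pow_atTop (by norm_num)).comp hK.tendsto_rateBase_mul)
      simpa using ENNReal.tendsto_ofReal h1
    refine tendsto_of_tendsto_of_tendsto_of_le_of_le' tendsto_const_nhds hlim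
      (Eventually.of_forall fun n => zero_le) ?_
    filter_upwards [hK.eventually_param 1, eventually_gt_atTop 0] with n hn hn0
    obtain ⟨w, x, -, hw, hx, hrb, hnw, hhx, hwx, hΔ⟩ := hn
    have hη : 0 < firstRate h n / (2 * (p + 1)) := by rw [hΔ]; positivity
    refine (measure_mono fun ω hω => ?_).trans
      ((hZ.chebyshev (hFm j) (hF2 j) hη le_rfl hn0).trans_eq ?_)
    · simp only [mem_ofPred_eq, not_le] at hω ⊢
      rw [hF0, sub_zero]
      exact hω.le
    · congr 1
      rw [hwx, hΔ, hnw]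
      field_simp
      rfl
  -- A remainder of norm at most 1, divided by √n = w^16, fits into the other half of x / w^16 as
  -- soon as x ≥ 2.
  have hrem := eventually_norm_le_of_tendstoInMeasure hβ.linear one_pos
  filter_upwards [eventually_all.2 hcheb, hrem, tendsto_fst_inProb.eventually (hK.eventually_param 1),
    tendsto_fst_inProb.eventually (hK.tendsto_rateBase_mul.eventually_ge_atTop 2)]
    with ⟨n, ω⟩ hch hr hpar hx2
  simp only at hch hr hpar hx2 ⊢
  obtain ⟨w, x, -, hw, hx, hrb, hnw, hhx, hwx, hΔ⟩ := hpar
  have hw0 : 0 < w := by linarith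
  have hsqrt : Real.sqrt (n : ℝ) = w ^ 16 := by
    rw [hnw, show w ^ 32 = (w ^ 16) ^ 2 by ring, Real.sqrt_sq (by positivity)]
  rw [hwx] at hx2
  set S : Vec p := ∑ i ∈ Finset.range n, ψ (Y i ω) (X i ω) βs with hS
  set rem : Vec p := Real.sqrt (n : ℝ) • (βhat n ω - βs) - (1 / Real.sqrt (n : ℝ)) • S with hremdef
  have hdec : βhat n ω - βs = (1 / w ^ 16) • rem + (1 / (n : ℝ)) • S := by
    rw [hremdef, hsqrt, hnw, smul_sub, smul_smul, smul_smul, one_div_mul_cancel (by positivity),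
      one_smul]
    have : (1 / w ^ 16) * (1 / w ^ 16) = 1 / w ^ 32 := by field_simp
    rw [this, sub_add_cancel]
  have hSn : ‖(1 / (n : ℝ)) • S‖ ≤ firstRate h n / 2 := by
    refine (norm_le_sum_abs _).trans ?_
    have hj : ∀ j, |((1 / (n : ℝ)) • S) j| ≤ firstRate h n / (2 * (p + 1)) := by
      intro j
      refine le_of_eq_of_le ?_ (hch j)
      congr 1
      simp [hS, sampleMean, hF, hZdef]
    calc ∑ j, |((1 / (n : ℝ)) • S) j| ≤ ∑ _j : Fin p, firstRate h n / (2 * (p + 1)) :=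
          Finset.sum_le_sum fun j _ => hj j
      _ = p * (firstRate h n / (2 * (p + 1))) := by simp
      _ ≤ (p + 1) * (firstRate h n / (2 * (p + 1))) := by
          have : 0 ≤ firstRate h n := by rw [hΔ]; positivity
          gcongr
          linarith
      _ = firstRate h n / 2 := by field_simp
  rw [hdec]
  calc ‖(1 / w ^ 16) • rem + (1 / (n : ℝ)) • S‖ ≤ ‖(1 / w ^ 16) • rem‖ + ‖(1 / (n : ℝ)) • S‖ :=
        norm_add_le _ _
    _ ≤ firstRate h n / 2 + firstRate h n / 2 := by
        refine add_le_add ?_ hSn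
        rw [norm_smul, Real.norm_of_nonneg (by positivity), hΔ]
        calc 1 / w ^ 16 * ‖rem‖ ≤ 1 / w ^ 16 * 1 := by gcongr
          _ ≤ 1 / w ^ 16 * (x / 2) := by gcongr; linarith
          _ = x / w ^ 16 / 2 := by field_simp
    _ = firstRate h n := by ring

end FirstStageRate

/-! ### Class indicators and conditional expectations -/

section ClassMean

/-- The indicator of the class `y`, as a function of the label. -/
def classWeight (y t : ℝ) : ℝ := if t = y then 1 else 0

theorem classWeight_nonneg (y t : ℝ) : 0 ≤ classWeight y t := by
  unfold classWeight; split_ifs <;> norm_num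

theorem classWeight_le_one (y t : ℝ) : classWeight y t ≤ 1 := by
  unfold classWeight; split_ifs <;> norm_num

theorem abs_classWeight_le_one (y t : ℝ) : |classWeight y t| ≤ 1 := by
  rw [abs_of_nonneg (classWeight_nonneg y t)]
  exact classWeight_le_one y t

theorem measurable_classWeight (y : ℝ) : Measurable (classWeight y) :=
  Measurable.ite (measurableSet_singleton y) measurable_const measurable_const

variable {Ω : Type*} [MeasurableSpace Ω] {μ : Measure Ω}

theorem integral_classWeight_mul [IsFiniteMeasure μ] {Y : Ω → ℝ} (hY : Measurable Y) {y : ℝ}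
    (hpos : 0 < μ {ω | Y ω = y}) (F : Ω → ℝ) :
    ∫ ω, classWeight y (Y ω) * F ω ∂μ =
      μ.real {ω | Y ω = y} * ∫ ω, F ω ∂(ProbabilityTheory.cond μ {ω | Y ω = y}) := by
  have hs : MeasurableSet {ω | Y ω = y} := hY (measurableSet_singleton y)
  have h1 : (fun ω => classWeight y (Y ω) * F ω) = {ω | Y ω = y}.indicator F := by
    funext ω
    by_cases h : Y ω = y <;> simp [classWeight, h]
  have hne : μ.real {ω | Y ω = y} ≠ 0 :=
    (ENNReal.toReal_pos hpos.ne' (measure_ne_top _ _)).ne'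
  rw [h1, integral_indicator hs, ProbabilityTheory.cond, integral_smul_measure, smul_eq_mul,
    ENNReal.toReal_inv, ← mul_assoc]
  change _ = μ.real _ * (μ.real _)⁻¹ * _
  rw [mul_inv_cancel₀ hne, one_mul]

theorem integrable_cond_of_integrable {E : Type*} [NormedAddCommGroup E]
    {s : Set Ω} (hpos : 0 < μ s) {F : Ω → E} (hF : Integrable F μ) :
    Integrable F (ProbabilityTheory.cond μ s) :=
  (hF.mono_measure Measure.restrict_le_self).smul_measure (ENNReal.inv_ne_top.2 hpos.ne')

end ClassMean

/-! ### Kernel averages at bandwidth scale -/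

section KernelLLN

variable {Ω α : Type*} [MeasurableSpace Ω] [MeasurableSpace α] {μ : Measure Ω}
  {Z : ℕ → Ω → α}

/-- Normalised kernel averages with square integrable weights concentrate uniformly. -/
theorem IsIID.uniform_kernel_lln_bandwidth [IsProbabilityMeasure μ] (hZ : IsIID μ Z)
    {V g : α → ℝ} (hV : Measurable V) (hg : Measurable g) (hV2 : MemLp (fun ω => V (Z 0 ω)) 2 μ)
    {K : ℝ → ℝ} {h : ℕ → ℝ} (hK : KernelBandwidth K h)
    {κ : ℝ → ℝ} (hκc : Continuous κ) {C : ℝ} (hκb : ∀ u, |κ u| ≤ C)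
    (hκl : ∀ u v, |κ u - κ v| ≤ C * |u - v|) {a b : ℝ} (hab : a < b) {ε : ℝ} (hε : 0 < ε) :
    ∀ᶠ z in inProb μ, ∀ c ∈ Icc a b,
      |sampleMean Z z.1 (fun x => V x * κ ((g x - c) / h z.1)) z.2 -
        ∫ ω, V (Z 0 ω) * κ ((g (Z 0 ω) - c) / h z.1) ∂μ| ≤ ε * h z.1 := by
  set v : ℝ := C ^ 2 * ∫ ω, V (Z 0 ω) ^ 2 ∂μ with hv
  have hx2 : Tendsto (fun n => (rateBase n ^ 8 * h n) ^ 2) atTop atTop :=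
    (tendsto_pow_atTop (by norm_num)).comp hK.tendsto_rateBase_mul
  -- A grid of w^16 = √n cells balances the two conditions: the interpolation term is 1 / (ε x²) and
  -- the union bound term is v / (ε² x²).
  refine hZ.uniform_kernel_lln hV hg hV2 hκc hκb hκl hab (ε := fun n => ε * h n)
    (A := fun n => rateBase n ^ 16) (v := fun _ => v) hK.eventually_pos ?_
    ((tendsto_pow_atTop (by norm_num)).comp tendsto_rateBase) ?_ ?_ ?_
  · filter_upwards [hK.eventually_pos] with n hn
    positivity
  · refine Eventually.of_forall fun n c _ => ?_
    rw [hv, ← integral_const_mul]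
    refine integral_mono_of_nonneg (ae_of_all _ fun _ => sq_nonneg _)
      (hV2.integrable_sq.const_mul _) (ae_of_all _ fun ω => ?_)
    simp only
    rw [mul_pow, mul_comm]
    refine mul_le_mul_of_nonneg_right ?_ (sq_nonneg _)
    rw [← sq_abs]
    exact pow_le_pow_left₀ (abs_nonneg _) (hκb _) 2
  · refine (tendsto_const_nhds (x := 1 / ε).div_atTop hx2).congr' ?_
    filter_upwards [hK.eventually_param 1] with n hn
    obtain ⟨w, x, -, hw, hx, hrb, hnw, hhx, hwx, hΔ⟩ := hn
    rw [hwx, hrb, hhx]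
    field_simp
  · refine (tendsto_const_nhds (x := v / ε ^ 2).div_atTop hx2).congr' ?_
    filter_upwards [hK.eventually_param 1] with n hn
    obtain ⟨w, x, -, hw, hx, hrb, hnw, hhx, hwx, hΔ⟩ := hn
    rw [hwx, hrb, hhx, hnw]
    field_simp

end KernelLLN

/-! ### The gradient estimator inside the margin -/

section GradientEstimator

theorem KernelBandwidth.tendsto_firstRate {K : ℝ → ℝ} {h : ℕ → ℝ} (hK : KernelBandwidth K h) :
    Tendsto (firstRate h) atTop (𝓝 0) := by
  unfold firstRate
  exact hK.bandwidth_zero.div_atTop ((tendsto_pow_atTop (by norm_num)).comp tendsto_rateBase)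

/-- A kernel average of a continuous function over `[a, b]` is close to its value. -/
theorem KernelBandwidth.abs_integral_sub_le {K : ℝ → ℝ} {h : ℕ → ℝ} (hK : KernelBandwidth K h)
    {a b : ℝ} {g : ℝ → ℝ} (hg : ContinuousOn g (Icc a b)) {t η : ℝ} (ht : 0 < t)
    (hmod : ∀ u ∈ Icc a b, ∀ c ∈ Icc a b, |u - c| ≤ t → |g u - g c| ≤ η) {c : ℝ}
    (hc : c ∈ Icc (a + t) (b - t)) :
    |(∫ u in Icc a b, K ((u - c) / t) * g u) - t * g c| ≤ t * η := by
  have hcI : c ∈ Icc a b := ⟨by linarith [hc.1], by linarith [hc.2]⟩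
  -- With margin t the kernel window stays inside [a, b], so the kernel keeps its full mass t and
  -- there is no boundary bias.
  have h0 : ∀ u, u ∉ Icc a b → K ((u - c) / t) = 0 := by
    intro u hu
    refine hK.scaled_eq_zero ht ?_
    by_contra! hle
    rw [abs_le] at hle
    exact hu ⟨by linarith [hc.1], by linarith [hc.2]⟩
  have hone : ∫ u in Icc a b, K ((u - c) / t) = t := by
    rw [setIntegral_eq_integral_of_forall_compl_eq_zero h0, hK.integral_scaled c ht]
  have hKi : IntegrableOn (fun u => K ((u - c) / t)) (Icc a b) :=
    (hK.integrable_scaled c ht).integrableOn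
  have hKc : ContinuousOn (fun u => K ((u - c) / t)) (Icc a b) :=
    (hK.continuous.comp (by fun_prop)).continuousOn
  have e1 : (∫ u in Icc a b, K ((u - c) / t) * g u) - t * g c =
      ∫ u in Icc a b, K ((u - c) / t) * (g u - g c) := by
    have hi : IntegrableOn (fun u => K ((u - c) / t) * g u) (Icc a b) :=
      (hKc.mul hg).integrableOn_Icc
    simp only [mul_sub]
    rw [integral_sub hi (hKi.mul_const _), integral_mul_const, hone]
  rw [e1]
  calc |∫ u in Icc a b, K ((u - c) / t) * (g u - g c)|
      ≤ ∫ u in Icc a b, |K ((u - c) / t) * (g u - g c)| := abs_integral_le_integral_abs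
    _ ≤ ∫ u in Icc a b, K ((u - c) / t) * η := by
        refine setIntegral_mono_on ?_ (hKi.mul_const _) measurableSet_Icc fun u hu => ?_
        · exact ((hKc.mul (hg.sub continuousOn_const)).abs).integrableOn_Icc
        · rw [abs_mul, abs_of_nonneg (hK.nonneg _)]
          by_cases hle : |u - c| ≤ t
          · exact mul_le_mul_of_nonneg_left (hmod u hu c hcI hle) (hK.nonneg _)
          · rw [hK.scaled_eq_zero ht (not_le.1 hle), zero_mul, zero_mul]
    _ = t * η := by rw [integral_mul_const, hone]

theorem exists_modulus {a b : ℝ} {g : ℝ → ℝ} (hg : ContinuousOn g (Icc a b)) {η : ℝ}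
    (hη : 0 < η) :
    ∃ d > 0, ∀ u ∈ Icc a b, ∀ c ∈ Icc a b, |u - c| ≤ d → |g u - g c| ≤ η := by
  have := Metric.uniformContinuousOn_iff.1 (isCompact_Icc.uniformContinuousOn_of_continuous hg) η hη
  obtain ⟨d, hd, h⟩ := this
  refine ⟨d / 2, half_pos hd, fun u hu c hc huc => ?_⟩
  have := h u hu c hc (by rw [Real.dist_eq]; linarith)
  rw [Real.dist_eq] at this
  exact this.le

variable {Ω : Type*} [MeasurableSpace Ω] {μ : Measure Ω} {k p : ℕ} {Y : ℕ → Ω → ℝ}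
  {X : ℕ → Ω → Vec k} {G : Vec k → Vec p → ℝ} {βs : Vec p} {βhat : ℕ → Ω → Vec p} {r : ℝ}
  {K : ℝ → ℝ} {h : ℕ → ℝ}

/-- The summand of the kernel estimator of the gradient, in coordinate `j`. -/
def gradSummand (K : ℝ → ℝ) (G : Vec k → Vec p → ℝ) (y t c : ℝ) (β : Vec p) (j : Fin p)
    (z : ℝ × Vec k) : ℝ :=
  classWeight y z.1 * gradient (G z.2) β j * K ((G z.2 β - c) / t)

/-- Replacing the estimated by the true parameter in the kernel estimator of the gradient. -/
theorem eventually_gradSummand_sub_le [IsProbabilityMeasure μ] (hr : 0 < r)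
    (hiid : IIDSample μ Y X) (hG : IndexSmooth μ (X 0) G βs r) (hK : KernelBandwidth K h)
    (hβ : ∀ᶠ z in inProb μ, ‖βhat z.1 z.2 - βs‖ ≤ firstRate h z.1) (y : ℝ) (j : Fin p)
    {ε : ℝ} (hε : 0 < ε) :
    ∀ᶠ z in inProb μ, ∀ c : ℝ,
      |sampleMean (fun i ω => (Y i ω, X i ω)) z.1
          (gradSummand K G y (h z.1) c (βhat z.1 z.2) j) z.2 -
        sampleMean (fun i ω => (Y i ω, X i ω)) z.1 (gradSummand K G y (h z.1) c βs j) z.2|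
        ≤ ε * h z.1 := by
  obtain ⟨L, M, hL, hM, hL2, hIB⟩ := hG.ae_indexBound hiid.identDistrib_X
  obtain ⟨C, hC, hKb, hKl⟩ := hK.exists_bound
  set Z : ℕ → Ω → ℝ × Vec k := fun i ω => (Y i ω, X i ω) with hZdef
  have hZ : IsIID μ Z := hiid.isIID
  have m1 := hZ.eventually_sampleMean_le (F := fun z => L z.2) (hL.comp measurable_snd)
    (hL2.integrable (by norm_num))
  have m2 := hZ.eventually_sampleMean_le (F := fun z => L z.2 ^ 2)
    ((hL.comp measurable_snd).pow_const 2) hL2.integrable_sq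
  set A₁ := ∫ ω, L (Z 0 ω).2 ∂μ + 1
  set A₂ := ∫ ω, L (Z 0 ω).2 ^ 2 ∂μ + 1
  -- The two errors of the replacement, divided by h. The kernel increment gives L² Δ / h = L² h /
  -- x; the gradient increment gives (L + M) √Δ = (L + M) h / √x, up to constants. Neither involves
  -- c, so the bound holds for all real c.
  have hrate : ∀ᶠ n in atTop, C * A₂ / (rateBase n ^ 8 * h n) +
      2 * C * (A₁ + M) / Real.sqrt (rateBase n ^ 8 * h n) ≤ ε := by
    have t1 := (tendsto_const_nhds (x := C * A₂)).div_atTop hK.tendsto_rateBase_mul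
    have t2 := (tendsto_const_nhds (x := 2 * C * (A₁ + M))).div_atTop
      (Real.tendsto_sqrt_atTop.comp hK.tendsto_rateBase_mul)
    have t3 := t1.add t2
    rw [add_zero] at t3
    exact t3.eventually_le_const hε
  have hsmall : ∀ᶠ n in atTop, firstRate h n + Real.sqrt (firstRate h n) < r := by
    have := hK.tendsto_firstRate.add
      ((Real.continuous_sqrt.tendsto 0).comp hK.tendsto_firstRate)
    simp only [Real.sqrt_zero, add_zero] at this
    exact this.eventually_lt_const hr
  filter_upwards [hβ, m1, m2, eventually_inProb_of_ae (μ := μ) (P := fun _ ω => ∀ i,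
    IndexBound (G (X i ω)) βs r (L (X i ω)) M) fun _ => hIB,
    tendsto_fst_inProb.eventually hrate, tendsto_fst_inProb.eventually hsmall,
    tendsto_fst_inProb.eventually (hK.eventually_param 1)]
    with ⟨n, ω⟩ hb m1 m2 hIB hrate hsmall hpar c
  simp only at hb m1 m2 hIB hrate hsmall hpar ⊢
  obtain ⟨w, x, -, hw, hx, hrb, hnw, hhx, hwx, hΔ⟩ := hpar
  set Δ := firstRate h n with hΔdef
  set β := βhat n ω
  have hw0 : 0 < w := by linarith
  have hx0 : 0 < x := by linarith
  have hh : 0 < h n := by rw [hhx]; positivity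
  have hΔ0 : 0 < Δ := by rw [hΔ]; positivity
  have hsq0 := Real.sqrt_nonneg Δ
  have hβmem : β ∈ Metric.ball βs r := by rw [mem_ball_iff_norm]; linarith
  have hβs : βs ∈ Metric.ball βs r := Metric.mem_ball_self hr
  have hpt : ∀ i < n, |gradSummand K G y (h n) c β j (Z i ω) -
      gradSummand K G y (h n) c βs j (Z i ω)| ≤
      C * Δ / h n * L (Z i ω).2 ^ 2 + 2 * C * Real.sqrt Δ * (L (Z i ω).2 + M) := by
    intro i _
    have hi := hIB i
    have hL0 : 0 ≤ L (X i ω) := (norm_nonneg _).trans (hi.grad _ hβs)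
    set g₁ := gradient (G (X i ω)) β j with hg₁
    set g₀ := gradient (G (X i ω)) βs j with hg₀
    set K₁ := K ((G (X i ω) β - c) / h n) with hK₁
    set K₀ := K ((G (X i ω) βs - c) / h n) with hK₀
    have b1 : |g₁| ≤ L (X i ω) := (abs_apply_le_norm _ _).trans (hi.grad _ hβmem)
    have b2 : |g₁ - g₀| ≤ 2 * (L (X i ω) + M) * Real.sqrt Δ :=
      hi.abs_gradient_sub_le j hΔ0 hb hsmall
    have b3 : |K₁ - K₀| ≤ C * Δ / h n * L (X i ω) := by
      refine (hKl _ _).trans ?_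
      have : (G (X i ω) β - c) / h n - (G (X i ω) βs - c) / h n =
        (G (X i ω) β - G (X i ω) βs) / h n := by ring
      rw [this, abs_div, abs_of_pos hh]
      calc C * (|G (X i ω) β - G (X i ω) βs| / h n) ≤ C * (L (X i ω) * Δ / h n) := by
            gcongr
            exact (hi.abs_sub_le hβmem hβs).trans (by gcongr)
        _ = _ := by ring
    have e1 : gradSummand K G y (h n) c β j (Z i ω) - gradSummand K G y (h n) c βs j (Z i ω) =
        classWeight y (Y i ω) * (g₁ * (K₁ - K₀) + K₀ * (g₁ - g₀)) := by
      simp only [gradSummand, hZdef, ← hg₁, ← hg₀, ← hK₁, ← hK₀]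
      ring
    rw [e1, abs_mul]
    have b4 : |g₁ * (K₁ - K₀) + K₀ * (g₁ - g₀)| ≤
        L (X i ω) * (C * Δ / h n * L (X i ω)) + C * (2 * (L (X i ω) + M) * Real.sqrt Δ) := by
      refine (abs_add_le _ _).trans ?_
      rw [abs_mul, abs_mul]
      gcongr
      exact hKb _
    calc |classWeight y (Y i ω)| * |g₁ * (K₁ - K₀) + K₀ * (g₁ - g₀)| ≤
        1 * (L (X i ω) * (C * Δ / h n * L (X i ω)) + C * (2 * (L (X i ω) + M) * Real.sqrt Δ)) := by
          gcongr
          exact abs_classWeight_le_one _ _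
      _ = _ := by simp only [hZdef]; ring
  refine (abs_sampleMean_sub_le (D := fun z => C * Δ / h n * L z.2 ^ 2 +
    2 * C * Real.sqrt Δ * (L z.2 + M)) hpt).trans ?_
  rw [sampleMean_add, sampleMean_const_mul, sampleMean_const_mul, sampleMean_add]
  have hΔh : Δ / h n = h n / x := by rw [hΔ, hhx]; field_simp
  have hsΔ : Real.sqrt Δ = h n / Real.sqrt x := by
    rw [hΔ, hhx, Real.sqrt_div hx0.le, show w ^ 16 = (w ^ 8) ^ 2 by ring,
      Real.sqrt_sq (by positivity)]
    have := Real.mul_self_sqrt hx0.le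
    have hsx : 0 < Real.sqrt x := Real.sqrt_pos.2 hx0
    field_simp
    linarith
  rw [hwx] at hrate
  calc C * Δ / h n * sampleMean Z n (fun z => L z.2 ^ 2) ω +
      2 * C * Real.sqrt Δ * (sampleMean Z n (fun z => L z.2) ω + sampleMean Z n (fun _ => M) ω)
      ≤ C * Δ / h n * A₂ + 2 * C * Real.sqrt Δ * (A₁ + M) := by
        gcongr
        exact sampleMean_const_le hM.le
    _ = (C * A₂ / x + 2 * C * (A₁ + M) / Real.sqrt x) * h n := by
        rw [mul_div_assoc, hΔh, hsΔ]; ring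
    _ ≤ ε * h n := by gcongr

/-- Uniform consistency of the kernel estimator of the gradient, in each coordinate and away from
the end points. -/
theorem eventually_gradSummand_consistent [IsProbabilityMeasure μ] (hr : 0 < r)
    (hiid : IIDSample μ Y X) (hG : IndexSmooth μ (X 0) G βs r) (hK : KernelBandwidth K h)
    (hβ : ∀ᶠ z in inProb μ, ‖βhat z.1 z.2 - βs‖ ≤ firstRate h z.1) {y : ℝ}
    (hy : 0 < μ {ω | Y 0 ω = y}) {a b : ℝ} (hab : a < b) {R : ℝ → Vec p → ℝ}
    (hR : ∀ c β, R c β = (ProbabilityTheory.cond μ {ω | Y 0 ω = y}).real {ω | c < G (X 0 ω) β})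
    (hgrad : GradientUnif R (Icc a b) βs r) (j : Fin p) {ε : ℝ} (hε : 0 < ε) :
    ∀ᶠ z in inProb μ, ∀ c ∈ Icc (a + h z.1) (b - h z.1),
      |1 / h z.1 * sampleMean (fun i ω => (Y i ω, X i ω)) z.1
          (gradSummand K G y (h z.1) c (βhat z.1 z.2) j) z.2 -
        μ.real {ω | Y 0 ω = y} * gradient (R c) βs j| ≤ ε := by
  have hβs : βs ∈ Metric.ball βs r := Metric.mem_ball_self hr
  obtain ⟨L, M, hL, hM, hL2, hIB⟩ := hG.ae_indexBound hiid.identDistrib_X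
  obtain ⟨C, hC, hKb, hKl⟩ := hK.exists_bound
  -- Each of the three errors receives ε/3: estimated parameter, sampling fluctuation, and smoothing
  -- bias.
  have swap := eventually_gradSummand_sub_le hr hiid hG hK hβ y j (ε := ε / 3) (by positivity)
  set Z : ℕ → Ω → ℝ × Vec k := fun i ω => (Y i ω, X i ω) with hZdef
  have hZ : IsIID μ Z := hiid.isIID
  set V : ℝ × Vec k → ℝ := fun z => classWeight y z.1 * gradient (G z.2) βs j with hVdef
  have hgm : Measurable (fun x => gradient (G x) βs j) :=
    measurable_gradient_apply hG.measurable_G hG.smooth hβs j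
  have hV : Measurable V := ((measurable_classWeight y).comp measurable_fst).mul
    (hgm.comp measurable_snd)
  have hV2 : MemLp (fun ω => V (Z 0 ω)) 2 μ := by
    refine hL2.of_le (hV.comp (hZ.measurable 0)).aestronglyMeasurable ?_
    filter_upwards [hIB] with ω hω
    rw [hVdef, norm_mul]
    calc ‖classWeight y (Z 0 ω).1‖ * ‖gradient (G (Z 0 ω).2) βs j‖ ≤ 1 * L (X 0 ω) := by
          gcongr
          · exact abs_classWeight_le_one _ _
          · exact (abs_apply_le_norm _ _).trans ((hω 0).grad _ hβs)
      _ ≤ ‖L (X 0 ω)‖ := by rw [one_mul]; exact le_abs_self _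
  have lln := hZ.uniform_kernel_lln_bandwidth hV ((hG.measurable_G βs).comp measurable_snd) hV2 hK
    hK.continuous hKb hKl hab (ε := ε / 3) (by positivity)
  set g : ℝ → ℝ := fun u => gradient (R u) βs j with hg
  have hgc : ContinuousOn g (Icc a b) := by
    have h1 : ContinuousOn (fun u : ℝ => gradient (R u) βs) (Icc a b) :=
      hgrad.continuous.comp (f := fun u : ℝ => (u, βs))
        (Continuous.continuousOn (by fun_prop)) fun u hu => ⟨hu, hβs⟩
    exact (EuclideanSpace.proj (𝕜 := ℝ) j).continuous.comp_continuousOn h1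
  obtain ⟨d, hd, hmod⟩ := exists_modulus hgc (η := ε / 3) (by positivity)
  have hhd : ∀ᶠ n in atTop, h n ≤ d := hK.bandwidth_zero.eventually_le_const hd
  have hνp : IsProbabilityMeasure (ProbabilityTheory.cond μ {ω | Y 0 ω = y}) :=
    cond_isProbabilityMeasure hy.ne'
  filter_upwards [swap, lln, tendsto_fst_inProb.eventually hhd,
    tendsto_fst_inProb.eventually hK.eventually_pos] with ⟨n, ω⟩ hsw hlln hhd hh c hc
  simp only at hsw hlln hhd hh hc ⊢
  have hcI : c ∈ Icc a b := ⟨by linarith [hc.1], by linarith [hc.2]⟩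
  have e1 := hsw c
  have e2 := hlln c hcI
  -- The weak differentiation identity, tested against the rescaled kernel centred at c. The margin
  -- makes this test function vanish outside [a, b].
  have hpop : ∫ ω, V (Z 0 ω) * K ((G (Z 0 ω).2 βs - c) / h n) ∂μ =
      μ.real {ω | Y 0 ω = y} * ∫ u in Icc a b, K ((u - c) / h n) * g u := by
    rw [← integral_mul_partial_eq (ProbabilityTheory.cond μ {ω | Y 0 ω = y}) (hiid.measurable_X 0)
      hG.measurable_G hr hG.smooth (L := L) (M := M)
      (cond_absolutelyContinuous.ae_le (hIB.mono fun ω hω => hω 0))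
      (integrable_cond_of_integrable hy (hL2.integrable (by norm_num))) hR hgrad
      (φ := fun u => K ((u - c) / h n)) (hK.continuous.comp (by fun_prop)) (fun u => hKb _)
      (fun u hu => hK.scaled_eq_zero hh (by
        by_contra! hle
        rw [abs_le] at hle
        exact hu ⟨by linarith [hc.1], by linarith [hc.2]⟩)) j,
      ← integral_classWeight_mul (hiid.measurable_Y 0) hy]
    refine integral_congr_ae (ae_of_all _ fun ω => ?_)
    simp only [hVdef, hZdef]
    ring
  have e3 := hK.abs_integral_sub_le hgc hh
    (fun u hu c hc huc => hmod u hu c hc (huc.trans hhd)) hc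
  set P := μ.real {ω | Y 0 ω = y}
  have hP0 : 0 ≤ P := measureReal_nonneg
  have hP1 : P ≤ 1 := measureReal_le_one
  set I := ∫ u in Icc a b, K ((u - c) / h n) * g u
  have e4 : |P * I - h n * (P * g c)| ≤ ε / 3 * h n := by
    have : P * I - h n * (P * g c) = P * (I - h n * g c) := by ring
    rw [this, abs_mul, abs_of_nonneg hP0]
    calc P * |I - h n * g c| ≤ 1 * (h n * (ε / 3)) := by gcongr
      _ = _ := by ring
  have e5 : sampleMean Z n (fun x => V x * K ((G x.2 βs - c) / h n)) ω =
      sampleMean Z n (gradSummand K G y (h n) c βs j) ω := rfl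
  simp only [Function.comp_apply] at e2
  rw [hpop, e5] at e2
  set S := sampleMean Z n (gradSummand K G y (h n) c (βhat n ω) j) ω
  have e6 : |S - h n * (P * g c)| ≤ ε * h n := by
    rw [abs_le] at e1 e2 e4 ⊢
    constructor <;> linarith [e1.1, e1.2, e2.1, e2.2, e4.1, e4.2]
  have e7 : 1 / h n * S - P * g c = (S - h n * (P * g c)) / h n := by field_simp
  change |1 / h n * S - P * g c| ≤ ε
  rw [e7, abs_div, abs_of_pos hh, div_le_iff₀ hh]
  exact e6

end GradientEstimator

/-! ### Integration against the conditional density -/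

section CondDensity

variable {Ω : Type*} [MeasurableSpace Ω] {μ : Measure Ω} {k p : ℕ} {Y : Ω → ℝ} {X : Ω → Vec k}
  {G : Vec k → Vec p → ℝ} {β : Vec p} {y a b : ℝ} {f : ℝ → ℝ}

theorem CondDensity.eq_zero (h : CondDensity μ Y X G β y a b f) {c : ℝ} (hc : c ∉ Icc a b) :
    f c = 0 :=
  image_eq_zero_of_notMem_tsupport (h.support ▸ hc)

theorem CondDensity.indicator_eq (h : CondDensity μ Y X G β y a b f) :
    (Icc a b).indicator f = f := by
  funext c
  by_cases hc : c ∈ Icc a b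
  · simp [hc]
  · simp [hc, h.eq_zero hc]

/-- The density may jump at a and b, so smoothness on [a, b] is combined with its vanishing outside.
-/
theorem CondDensity.measurable (h : CondDensity μ Y X G β y a b f) : Measurable f := by
  classical
  have h1 := h.smooth.continuousOn.measurable_piecewise (g := (0 : ℝ → ℝ))
    continuous_zero.continuousOn measurableSet_Icc
  rwa [piecewise_eq_indicator, h.indicator_eq] at h1

theorem CondDensity.exists_bound (h : CondDensity μ Y X G β y a b f) :
    ∃ C : ℝ, 0 < C ∧ ∀ c, f c ≤ C := by
  obtain ⟨C, hC⟩ := isCompact_Icc.exists_bound_of_continuousOn h.smooth.continuousOn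
  refine ⟨max C 1, by positivity, fun c => ?_⟩
  by_cases hc : c ∈ Icc a b
  · exact ((le_abs_self _).trans (hC c hc)).trans (le_max_left _ _)
  · rw [h.eq_zero hc]; positivity

theorem CondDensity.integrable (h : CondDensity μ Y X G β y a b f) : Integrable f := by
  rw [← h.indicator_eq, integrable_indicator_iff measurableSet_Icc]
  exact h.smooth.continuousOn.integrableOn_Icc

theorem CondDensity.integrable_mul (h : CondDensity μ Y X G β y a b f) {φ : ℝ → ℝ}
    (hφ : Measurable φ) {C : ℝ} (hC : ∀ u, |φ u| ≤ C) : Integrable (fun u => φ u * f u) :=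
  h.integrable.bdd_mul hφ.aestronglyMeasurable (ae_of_all _ hC)

theorem CondDensity.integral_comp (h : CondDensity μ Y X G β y a b f)
    (hX : Measurable fun ω => G (X ω) β) {φ : ℝ → ℝ} (hφ : Measurable φ) :
    ∫ ω, φ (G (X ω) β) ∂(ProbabilityTheory.cond μ {ω | Y ω = y}) = ∫ u, φ u * f u := by
  rw [← integral_map hX.aemeasurable (f := φ) hφ.aestronglyMeasurable, h.law,
    integral_withDensity_eq_integral_toReal_smul h.measurable.ennreal_ofReal
      (ae_of_all _ fun _ => ENNReal.ofReal_lt_top)]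
  refine integral_congr_ae (ae_of_all _ fun u => ?_)
  simp only [smul_eq_mul]
  rw [ENNReal.toReal_ofReal (h.nonneg u), mul_comm]

theorem CondDensity.integral_classWeight [IsFiniteMeasure μ] (h : CondDensity μ Y X G β y a b f)
    (hY : Measurable Y) (hX : Measurable fun ω => G (X ω) β) (hy : 0 < μ {ω | Y ω = y})
    {φ : ℝ → ℝ} (hφ : Measurable φ) :
    ∫ ω, classWeight y (Y ω) * φ (G (X ω) β) ∂μ = μ.real {ω | Y ω = y} * ∫ u, φ u * f u := by
  rw [integral_classWeight_mul hY hy, h.integral_comp hX hφ]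

theorem CondDensity.integral_mul_le (h : CondDensity μ Y X G β y a b f) {φ : ℝ → ℝ}
    (hφi : Integrable φ) (hφ0 : ∀ u, 0 ≤ φ u) {C : ℝ} (hC : ∀ c, f c ≤ C) :
    ∫ u, φ u * f u ≤ (∫ u, φ u) * C := by
  rw [← integral_mul_const]
  exact integral_mono_of_nonneg (ae_of_all _ fun u => mul_nonneg (hφ0 u) (h.nonneg u))
    (hφi.mul_const C) (ae_of_all _ fun u => mul_le_mul_of_nonneg_left (hC u) (hφ0 u))

end CondDensity

/-! ### Kernel density estimators with a polynomial rate -/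

section DensityEstimator

/-- A trapezoid: it equals one on `[-2, 2]` and vanishes outside `[-3, 3]`. -/
def trapezoid (u : ℝ) : ℝ := max 0 (min 1 (3 - |u|))

theorem trapezoid_nonneg (u : ℝ) : 0 ≤ trapezoid u := le_max_left _ _

theorem trapezoid_le_one (u : ℝ) : trapezoid u ≤ 1 :=
  max_le zero_le_one (min_le_left _ _)

theorem abs_trapezoid_le_one (u : ℝ) : |trapezoid u| ≤ 1 := by
  rw [abs_of_nonneg (trapezoid_nonneg u)]
  exact trapezoid_le_one u

theorem trapezoid_eq_one {u : ℝ} (hu : |u| ≤ 2) : trapezoid u = 1 := by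
  rw [trapezoid, min_eq_left (by linarith), max_eq_right zero_le_one]

theorem continuous_trapezoid : Continuous trapezoid := by
  unfold trapezoid
  fun_prop

theorem abs_trapezoid_sub_le (u v : ℝ) : |trapezoid u - trapezoid v| ≤ 1 * |u - v| := by
  rw [one_mul]
  unfold trapezoid
  calc |max 0 (min 1 (3 - |u|)) - max 0 (min 1 (3 - |v|))| ≤ |min 1 (3 - |u|) - min 1 (3 - |v|)| := by
        simpa using abs_max_sub_max_le_max 0 (min 1 (3 - |u|)) 0 (min 1 (3 - |v|))
    _ ≤ |(3 - |u|) - (3 - |v|)| := by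
        simpa using abs_min_sub_min_le_max 1 (3 - |u|) 1 (3 - |v|)
    _ = |(|v| - |u|)| := by congr 1; ring
    _ ≤ |v - u| := abs_abs_sub_abs_le_abs_sub v u
    _ = |u - v| := abs_sub_comm v u

theorem integrable_trapezoid : Integrable trapezoid := by
  refine continuous_trapezoid.integrable_of_hasCompactSupport
    (HasCompactSupport.intro (K := Icc (-3) 3) isCompact_Icc fun u hu => ?_)
  rw [trapezoid]
  have : 3 < |u| := by
    by_contra! h
    exact hu (abs_le.1 h)
  exact max_eq_left ((min_le_right _ _).trans (by linarith))

/-- The increment of a compactly supported Lipschitz kernel. -/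
theorem KernelBandwidth.abs_sub_le_trapezoid {K : ℝ → ℝ} {h : ℕ → ℝ} (hK : KernelBandwidth K h)
    {C : ℝ} (hC : 0 < C) (hKl : ∀ u v, |K u - K v| ≤ C * |u - v|) {u v l : ℝ}
    (hl : |v - u| ≤ l) : |K v - K u| ≤ C * (l * trapezoid u + l ^ 2) := by
  have hl0 : 0 ≤ l := (abs_nonneg _).trans hl
  have h1 : |K v - K u| ≤ C * l := (hKl v u).trans (by gcongr)
  have hm : 0 ≤ l * trapezoid u := mul_nonneg hl0 (trapezoid_nonneg u)
  -- A displacement l ≤ 1 leaves both kernel values zero when |u| > 2, so the increment is localised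
  -- by the trapezoid. For l > 1 the quadratic term alone suffices. The localisation later yields
  -- the extra factor h in the mean.
  by_cases hl1 : l ≤ 1
  · by_cases hu : |u| ≤ 2
    · rw [trapezoid_eq_one hu]
      refine h1.trans (mul_le_mul_of_nonneg_left ?_ hC.le)
      nlinarith [sq_nonneg l]
    · have hv : 1 < |v| := by
        have := abs_sub_abs_le_abs_sub u v
        rw [abs_sub_comm] at this
        linarith
      rw [hK.eq_zero hv, hK.eq_zero (by linarith), sub_zero, abs_zero]
      positivity
  · refine h1.trans (mul_le_mul_of_nonneg_left ?_ hC.le)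
    nlinarith

variable {Ω : Type*} [MeasurableSpace Ω] {μ : Measure Ω} {k p : ℕ} {Y : ℕ → Ω → ℝ}
  {X : ℕ → Ω → Vec k} {G : Vec k → Vec p → ℝ} {βs : Vec p} {βhat : ℕ → Ω → Vec p} {r : ℝ}
  {K : ℝ → ℝ} {h : ℕ → ℝ} {y a b : ℝ} {f : ℝ → ℝ}

/-- The summand of the kernel density estimator. -/
def densSummand (K : ℝ → ℝ) (G : Vec k → Vec p → ℝ) (y t c : ℝ) (β : Vec p)
    (z : ℝ × Vec k) : ℝ :=
  classWeight y z.1 * K ((G z.2 β - c) / t)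

theorem memLp_classWeight [IsProbabilityMeasure μ] (hiid : IIDSample μ Y X) (y : ℝ) :
    MemLp (fun ω => classWeight y (Y 0 ω)) 2 μ :=
  MemLp.of_bound ((measurable_classWeight y).comp (hiid.measurable_Y 0)).aestronglyMeasurable 1
    (ae_of_all _ fun _ => abs_classWeight_le_one _ _)

/-- Concentration of the kernel density estimator at the true parameter, at a polynomial rate. -/
theorem eventually_densSummand_concentrate [IsProbabilityMeasure μ]
    (hiid : IIDSample μ Y X) (hG : IndexSmooth μ (X 0) G βs r) (hK : KernelBandwidth K h)
    (hy : 0 < μ {ω | Y 0 ω = y}) (hf : CondDensity μ (Y 0) (X 0) G βs y a b f)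
    {a' b' : ℝ} (hab : a' < b') :
    ∀ᶠ z in inProb μ, ∀ c ∈ Icc a' b',
      |sampleMean (fun i ω => (Y i ω, X i ω)) z.1 (densSummand K G y (h z.1) c βs) z.2 -
        μ.real {ω | Y 0 ω = y} * ∫ u, K ((u - c) / h z.1) * f u| ≤ h z.1 / rateBase z.1 := by
  obtain ⟨C, hC, hKb, hKl⟩ := hK.exists_bound
  obtain ⟨Cf, hCf, hfb⟩ := hf.exists_bound
  have hZ := hiid.isIID
  set Z : ℕ → Ω → ℝ × Vec k := fun i ω => (Y i ω, X i ω) with hZdef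
  have hGX : Measurable fun ω => G (X 0 ω) βs := (hG.measurable_G βs).comp (hiid.measurable_X 0)
  have hKm : ∀ c t : ℝ, Measurable fun u => K ((u - c) / t) := fun c t =>
    (hK.continuous.comp (by fun_prop)).measurable
  have hlim : Tendsto (fun n => rateBase n * (rateBase n ^ 8 * h n)) atTop atTop :=
    tendsto_rateBase.atTop_mul_atTop₀ hK.tendsto_rateBase_mul
  -- Since K² ≤ C K and f is bounded, the second moments are O(h), which pays for the gain of 1/w in
  -- the error. With w^18 cells the interpolation term is 1 / (w x²) and the union bound term is a
  -- constant over w^4 x.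
  have lln := hZ.uniform_kernel_lln (V := fun z => classWeight y z.1) (g := fun z => G z.2 βs)
    ((measurable_classWeight y).comp measurable_fst)
    ((hG.measurable_G βs).comp measurable_snd) (memLp_classWeight hiid y) hK.continuous hKb hKl hab
    (h := h) (ε := fun n => h n / rateBase n) (A := fun n => rateBase n ^ 18)
    (v := fun n => C * (h n * Cf)) hK.eventually_pos
    (by
      filter_upwards [hK.eventually_pos, tendsto_rateBase.eventually_gt_atTop 0] with n h1 h2
      positivity)
    ((tendsto_pow_atTop (by norm_num)).comp tendsto_rateBase)
    (by
      filter_upwards [hK.eventually_pos] with n hn c _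
      have hb : ∫ u, K ((u - c) / h n) * f u ≤ h n * Cf := by
        have := hf.integral_mul_le (hK.integrable_scaled c hn) (fun u => hK.nonneg _) hfb
        rwa [hK.integral_scaled c hn] at this
      have hP1 : μ.real {ω | Y 0 ω = y} ≤ 1 := measureReal_le_one
      have hI0 : 0 ≤ ∫ u, K ((u - c) / h n) * f u :=
        integral_nonneg fun u => mul_nonneg (hK.nonneg _) (hf.nonneg u)
      calc ∫ ω, (classWeight y (Z 0 ω).1 * K ((G (Z 0 ω).2 βs - c) / h n)) ^ 2 ∂μ
          ≤ ∫ ω, C * (classWeight y (Y 0 ω) * K ((G (X 0 ω) βs - c) / h n)) ∂μ := by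
            refine integral_mono_of_nonneg (ae_of_all _ fun _ => sq_nonneg _) ?_
              (ae_of_all _ fun ω => ?_)
            · refine Integrable.const_mul (Integrable.of_bound (C := 1 * C) ?_
                (ae_of_all _ fun ω => ?_)) C
              · exact (((measurable_classWeight y).comp (hiid.measurable_Y 0)).mul
                  ((hKm c (h n)).comp hGX)).aestronglyMeasurable
              · rw [norm_mul]
                gcongr
                · exact abs_classWeight_le_one _ _
                · exact hKb _
            · simp only [hZdef]
              have h1 := classWeight_nonneg y (Y 0 ω)
              have h2 := classWeight_le_one y (Y 0 ω)
              have h3 := hK.nonneg ((G (X 0 ω) βs - c) / h n)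
              have h4 := (le_abs_self _).trans (hKb ((G (X 0 ω) βs - c) / h n))
              rw [sq]
              refine mul_le_mul_of_nonneg_right ?_ (mul_nonneg h1 h3)
              calc _ ≤ 1 * C := by gcongr
                _ = C := one_mul C
        _ = C * (μ.real {ω | Y 0 ω = y} * ∫ u, K ((u - c) / h n) * f u) := by
            rw [integral_const_mul,
              hf.integral_classWeight (hiid.measurable_Y 0) hGX hy (hKm c (h n))]
        _ ≤ C * (1 * (h n * Cf)) := by gcongr
        _ = C * (h n * Cf) := by rw [one_mul])
    (by
      refine (tendsto_const_nhds (x := (1 : ℝ)).div_atTop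
        (hlim.atTop_mul_atTop₀ hK.tendsto_rateBase_mul)).congr' ?_
      filter_upwards [hK.eventually_param 1] with n hn
      obtain ⟨w, x, -, hw, hx, hrb, hnw, hhx, hwx, hΔ⟩ := hn
      rw [hwx, hrb, hhx]
      field_simp)
    (by
      refine (tendsto_const_nhds (x := C * Cf).div_atTop
        ((tendsto_pow_atTop (n := 3) (by norm_num)).comp tendsto_rateBase |>.atTop_mul_atTop₀
          hlim)).congr' ?_
      filter_upwards [hK.eventually_param 1] with n hn
      obtain ⟨w, x, -, hw, hx, hrb, hnw, hhx, hwx, hΔ⟩ := hn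
      simp only [Function.comp_apply]
      rw [hwx, hrb, hhx, hnw]
      field_simp)
  filter_upwards [lln] with z hz c hc
  have := hz c hc
  rwa [show ∫ ω, classWeight y (Z 0 ω).1 * K ((G (Z 0 ω).2 βs - c) / h z.1) ∂μ =
    μ.real {ω | Y 0 ω = y} * ∫ u, K ((u - c) / h z.1) * f u from
      hf.integral_classWeight (hiid.measurable_Y 0) hGX hy (hKm c (h z.1))] at this

/-- Replacing the estimated by the true parameter in the kernel density estimator, at a polynomial
rate. -/
theorem eventually_densSummand_sub_le [IsProbabilityMeasure μ] (hr : 0 < r)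
    (hiid : IIDSample μ Y X) (hG : IndexSmooth μ (X 0) G βs r) (hK : KernelBandwidth K h)
    (hβ : ∀ᶠ z in inProb μ, ‖βhat z.1 z.2 - βs‖ ≤ firstRate h z.1)
    (hy : 0 < μ {ω | Y 0 ω = y}) (hf : CondDensity μ (Y 0) (X 0) G βs y a b f)
    {a' b' : ℝ} (hab : a' < b') :
    ∀ᶠ z in inProb μ, ∀ c ∈ Icc a' b',
      |sampleMean (fun i ω => (Y i ω, X i ω)) z.1
          (densSummand K G y (h z.1) c (βhat z.1 z.2)) z.2 -
        sampleMean (fun i ω => (Y i ω, X i ω)) z.1 (densSummand K G y (h z.1) c βs) z.2|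
        ≤ h z.1 / rateBase z.1 := by
  obtain ⟨L, M, hL, hM, hL2, hIB⟩ := hG.ae_indexBound hiid.identDistrib_X
  obtain ⟨C, hC, hKb, hKl⟩ := hK.exists_bound
  obtain ⟨Cf, hCf, hfb⟩ := hf.exists_bound
  have hZ := hiid.isIID
  set Z : ℕ → Ω → ℝ × Vec k := fun i ω => (Y i ω, X i ω) with hZdef
  have hGX : Measurable fun ω => G (X 0 ω) βs := (hG.measurable_G βs).comp (hiid.measurable_X 0)
  have m2 := hZ.eventually_sampleMean_le (F := fun z => L z.2 ^ 2)
    ((hL.comp measurable_snd).pow_const 2) hL2.integrable_sq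
  set A₂ := ∫ ω, L (Z 0 ω).2 ^ 2 ∂μ + 1 with hA₂
  have hA₂0 : 0 ≤ A₂ := by
    have : 0 ≤ ∫ ω, L (Z 0 ω).2 ^ 2 ∂μ := integral_nonneg fun _ => sq_nonneg _
    linarith
  have lln := hZ.uniform_kernel_lln_bandwidth (V := fun z => classWeight y z.1)
    (g := fun z => G z.2 βs) ((measurable_classWeight y).comp measurable_fst)
    ((hG.measurable_G βs).comp measurable_snd) (memLp_classWeight hiid y) hK continuous_trapezoid
    abs_trapezoid_le_one abs_trapezoid_sub_le hab (ε := 1) one_pos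
  set I := ∫ u, trapezoid u with hI
  have hI0 : 0 ≤ I := integral_nonneg trapezoid_nonneg
  have hsmall : ∀ᶠ n in atTop, firstRate h n < r := hK.tendsto_firstRate.eventually_lt_const hr
  filter_upwards [hβ, m2, lln, eventually_inProb_of_ae (μ := μ) (P := fun _ ω => ∀ i,
    IndexBound (G (X i ω)) βs r (L (X i ω)) M) fun _ => hIB,
    tendsto_fst_inProb.eventually hsmall,
    tendsto_fst_inProb.eventually (hK.eventually_param (C * (2 * A₂ + 1 + I * Cf)))]
    with ⟨n, ω⟩ hb m2 lln hIB hsmall hpar c hc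
  simp only at hb m2 lln hIB hsmall hpar ⊢
  obtain ⟨w, x, hwT, hw, hx, hrb, hnw, hhx, hwx, hΔ⟩ := hpar
  set Δ := firstRate h n with hΔdef
  set β := βhat n ω
  have hw0 : 0 < w := by linarith
  have hx0 : 0 < x := by linarith
  have hh : 0 < h n := by rw [hhx]; positivity
  have hΔh : Δ / h n = 1 / w ^ 8 := by rw [hΔ, hhx]; field_simp
  have hβmem : β ∈ Metric.ball βs r := by rw [mem_ball_iff_norm]; linarith
  have hβs : βs ∈ Metric.ball βs r := Metric.mem_ball_self hr
  -- The weighted fraction of observations near the window is O(h), uniformly in c: the uniform law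
  -- of large numbers with error h, plus a bounded density.
  have htrap : sampleMean Z n (densSummand trapezoid G y (h n) c βs) ω ≤ h n * (1 + I * Cf) := by
    have h1 := (abs_le.1 (lln c hc)).2
    have hint : Integrable fun u => trapezoid ((u - c) / h n) :=
      (integrable_trapezoid.comp_div hh.ne').comp_sub_right c
    have h2 : ∫ u, trapezoid ((u - c) / h n) = h n * I := by
      rw [integral_sub_right_eq_self (fun u => trapezoid (u / h n)) c, Measure.integral_comp_div,
        abs_of_pos hh, smul_eq_mul]
    have h3 := hf.integral_mul_le hint (fun u => trapezoid_nonneg _) hfb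
    have h4 : ∫ ω, classWeight y (Z 0 ω).1 * trapezoid ((G (Z 0 ω).2 βs - c) / h n) ∂μ =
        μ.real {ω | Y 0 ω = y} * ∫ u, trapezoid ((u - c) / h n) * f u :=
      hf.integral_classWeight (hiid.measurable_Y 0) hGX hy
        (φ := fun u => trapezoid ((u - c) / h n))
        (continuous_trapezoid.comp (by fun_prop : Continuous fun u => (u - c) / h n)).measurable
    have hP1 : μ.real {ω | Y 0 ω = y} ≤ 1 := measureReal_le_one
    have hJ0 : 0 ≤ ∫ u, trapezoid ((u - c) / h n) * f u :=
      integral_nonneg fun u => mul_nonneg (trapezoid_nonneg _) (hf.nonneg u)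
    have h5 : μ.real {ω | Y 0 ω = y} * ∫ u, trapezoid ((u - c) / h n) * f u ≤ h n * I * Cf := by
      calc _ ≤ 1 * ∫ u, trapezoid ((u - c) / h n) * f u := by gcongr
        _ ≤ _ := by rw [one_mul, ← h2]; exact h3
    rw [h4] at h1
    change sampleMean Z n (fun x => classWeight y x.1 * trapezoid ((G x.2 βs - c) / h n)) ω ≤ _
    linarith
  have hpt : ∀ i < n, |densSummand K G y (h n) c β (Z i ω) -
      densSummand K G y (h n) c βs (Z i ω)| ≤
      C * (1 / w ^ 8) * (1 / w ^ 4 + 1 / w ^ 8) * L (Z i ω).2 ^ 2 +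
        C * (1 / w ^ 8) * w ^ 4 * densSummand trapezoid G y (h n) c βs (Z i ω) := by
    intro i _
    have hi := hIB i
    have hL0 : 0 ≤ L (X i ω) := (norm_nonneg _).trans (hi.grad _ hβs)
    set u := (G (X i ω) βs - c) / h n with hu
    set v := (G (X i ω) β - c) / h n with hv
    set l := L (X i ω) * (1 / w ^ 8) with hl
    have hvu : |v - u| ≤ l := by
      have : v - u = (G (X i ω) β - G (X i ω) βs) / h n := by rw [hu, hv]; ring
      rw [this, abs_div, abs_of_pos hh, hl, ← hΔh, ← mul_div_assoc]
      gcongr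
      exact (hi.abs_sub_le hβmem hβs).trans (by gcongr)
    have b1 := hK.abs_sub_le_trapezoid hC hKl hvu
    have t0 := trapezoid_nonneg u
    have t1 := trapezoid_le_one u
    have c0 := classWeight_nonneg y (Y i ω)
    have c1 := classWeight_le_one y (Y i ω)
    -- Young's inequality separates the envelope, which is only square integrable, from the
    -- localisation. The weight w^4 makes both resulting contributions O(x / w^12), using x ≥ 1 for
    -- the first.
    have young : L (X i ω) * trapezoid u ≤ 1 / w ^ 4 * L (X i ω) ^ 2 + w ^ 4 * trapezoid u := by
      have h1 : L (X i ω) * trapezoid u ≤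
          1 / w ^ 4 * L (X i ω) ^ 2 + w ^ 4 * trapezoid u ^ 2 := by
        have h2 : 1 / w ^ 4 * L (X i ω) ^ 2 + w ^ 4 * trapezoid u ^ 2 - L (X i ω) * trapezoid u =
            1 / w ^ 4 * ((L (X i ω) - w ^ 4 * trapezoid u / 2) ^ 2 +
              3 / 4 * (w ^ 4 * trapezoid u) ^ 2) := by
          field_simp
          ring
        have h3 : 0 ≤ 1 / w ^ 4 * ((L (X i ω) - w ^ 4 * trapezoid u / 2) ^ 2 +
              3 / 4 * (w ^ 4 * trapezoid u) ^ 2) := by positivity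
        linarith
      refine h1.trans ?_
      gcongr
      nlinarith
    have e1 : densSummand K G y (h n) c β (Z i ω) - densSummand K G y (h n) c βs (Z i ω) =
        classWeight y (Y i ω) * (K v - K u) := by
      simp only [densSummand, hZdef, ← hu, ← hv]; ring
    have e2 : densSummand trapezoid G y (h n) c βs (Z i ω) =
        classWeight y (Y i ω) * trapezoid u := rfl
    rw [e1, e2, abs_mul, abs_of_nonneg c0]
    calc classWeight y (Y i ω) * |K v - K u|
        ≤ classWeight y (Y i ω) * (C * (l * trapezoid u + l ^ 2)) := by gcongr
      _ = classWeight y (Y i ω) * (C * (1 / w ^ 8)) *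
          (L (X i ω) * trapezoid u + 1 / w ^ 8 * L (X i ω) ^ 2) := by rw [hl]; ring
      _ ≤ classWeight y (Y i ω) * (C * (1 / w ^ 8)) *
          ((1 / w ^ 4 * L (X i ω) ^ 2 + w ^ 4 * trapezoid u) + 1 / w ^ 8 * L (X i ω) ^ 2) := by
          gcongr
      _ = classWeight y (Y i ω) * (C * (1 / w ^ 8) * (1 / w ^ 4 + 1 / w ^ 8) * L (X i ω) ^ 2) +
          C * (1 / w ^ 8) * w ^ 4 * (classWeight y (Y i ω) * trapezoid u) := by ring
      _ ≤ 1 * (C * (1 / w ^ 8) * (1 / w ^ 4 + 1 / w ^ 8) * L (X i ω) ^ 2) +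
          C * (1 / w ^ 8) * w ^ 4 * (classWeight y (Y i ω) * trapezoid u) := by gcongr
      _ = _ := by rw [one_mul]
  refine (abs_sampleMean_sub_le (D := fun z => C * (1 / w ^ 8) * (1 / w ^ 4 + 1 / w ^ 8) *
    L z.2 ^ 2 + C * (1 / w ^ 8) * w ^ 4 * densSummand trapezoid G y (h n) c βs z) hpt).trans ?_
  rw [sampleMean_add, sampleMean_const_mul, sampleMean_const_mul, hrb]
  have hpow : 1 / w ^ 8 ≤ 1 / w ^ 4 :=
    one_div_le_one_div_of_le (by positivity) (pow_le_pow_right₀ hw (by norm_num))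
  have hAx : A₂ ≤ A₂ * x := le_mul_of_one_le_right hA₂0 hx
  calc C * (1 / w ^ 8) * (1 / w ^ 4 + 1 / w ^ 8) * sampleMean Z n (fun z => L z.2 ^ 2) ω +
      C * (1 / w ^ 8) * w ^ 4 * sampleMean Z n (densSummand trapezoid G y (h n) c βs) ω
      ≤ C * (1 / w ^ 8) * (1 / w ^ 4 + 1 / w ^ 8) * A₂ +
        C * (1 / w ^ 8) * w ^ 4 * (h n * (1 + I * Cf)) := by gcongr
    _ ≤ C * (1 / w ^ 8) * (1 / w ^ 4 + 1 / w ^ 4) * (A₂ * x) +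
        C * (1 / w ^ 8) * w ^ 4 * (h n * (1 + I * Cf)) := by
        exact add_le_add_left (mul_le_mul (mul_le_mul_of_nonneg_left (by linarith)
          (by positivity)) hAx hA₂0 (by positivity)) _
    _ = C * (2 * A₂ + 1 + I * Cf) * (x / w ^ 12) := by rw [hhx]; field_simp; ring
    -- The constant is absorbed by one factor w, through the threshold imposed on w above.
    _ ≤ w * (x / w ^ 12) := by gcongr
    _ = x / w ^ 11 := by field_simp
    _ ≤ x / w ^ 9 := by
        exact div_le_div_of_nonneg_left hx0.le (by positivity)
          (pow_le_pow_right₀ hw (by norm_num))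
    _ = h n / w := by rw [hhx]; field_simp

end DensityEstimator

/-! ### The likelihood ratio estimator inside the margin -/

section LikelihoodRatioEstimator

/-- Stability of a ratio under small perturbations of its two terms. -/
theorem abs_ratio_sub_le {P₀ P₁ m₀ m₁ S₀ S₁ l B θ η : ℝ} (hP₀ : 0 < P₀) (hP₁ : 0 ≤ P₁)
    (hP₁' : P₁ ≤ 1) (hm₀ : 0 < m₀) (hB : |l| ≤ B) (hlr : |m₁ - l * m₀| ≤ η * m₀)
    (h₁ : |S₁ - P₁ * m₁| ≤ θ * m₀) (h₀ : |S₀ - P₀ * m₀| ≤ θ * m₀) (hθ : θ ≤ P₀ / 2) :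
    0 < S₀ ∧ |S₁ / S₀ - P₁ / P₀ * l| ≤ 2 * (θ * (1 + B / P₀) + η) / P₀ := by
  have hB0 : 0 ≤ B := (abs_nonneg _).trans hB
  have hS₀ : P₀ * m₀ / 2 ≤ S₀ := by
    have h1 : θ * m₀ ≤ P₀ / 2 * m₀ := by gcongr
    linarith [(abs_le.1 h₀).1]
  have hS₀' : 0 < S₀ := lt_of_lt_of_le (by positivity) hS₀
  refine ⟨hS₀', ?_⟩
  have hθ0 : 0 ≤ θ := by
    by_contra! hneg
    linarith [abs_nonneg (S₀ - P₀ * m₀), mul_neg_of_neg_of_pos hneg hm₀]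
  have hη0 : 0 ≤ η := by
    by_contra! hneg
    linarith [abs_nonneg (m₁ - l * m₀), mul_neg_of_neg_of_pos hneg hm₀]
  -- All three terms of the numerator are at most a small multiple of m₀, and the denominator is at
  -- least P₀ m₀ / 2, so m₀ cancels however small it is.
  have e : S₁ / S₀ - P₁ / P₀ * l =
      ((S₁ - P₁ * m₁) + P₁ * (m₁ - l * m₀) - P₁ / P₀ * l * (S₀ - P₀ * m₀)) / S₀ := by
    field_simp
    ring
  have num : |(S₁ - P₁ * m₁) + P₁ * (m₁ - l * m₀) - P₁ / P₀ * l * (S₀ - P₀ * m₀)| ≤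
      (θ * (1 + B / P₀) + η) * m₀ := by
    calc _ ≤ |S₁ - P₁ * m₁| + |P₁ * (m₁ - l * m₀)| + |P₁ / P₀ * l * (S₀ - P₀ * m₀)| :=
          (abs_sub _ _).trans (add_le_add (abs_add_le _ _) le_rfl)
      _ ≤ θ * m₀ + 1 * (η * m₀) + 1 / P₀ * B * (θ * m₀) := by
          rw [abs_mul, abs_mul, abs_mul, abs_of_nonneg hP₁,
            abs_of_nonneg (by positivity : 0 ≤ P₁ / P₀)]
          gcongr
      _ = _ := by field_simp; ring
  rw [e, abs_div, abs_of_pos hS₀']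
  calc _ ≤ (θ * (1 + B / P₀) + η) * m₀ / (P₀ * m₀ / 2) := by gcongr
    _ = _ := by field_simp

variable {Ω : Type*} [MeasurableSpace Ω] {μ : Measure Ω} {k p : ℕ} {Y : ℕ → Ω → ℝ}
  {X : ℕ → Ω → Vec k} {G : Vec k → Vec p → ℝ} {βs : Vec p} {βhat : ℕ → Ω → Vec p} {r : ℝ}
  {K : ℝ → ℝ} {h δ : ℕ → ℝ} {a₀ b₀ a₁ b₁ : ℝ} {f₀ f₁ lr : ℝ → ℝ}

/-- A lower bound for the smoothed density near the boundary of its support. -/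
theorem KernelBandwidth.le_integral_mul (hK : KernelBandwidth K h) {y a b : ℝ} {f : ℝ → ℝ}
    (hf : CondDensity μ (Y 0) (X 0) G βs y a b f) {d t q c : ℝ} (ht : 0 < t)
    (hq : ∀ u ∈ Icc (a + d) (b - d), q ≤ f u) (hdt : d + t ≤ (b - a) / 2)
    (hc : c ∈ Icc (a + d) (b - d)) : t * (q / 2) ≤ ∫ u, K ((u - c) / t) * f u := by
  obtain ⟨C, hC, hKb, hKl⟩ := hK.exists_bound
  have hKm : Measurable fun u => K ((u - c) / t) :=
    (hK.continuous.comp (by fun_prop : Continuous fun u => (u - c) / t)).measurable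
  have hi := hf.integrable_mul hKm (fun u => hKb _)
  -- The bandwidth may exceed the margin, so the window can leave the support. Symmetry of K permits
  -- averaging f over u and its reflection 2c - u, and at least one of these two points lies on the
  -- inner side, where f ≥ q.
  have hrefl : ∫ u, K ((u - c) / t) * f (2 * c - u) = ∫ u, K ((u - c) / t) * f u := by
    rw [← integral_sub_left_eq_self (fun u => K ((u - c) / t) * f u) volume (2 * c)]
    refine integral_congr_ae (ae_of_all _ fun u => ?_)
    simp only
    rw [← hK.symm ((u - c) / t)]
    congr 2
    ring
  have hi' : Integrable fun u => K ((u - c) / t) * f (2 * c - u) := by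
    have h1 := hi.comp_sub_left (2 * c)
    refine h1.congr (ae_of_all _ fun u => ?_)
    simp only
    rw [← hK.symm ((u - c) / t)]
    congr 2
    ring
  have hpt : ∀ u, |u - c| ≤ t → q ≤ f u + f (2 * c - u) := by
    intro u hu
    obtain ⟨h1, h2⟩ := abs_le.1 hu
    have key : u ∈ Icc (a + d) (b - d) ∨ 2 * c - u ∈ Icc (a + d) (b - d) := by
      rcases le_total c ((a + b) / 2) with hmid | hmid <;> rcases le_total c u with hcu | hcu
      · left; constructor <;> linarith [hc.1, hc.2]
      · right; constructor <;> linarith [hc.1, hc.2]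
      · right; constructor <;> linarith [hc.1, hc.2]
      · left; constructor <;> linarith [hc.1, hc.2]
    rcases key with hk | hk
    · linarith [hq _ hk, hf.nonneg (2 * c - u)]
    · linarith [hq _ hk, hf.nonneg u]
  have h2 : t * q ≤ (∫ u, K ((u - c) / t) * f u) + ∫ u, K ((u - c) / t) * f (2 * c - u) := by
    rw [← integral_add hi hi']
    have h3 := hK.integral_scaled c ht
    calc t * q = ∫ u, K ((u - c) / t) * q := by rw [integral_mul_const, h3]
      _ ≤ _ := by
        refine integral_mono ((hK.integrable_scaled c ht).mul_const q) (hi.add hi') fun u => ?_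
        simp only
        rw [← mul_add]
        by_cases hle : |u - c| ≤ t
        · exact mul_le_mul_of_nonneg_left (hpt u hle) (hK.nonneg _)
        · rw [hK.scaled_eq_zero ht (not_le.1 hle), zero_mul, zero_mul]
  rw [hrefl] at h2
  linarith

/-- The end points, where the ratio is defined by extension only, form a null set; outside [a₀, b₀]
both densities vanish. -/
theorem LikelihoodRatio.ae_eq_mul (hlr : LikelihoodRatio a₀ b₀ f₀ f₁ lr)
    (hf₀ : CondDensity μ (Y 0) (X 0) G βs 0 a₀ b₀ f₀) (hdecay : DensityDecay a₀ b₀ f₀)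
    (hf₁ : CondDensity μ (Y 0) (X 0) G βs 1 a₁ b₁ f₁) (hsub : Icc a₁ b₁ ⊆ Icc a₀ b₀) :
    ∀ᵐ u : ℝ, f₁ u = lr u * f₀ u := by
  have hne : ∀ e : ℝ, ∀ᵐ u : ℝ, u ≠ e := fun e => by
    simp [ae_iff]
  filter_upwards [hne a₀, hne b₀] with u ha hb
  by_cases hu : u ∈ Icc a₀ b₀
  · have hIoo : u ∈ Ioo a₀ b₀ := ⟨lt_of_le_of_ne hu.1 (Ne.symm ha), lt_of_le_of_ne hu.2 hb⟩
    rw [hlr.eq u hIoo, div_mul_cancel₀ _ (hdecay.pos u hIoo).ne']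
  · rw [hf₀.eq_zero hu, hf₁.eq_zero fun h => hu (hsub h), mul_zero]

/-- The ratio of the smoothed densities is close to the likelihood ratio. -/
theorem LikelihoodRatio.abs_integral_sub_le (hlr : LikelihoodRatio a₀ b₀ f₀ f₁ lr)
    (hf₀ : CondDensity μ (Y 0) (X 0) G βs 0 a₀ b₀ f₀) (hdecay : DensityDecay a₀ b₀ f₀)
    (hf₁ : CondDensity μ (Y 0) (X 0) G βs 1 a₁ b₁ f₁) (hsub : Icc a₁ b₁ ⊆ Icc a₀ b₀)
    (hK : KernelBandwidth K h) {t η c : ℝ} (ht : 0 < t)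
    (hmod : ∀ u ∈ Icc a₀ b₀, ∀ c ∈ Icc a₀ b₀, |u - c| ≤ t → |lr u - lr c| ≤ η)
    (hc : c ∈ Icc a₀ b₀) :
    |(∫ u, K ((u - c) / t) * f₁ u) - lr c * ∫ u, K ((u - c) / t) * f₀ u| ≤
      η * ∫ u, K ((u - c) / t) * f₀ u := by
  obtain ⟨C, hC, hKb, hKl⟩ := hK.exists_bound
  have hKm : Measurable fun u => K ((u - c) / t) :=
    (hK.continuous.comp (by fun_prop : Continuous fun u => (u - c) / t)).measurable
  have hi₀ := hf₀.integrable_mul hKm (fun u => hKb _)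
  have hi₁ := hf₁.integrable_mul hKm (fun u => hKb _)
  rw [← integral_const_mul, ← integral_const_mul, ← integral_sub hi₁ (hi₀.const_mul _)]
  refine abs_integral_le_integral_abs.trans ?_
  refine integral_mono_of_nonneg (ae_of_all _ fun _ => abs_nonneg _) (hi₀.const_mul _) ?_
  filter_upwards [hlr.ae_eq_mul hf₀ hdecay hf₁ hsub] with u hu
  -- The error carries the factor f₀ under the integral, so the bound is relative to the smoothed
  -- f₀. Parts of the window outside [a₀, b₀] contribute nothing.
  have e : K ((u - c) / t) * f₁ u - lr c * (K ((u - c) / t) * f₀ u) =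
      (lr u - lr c) * (K ((u - c) / t) * f₀ u) := by rw [hu]; ring
  have hnn : 0 ≤ K ((u - c) / t) * f₀ u := mul_nonneg (hK.nonneg _) (hf₀.nonneg u)
  rw [e, abs_mul, abs_of_nonneg hnn]
  by_cases hle : |u - c| ≤ t
  · by_cases hu0 : u ∈ Icc a₀ b₀
    · exact mul_le_mul_of_nonneg_right (hmod u hu0 c hc hle) hnn
    · rw [hf₀.eq_zero hu0, mul_zero, mul_zero, mul_zero]
  · rw [hK.scaled_eq_zero ht (not_le.1 hle), zero_mul, mul_zero, mul_zero]

/-- With exponent 1/(32 κ) in `slow`, the κ-th power of δ n^(1/(32 κ)) is w δ^κ. -/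
theorem MarginRate.tendsto_rateBase_mul_pow (hδ : MarginRate δ) {κ : ℕ} (hκ : 0 < κ) :
    Tendsto (fun n => rateBase n * δ n ^ κ) atTop atTop := by
  have hκ' : (0 : ℝ) < κ := by exact_mod_cast hκ
  have h1 := hδ.slow (1 / 32 / κ) (by positivity)
  refine ((tendsto_pow_atTop hκ.ne').comp h1).congr fun n => ?_
  simp only [Function.comp_apply]
  rw [mul_pow, ← Real.rpow_natCast ((n : ℝ) ^ (1 / 32 / κ : ℝ)), ← Real.rpow_mul (Nat.cast_nonneg n),
    div_mul_cancel₀ _ hκ'.ne', rateBase, mul_comm]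

theorem IIDSample.tendsto_classFrequency [IsProbabilityMeasure μ] (hiid : IIDSample μ Y X) {y : ℝ}
    (hy : 0 < μ {ω | Y 0 ω = y}) :
    Tendsto (fun z : ℕ × Ω => sampleMean (fun i ω => (Y i ω, X i ω)) z.1
      (fun z => classWeight y z.1) z.2) (inProb μ) (𝓝 (μ.real {ω | Y 0 ω = y})) := by
  have h1 := hiid.isIID.tendsto_sampleMean (F := fun z => classWeight y z.1)
    ((measurable_classWeight y).comp measurable_fst)
    ((memLp_classWeight hiid y).integrable (by norm_num))
  have h2 : ∫ ω, classWeight y (Y 0 ω) ∂μ = μ.real {ω | Y 0 ω = y} := by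
    have hp : IsProbabilityMeasure (ProbabilityTheory.cond μ {ω | Y 0 ω = y}) :=
      cond_isProbabilityMeasure hy.ne'
    have := integral_classWeight_mul (hiid.measurable_Y 0) hy (fun _ => 1)
    simpa using this
  rwa [h2] at h1

/-- Consistency of the estimated likelihood ratio inside the margin. -/
theorem eventually_densRatio_consistent [IsProbabilityMeasure μ] (hr : 0 < r)
    (hiid : IIDSample μ Y X) (hG : IndexSmooth μ (X 0) G βs r) (hK : KernelBandwidth K h)
    (hβ : ∀ᶠ z in inProb μ, ‖βhat z.1 z.2 - βs‖ ≤ firstRate h z.1)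
    (hf₀ : CondDensity μ (Y 0) (X 0) G βs 0 a₀ b₀ f₀) (hdecay : DensityDecay a₀ b₀ f₀)
    (hf₁ : CondDensity μ (Y 0) (X 0) G βs 1 a₁ b₁ f₁) (hsub : Icc a₁ b₁ ⊆ Icc a₀ b₀)
    (hlr : LikelihoodRatio a₀ b₀ f₀ f₁ lr) (hδ : MarginRate δ) {ε : ℝ} (hε : 0 < ε) :
    ∀ᶠ z in inProb μ, ∀ c ∈ Icc (a₀ + δ z.1) (b₀ - δ z.1),
      0 < sampleMean (fun i ω => (Y i ω, X i ω)) z.1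
          (densSummand K G 0 (h z.1) c (βhat z.1 z.2)) z.2 ∧
      |sampleMean (fun i ω => (Y i ω, X i ω)) z.1 (fun z => classWeight 0 z.1) z.2 /
        sampleMean (fun i ω => (Y i ω, X i ω)) z.1 (fun z => classWeight 1 z.1) z.2 *
        (sampleMean (fun i ω => (Y i ω, X i ω)) z.1
          (densSummand K G 1 (h z.1) c (βhat z.1 z.2)) z.2 /
        sampleMean (fun i ω => (Y i ω, X i ω)) z.1
          (densSummand K G 0 (h z.1) c (βhat z.1 z.2)) z.2) - lr c| ≤ ε := by
  have hab := hf₀.lt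
  have s₀ := eventually_densSummand_sub_le hr hiid hG hK hβ hiid.pos_zero hf₀ hab
  have s₁ := eventually_densSummand_sub_le hr hiid hG hK hβ hiid.pos_one hf₁ hab
  have t₀ := eventually_densSummand_concentrate hiid hG hK hiid.pos_zero hf₀ hab
  have t₁ := eventually_densSummand_concentrate hiid hG hK hiid.pos_one hf₁ hab
  have q₀ := hiid.tendsto_classFrequency hiid.pos_zero
  have q₁ := hiid.tendsto_classFrequency hiid.pos_one
  set Z : ℕ → Ω → ℝ × Vec k := fun i ω => (Y i ω, X i ω) with hZdef
  set P₀ := μ.real {ω | Y 0 ω = 0} with hP₀def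
  set P₁ := μ.real {ω | Y 0 ω = 1} with hP₁def
  have hP₀ : 0 < P₀ := ENNReal.toReal_pos hiid.pos_zero.ne' (measure_ne_top _ _)
  have hP₁ : 0 < P₁ := ENNReal.toReal_pos hiid.pos_one.ne' (measure_ne_top _ _)
  have hP₁' : P₁ ≤ 1 := measureReal_le_one
  obtain ⟨B', hB'⟩ := isCompact_Icc.exists_bound_of_continuousOn hlr.continuous
  set B := max B' 0 with hBdef
  have hB0 : 0 ≤ B := le_max_right _ _
  have hB : ∀ c ∈ Icc a₀ b₀, |lr c| ≤ B := fun c hc => (hB' c hc).trans (le_max_left _ _)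
  have q := q₀.div q₁ hP₁.ne'
  set Q : ℝ := P₀ / P₁ + 1 with hQ
  have hQ0 : 0 < Q := by positivity
  have q' := q.eventually_le_const (show P₀ / P₁ < Q by linarith)
  have q₀' := q₀.eventually_const_le (show P₀ / 2 < P₀ by linarith)
  have q₁' := q₁.eventually_const_le (show P₁ / 2 < P₁ by linarith)
  have q'' : ∀ᶠ z in inProb μ, |sampleMean Z z.1 (fun z => classWeight 0 z.1) z.2 /
      sampleMean Z z.1 (fun z => classWeight 1 z.1) z.2 * (P₁ / P₀) - 1| * B ≤ ε / 2 := by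
    have h1 := (((q.mul_const (P₁ / P₀)).sub_const 1).abs).mul_const B
    have h2 : P₀ / P₁ * (P₁ / P₀) = 1 := by field_simp
    rw [h2, sub_self, abs_zero, zero_mul] at h1
    exact h1.eventually_le_const (by positivity)
  -- Q bounds the ratio of class frequencies multiplying the estimated ratio, so ε' spends half of ε
  -- there. The other half covers the error of that frequency ratio.
  set ε' := ε / (2 * Q) with hε'
  have hε'0 : 0 < ε' := by positivity
  set η := ε' * P₀ / 4 with hη
  have hη0 : 0 < η := by positivity
  set θ := min (P₀ / 2) (ε' * P₀ / (4 * (1 + B / P₀))) with hθ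
  have hθ0 : 0 < θ := by positivity
  have hfin : 2 * (θ * (1 + B / P₀) + η) / P₀ ≤ ε' := by
    have h1 : θ * (1 + B / P₀) ≤ ε' * P₀ / (4 * (1 + B / P₀)) * (1 + B / P₀) := by
      gcongr
      exact min_le_right _ _
    have h2 : ε' * P₀ / (4 * (1 + B / P₀)) * (1 + B / P₀) = ε' * P₀ / 4 := by field_simp
    rw [div_le_iff₀ hP₀]
    linarith
  obtain ⟨d, hd, hmod⟩ := exists_modulus hlr.continuous hη0
  obtain ⟨M, hM, κ, hκ, hdec⟩ := hdecay.decay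
  have hsmall : ∀ᶠ n in atTop, δ n + h n ≤ (b₀ - a₀) / 2 := by
    have := hδ.tendsto_zero.add hK.bandwidth_zero
    rw [add_zero] at this
    exact this.eventually_le_const (by linarith)
  filter_upwards [s₀, s₁, t₀, t₁, q', q₀', q₁', q'', tendsto_fst_inProb.eventually hsmall,
    tendsto_fst_inProb.eventually hK.eventually_pos,
    tendsto_fst_inProb.eventually (hK.bandwidth_zero.eventually_le_const hd),
    tendsto_fst_inProb.eventually (tendsto_rateBase.eventually_gt_atTop 0),
    tendsto_fst_inProb.eventually
      ((hδ.tendsto_rateBase_mul_pow hκ).eventually_ge_atTop (4 / (θ * M)))]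
    with ⟨n, ω⟩ s₀ s₁ t₀ t₁ q' q₀' q₁' q'' hsmall hh hhd hw hwδ c hc
  simp only [Pi.div_apply] at s₀ s₁ t₀ t₁ q' q₀' q₁' q'' hsmall hh hhd hw hwδ hc ⊢
  have hδ0 := hδ.pos n
  have hcI : c ∈ Icc a₀ b₀ := ⟨by linarith [hc.1], by linarith [hc.2]⟩
  set S₀ := sampleMean Z n (densSummand K G 0 (h n) c (βhat n ω)) ω
  set S₁ := sampleMean Z n (densSummand K G 1 (h n) c (βhat n ω)) ω
  set m₀ := ∫ u, K ((u - c) / h n) * f₀ u with hm₀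
  set m₁ := ∫ u, K ((u - c) / h n) * f₁ u with hm₁
  have hlow : h n * (M * δ n ^ κ / 2) ≤ m₀ := by
    refine hK.le_integral_mul hf₀ hh (d := δ n) (fun u hu => ?_) hsmall hc
    refine le_trans ?_ (hdec u ⟨by linarith [hu.1], by linarith [hu.2]⟩)
    gcongr
    exact le_min (by linarith [hu.1]) (by linarith [hu.2])
  have hm₀0 : 0 < m₀ := lt_of_lt_of_le (by positivity) hlow
  -- The factor 2 counts the replacement error and the sampling error. They are dominated because m₀
  -- ≥ h M δ^κ / 2 and w δ^κ ≥ 4 / (θ M).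
  have herr : 2 * (h n / rateBase n) ≤ θ * m₀ := by
    have h1 : 2 * (h n / rateBase n) ≤ θ * (h n * (M * δ n ^ κ / 2)) := by
      rw [div_le_iff₀ (by positivity)] at hwδ
      rw [← mul_div_assoc, div_le_iff₀ hw]
      have h2 : θ * (h n * (M * δ n ^ κ / 2)) * rateBase n =
          h n / 2 * (rateBase n * δ n ^ κ * (θ * M)) := by ring
      rw [h2]
      calc 2 * h n = h n / 2 * 4 := by ring
        _ ≤ _ := by gcongr
    exact h1.trans (by gcongr)
  have e₀ : |S₀ - P₀ * m₀| ≤ θ * m₀ := by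
    refine le_trans ?_ herr
    refine (abs_sub_le _ _ _).trans ((add_le_add (s₀ c hcI) (t₀ c hcI)).trans_eq ?_)
    ring
  have e₁ : |S₁ - P₁ * m₁| ≤ θ * m₀ := by
    refine le_trans ?_ herr
    refine (abs_sub_le _ _ _).trans ((add_le_add (s₁ c hcI) (t₁ c hcI)).trans_eq ?_)
    ring
  have elr : |m₁ - lr c * m₀| ≤ η * m₀ := hlr.abs_integral_sub_le hf₀ hdecay hf₁ hsub hK hh
    (fun u hu c hc huc => hmod u hu c hc (huc.trans hhd)) hcI
  obtain ⟨hS₀, hrat⟩ := abs_ratio_sub_le hP₀ hP₁.le hP₁' hm₀0 (hB c hcI) elr e₁ e₀ (min_le_left _ _)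
  refine ⟨hS₀, ?_⟩
  set ρ := sampleMean Z n (fun z => classWeight 0 z.1) ω /
    sampleMean Z n (fun z => classWeight 1 z.1) ω
  have hρ0 : 0 ≤ ρ := div_nonneg (by linarith) (by linarith)
  have e : ρ * (S₁ / S₀) - lr c =
      ρ * (S₁ / S₀ - P₁ / P₀ * lr c) + (ρ * (P₁ / P₀) - 1) * lr c := by ring
  rw [e]
  refine (abs_add_le _ _).trans ?_
  rw [abs_mul, abs_mul, abs_of_nonneg hρ0]
  calc ρ * |S₁ / S₀ - P₁ / P₀ * lr c| + |ρ * (P₁ / P₀) - 1| * |lr c|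
      ≤ Q * ε' + |ρ * (P₁ / P₀) - 1| * B := by
        gcongr
        · exact hrat.trans hfin
        · exact hB c hcI
    _ ≤ ε / 2 + ε / 2 := by
        refine add_le_add (le_of_eq ?_) q''
        rw [hε']; field_simp
    _ = ε := by ring

end LikelihoodRatioEstimator

/-! ### Consistency of the estimated cutoffs -/

section Cutoff

/-- Inversion of uniformly close rate functions. -/
theorem abs_cutoff_sub_le {a b : ℝ} (hab : a ≤ b) {F F' : ℝ → ℝ} {ε η : ℝ} (hε : 0 < ε)
    (hη : 0 < η) (hF : ∀ c ∈ Icc a b, c + ε ≤ b → F (c + ε) ≤ F c - η)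
    (hclose : ∀ c ∈ Icc a b, |F' c - F c| ≤ η / 2) (t : ℝ) :
    |cutoff a b F' t - cutoff a b F t| ≤ 2 * ε := by
  have hle : ∀ (H : ℝ → ℝ) (c : ℝ), c ∈ Icc a b → H c ≤ t → cutoff a b H t ≤ c := by
    intro H c hc hH
    refine csInf_le ⟨a, ?_⟩ (Or.inl ⟨hc, hH⟩)
    rintro x (hx | hx)
    · exact hx.1.1
    · rw [mem_singleton_iff.1 hx]; exact hab
  have hleb : ∀ H : ℝ → ℝ, cutoff a b H t ≤ b := by
    intro H
    refine csInf_le ⟨a, ?_⟩ (Or.inr rfl)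
    rintro x (hx | hx)
    · exact hx.1.1
    · rw [mem_singleton_iff.1 hx]; exact hab
  -- The infimum need not be attained, so it is approached within ε. Moving a further ε to the right
  -- lowers F by η, more than the discrepancy η / 2, and so makes the point admissible for the other
  -- function: 2 ε in total.
  have hex : ∀ H : ℝ → ℝ, ∃ c, ((c ∈ Icc a b ∧ H c ≤ t) ∨ c = b) ∧ c < cutoff a b H t + ε := by
    intro H
    have hne : ({c | c ∈ Icc a b ∧ H c ≤ t} ∪ {b}).Nonempty := ⟨b, Or.inr rfl⟩
    obtain ⟨c, hc, hlt⟩ := exists_lt_of_csInf_lt hne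
      (show sInf ({c | c ∈ Icc a b ∧ H c ≤ t} ∪ {b}) < cutoff a b H t + ε by
        unfold cutoff; linarith)
    exact ⟨c, hc, hlt⟩
  rw [abs_le]
  constructor
  · obtain ⟨c, hc | rfl, hlt⟩ := hex F'
    · by_cases hcb : c + ε ≤ b
      · have h1 := hF c hc.1 hcb
        have h2 := (abs_le.1 (hclose c hc.1)).1
        have := hle F (c + ε) ⟨by linarith [hc.1.1], hcb⟩ (by linarith [hc.2])
        linarith
      · linarith [hleb F]
    · linarith [hleb F]
  · by_cases hb : b ≤ cutoff a b F t + 2 * ε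
    · linarith [hleb F']
    · obtain ⟨c, hc | rfl, hlt⟩ := hex F
      · have hcb : c + ε ≤ b := by linarith
        have hmem : c + ε ∈ Icc a b := ⟨by linarith [hc.1.1], hcb⟩
        have h1 := hF c hc.1 hcb
        have h2 := (abs_le.1 (hclose _ hmem)).2
        have := hle F' (c + ε) hmem (by linarith [hc.2])
        linarith
      · linarith

/-- A Lipschitz approximation of the indicator of the positive half line. -/
def ramp (u : ℝ) : ℝ := max 0 (min 1 u)

theorem ramp_nonneg (u : ℝ) : 0 ≤ ramp u := le_max_left _ _

theorem ramp_le_one (u : ℝ) : ramp u ≤ 1 := max_le zero_le_one (min_le_left _ _)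

theorem abs_ramp_le_one (u : ℝ) : |ramp u| ≤ 1 := by
  rw [abs_of_nonneg (ramp_nonneg u)]
  exact ramp_le_one u

theorem ramp_of_nonpos {u : ℝ} (hu : u ≤ 0) : ramp u = 0 :=
  max_eq_left ((min_le_right _ _).trans hu)

theorem ramp_of_one_le {u : ℝ} (hu : 1 ≤ u) : ramp u = 1 := by
  rw [ramp, min_eq_left hu, max_eq_right zero_le_one]

theorem continuous_ramp : Continuous ramp := by
  unfold ramp
  fun_prop

theorem abs_ramp_sub_le (u v : ℝ) : |ramp u - ramp v| ≤ 1 * |u - v| := by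
  rw [one_mul]
  unfold ramp
  calc |max 0 (min 1 u) - max 0 (min 1 v)| ≤ |min 1 u - min 1 v| := by
        simpa using abs_max_sub_max_le_max 0 (min 1 u) 0 (min 1 v)
    _ ≤ |u - v| := by simpa using abs_min_sub_min_le_max 1 u 1 v

theorem ramp_le_indicator {g c η : ℝ} (hη : 0 < η) :
    ramp ((g - c) / η) ≤ (Ioi c).indicator (fun _ => 1) g := by
  by_cases h : c < g
  · rw [indicator_of_mem (mem_Ioi.2 h)]
    exact ramp_le_one _
  · rw [indicator_of_notMem (by simpa using h), ramp_of_nonpos]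
    exact div_nonpos_of_nonpos_of_nonneg (by linarith) hη.le

theorem indicator_le_ramp {g c η : ℝ} (hη : 0 < η) :
    (Ioi c).indicator (fun _ => 1) g ≤ ramp ((g - (c - η)) / η) := by
  by_cases h : c < g
  · rw [indicator_of_mem (mem_Ioi.2 h), ramp_of_one_le]
    rw [one_le_div hη]
    linarith
  · rw [indicator_of_notMem (by simpa using h)]
    exact ramp_nonneg _

theorem falsePosHat_eq {Ω : Type*} {k p : ℕ} {Y : ℕ → Ω → ℝ} {X : ℕ → Ω → Vec k}
    {G : Vec k → Vec p → ℝ} (n : ℕ) (hn : 0 < n) (c : ℝ) (β : Vec p) (ω : Ω) :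
    falsePosHat G n (fun i => Y i ω) (fun i => X i ω) c β =
      sampleMean (fun i ω => (Y i ω, X i ω)) n
        (fun z => classWeight 0 z.1 * (Ioi c).indicator (fun _ => 1) (G z.2 β)) ω /
      sampleMean (fun i ω => (Y i ω, X i ω)) n (fun z => classWeight 0 z.1) ω := by
  classical
  have hn' : (n : ℝ) ≠ 0 := by positivity
  have h1 : ((Finset.range n).filter (fun i => c < G (X i ω) β ∧ Y i ω = 0)).card =
      ∑ i ∈ Finset.range n,
        classWeight 0 (Y i ω) * (Ioi c).indicator (fun _ => (1 : ℝ)) (G (X i ω) β) := by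
    rw [Finset.card_filter]
    push_cast
    refine Finset.sum_congr rfl fun i _ => ?_
    by_cases h1 : c < G (X i ω) β <;> by_cases h2 : Y i ω = 0 <;> simp [classWeight, h1, h2]
  have h2 : ((Finset.range n).filter (fun i => Y i ω = 0)).card =
      ∑ i ∈ Finset.range n, classWeight 0 (Y i ω) := by
    rw [Finset.card_filter]
    push_cast
    rfl
  unfold falsePosHat sampleMean
  rw [mul_div_mul_left _ _ (by positivity : (1 : ℝ) / n ≠ 0), ← h1, ← h2]

variable {Ω : Type*} [MeasurableSpace Ω] {μ : Measure Ω} {k p : ℕ} {Y : ℕ → Ω → ℝ}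
  {X : ℕ → Ω → Vec k} {G : Vec k → Vec p → ℝ} {βs : Vec p} {βhat : ℕ → Ω → Vec p} {r : ℝ}
  {K : ℝ → ℝ} {h : ℕ → ℝ} {y a b : ℝ} {f : ℝ → ℝ}

theorem CondDensity.real_tail (hf : CondDensity μ (Y 0) (X 0) G βs y a b f)
    (hX : Measurable fun ω => G (X 0 ω) βs) (c : ℝ) :
    (ProbabilityTheory.cond μ {ω | Y 0 ω = y}).real {ω | c < G (X 0 ω) βs} =
      ∫ u, (Ioi c).indicator (fun _ => (1 : ℝ)) u * f u := by
  rw [← hf.integral_comp hX (measurable_const.indicator measurableSet_Ioi)]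
  have : (fun ω => (Ioi c).indicator (fun _ => (1 : ℝ)) (G (X 0 ω) βs)) =
      {ω | c < G (X 0 ω) βs}.indicator (fun _ => 1) := by
    funext ω
    simp [indicator]
  rw [this, integral_indicator (measurableSet_lt measurable_const hX)]
  simp

/-- The tail of the density decreases by a fixed amount over intervals of fixed length. -/
theorem CondDensity.exists_tail_decrease (hf : CondDensity μ (Y 0) (X 0) G βs y a b f)
    (hX : Measurable fun ω => G (X 0 ω) βs) (hdecay : DensityDecay a b f) {ε : ℝ} (hε : 0 < ε) :
    ∃ η > 0, ∀ c ∈ Icc a b, c + ε ≤ b →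
      (ProbabilityTheory.cond μ {ω | Y 0 ω = y}).real {ω | c + ε < G (X 0 ω) βs} ≤
      (ProbabilityTheory.cond μ {ω | Y 0 ω = y}).real {ω | c < G (X 0 ω) βs} - η := by
  obtain ⟨M, hM, κ, hκ, hdec⟩ := hdecay.decay
  -- The middle half of [c, c + ε] has length ε/2 and distance at least ε/4 from both end points of
  -- the support.
  refine ⟨ε / 2 * (M * (ε / 4) ^ κ), by positivity, fun c hc hcε => ?_⟩
  rw [hf.real_tail hX, hf.real_tail hX]
  have hind : ∀ c : ℝ, Integrable fun u => (Ioi c).indicator (fun _ => (1 : ℝ)) u * f u := fun c =>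
    hf.integrable_mul (measurable_const.indicator measurableSet_Ioi) (C := 1) fun u => by
      by_cases hu : u ∈ Ioi c <;> simp [hu]
  suffices hs : ε / 2 * (M * (ε / 4) ^ κ) ≤
      (∫ u, (Ioi c).indicator (fun _ => (1 : ℝ)) u * f u) -
        ∫ u, (Ioi (c + ε)).indicator (fun _ => (1 : ℝ)) u * f u by linarith
  rw [← integral_sub (hind _) (hind _)]
  have hval : ∫ u, (Ioc (c + ε / 4) (c + 3 * ε / 4)).indicator (fun _ => M * (ε / 4) ^ κ) u =
      ε / 2 * (M * (ε / 4) ^ κ) := by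
    rw [integral_indicator measurableSet_Ioc]
    simp only [integral_const, smul_eq_mul, measureReal_restrict_apply MeasurableSet.univ,
      univ_inter, Real.volume_real_Ioc]
    rw [max_eq_left (by linarith)]
    ring
  rw [← hval]
  refine integral_mono ?_ ((hind _).sub (hind _)) fun u => ?_
  · exact (integrable_indicator_iff measurableSet_Ioc).2
      (integrableOn_const (by simp))
  · by_cases hu : u ∈ Ioc (c + ε / 4) (c + 3 * ε / 4)
    · have h1 : u ∈ Ioi c := by rw [mem_Ioi]; linarith [hu.1]
      have h2 : u ∉ Ioi (c + ε) := by rw [mem_Ioi]; linarith [hu.2]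
      simp only [hu, h1, h2, indicator_of_mem, indicator_of_notMem, not_false_eq_true]
      rw [one_mul, zero_mul, sub_zero]
      refine le_trans ?_ (hdec u ⟨by linarith [hu.1, hc.1], by linarith [hu.2]⟩)
      gcongr
      exact le_min (by linarith [hu.1, hc.1]) (by linarith [hu.2])
    · rw [indicator_of_notMem hu, ← sub_mul]
      refine mul_nonneg (sub_nonneg.2 ?_) (hf.nonneg u)
      exact indicator_le_indicator_of_subset (Ioi_subset_Ioi (by linarith))
        (fun _ => zero_le_one) u

/-- Smoothing the indicator changes the tail of a bounded density by little. -/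
theorem CondDensity.abs_ramp_sub_tail_le (hf : CondDensity μ (Y 0) (X 0) G βs y a b f) {C : ℝ}
    (hC : ∀ u, f u ≤ C) {c c' η : ℝ} (hη : 0 < η) (h1 : c' ≤ c) (h2 : c ≤ c' + η) :
    |(∫ u, ramp ((u - c') / η) * f u) - ∫ u, (Ioi c).indicator (fun _ => (1 : ℝ)) u * f u| ≤
      C * η := by
  have hm : Measurable fun u => ramp ((u - c') / η) :=
    (continuous_ramp.comp (by fun_prop : Continuous fun u => (u - c') / η)).measurable
  have hind : Integrable fun u => (Ioi c).indicator (fun _ => (1 : ℝ)) u * f u :=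
    hf.integrable_mul (measurable_const.indicator measurableSet_Ioi) (C := 1) fun u => by
      by_cases hu : u ∈ Ioi c <;> simp [hu]
  have hval : ∫ u, (Ioc c' (c' + η)).indicator (fun _ => C) u = C * η := by
    rw [integral_indicator measurableSet_Ioc]
    simp only [integral_const, smul_eq_mul, measureReal_restrict_apply MeasurableSet.univ,
      univ_inter, Real.volume_real_Ioc]
    rw [max_eq_left (by linarith)]
    ring
  have hC0 : 0 ≤ C := (hf.nonneg 0).trans (hC 0)
  rw [← integral_sub (hf.integrable_mul hm fun u => abs_ramp_le_one _) hind, ← hval]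
  refine abs_integral_le_integral_abs.trans ?_
  refine integral_mono_of_nonneg (ae_of_all _ fun _ => abs_nonneg _)
    ((integrable_indicator_iff measurableSet_Ioc).2 (integrableOn_const (by simp)))
    (ae_of_all _ fun u => ?_)
  simp only
  rw [← sub_mul, abs_mul, abs_of_nonneg (hf.nonneg u)]
  have hr0 := ramp_nonneg ((u - c') / η)
  have hr1 := ramp_le_one ((u - c') / η)
  by_cases hu : u ∈ Ioc c' (c' + η)
  · rw [indicator_of_mem hu]
    have : |ramp ((u - c') / η) - (Ioi c).indicator (fun _ => (1 : ℝ)) u| ≤ 1 := by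
      rw [abs_le]
      by_cases hc : u ∈ Ioi c
      · rw [indicator_of_mem hc]; constructor <;> linarith
      · rw [indicator_of_notMem hc]; constructor <;> linarith
    calc _ ≤ 1 * C := by
          gcongr
          · exact hf.nonneg u
          · exact hC u
      _ = C := one_mul C
  · rw [indicator_of_notMem hu]
    rcases le_or_gt u c' with hu1 | hu1
    · have hc : u ∉ Ioi c := by rw [mem_Ioi]; linarith
      rw [indicator_of_notMem hc, ramp_of_nonpos
        (div_nonpos_of_nonpos_of_nonneg (by linarith) hη.le)]
      simp
    · have hu2 : c' + η < u := by
        by_contra! hle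
        exact hu ⟨hu1, hle⟩
      have hc : u ∈ Ioi c := by rw [mem_Ioi]; linarith
      rw [indicator_of_mem hc, ramp_of_one_le (by rw [one_le_div hη]; linarith)]
      simp

/-- Uniform consistency of the empirical false positive rate at the estimated parameter. -/
theorem eventually_falsePosHat_consistent [IsProbabilityMeasure μ] (hr : 0 < r)
    (hiid : IIDSample μ Y X) (hG : IndexSmooth μ (X 0) G βs r) (hK : KernelBandwidth K h)
    (hβ : ∀ᶠ z in inProb μ, ‖βhat z.1 z.2 - βs‖ ≤ firstRate h z.1)
    (hf : CondDensity μ (Y 0) (X 0) G βs 0 a b f) {ε : ℝ} (hε : 0 < ε) :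
    ∀ᶠ z in inProb μ, ∀ c ∈ Icc a b,
      |falsePosHat G z.1 (fun i => Y i z.2) (fun i => X i z.2) c (βhat z.1 z.2) -
        falsePos μ (Y 0) (X 0) G c βs| ≤ ε := by
  obtain ⟨L, M, hL, hM, hL2, hIB⟩ := hG.ae_indexBound hiid.identDistrib_X
  obtain ⟨Cf, hCf, hfb⟩ := hf.exists_bound
  have hZ := hiid.isIID
  have q := hiid.tendsto_classFrequency hiid.pos_zero
  set Z : ℕ → Ω → ℝ × Vec k := fun i ω => (Y i ω, X i ω) with hZdef
  have hGX : Measurable fun ω => G (X 0 ω) βs := (hG.measurable_G βs).comp (hiid.measurable_X 0)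
  set P := μ.real {ω | Y 0 ω = 0} with hPdef
  have hP : 0 < P := ENNReal.toReal_pos hiid.pos_zero.ne' (measure_ne_top _ _)
  have hP1 : P ≤ 1 := measureReal_le_one
  have hνp : IsProbabilityMeasure (ProbabilityTheory.cond μ {ω | Y 0 ω = 0}) :=
    cond_isProbabilityMeasure hiid.pos_zero.ne'
  set e : ℝ := P * ε / 12 with he
  have he0 : 0 < e := by positivity
  -- A fixed ramp width: at most 1, so that c - η stays in [a - 1, b] where the uniform law is
  -- applied, and small enough for a smoothing bias of at most e.
  set η : ℝ := min 1 (e / Cf) with hη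
  have hη0 : 0 < η := by positivity
  have hη1 : η ≤ 1 := min_le_left _ _
  have hCη : Cf * η ≤ e := by
    calc Cf * η ≤ Cf * (e / Cf) := by gcongr; exact min_le_right _ _
      _ = e := by field_simp
  have m1 := hZ.eventually_sampleMean_le (F := fun z => L z.2) (hL.comp measurable_snd)
    (hL2.integrable (by norm_num))
  set A₁ := ∫ ω, L (Z 0 ω).2 ∂μ + 1
  have lln := hZ.uniform_kernel_lln (V := fun z => classWeight 0 z.1) (g := fun z => G z.2 βs)
    ((measurable_classWeight 0).comp measurable_fst)
    ((hG.measurable_G βs).comp measurable_snd) (memLp_classWeight hiid 0) continuous_ramp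
    abs_ramp_le_one abs_ramp_sub_le (show a - 1 < b by linarith [hf.lt])
    (h := fun _ => η) (ε := fun _ => e) (A := fun n => rateBase n ^ 16) (v := fun _ => 1)
    (Eventually.of_forall fun _ => hη0) (Eventually.of_forall fun _ => he0)
    ((tendsto_pow_atTop (by norm_num)).comp tendsto_rateBase)
    (by
      refine Eventually.of_forall fun n c _ => ?_
      have h1 : ∫ _ω : Ω, (1 : ℝ) ∂μ = 1 := by simp
      rw [← h1]
      refine integral_mono_of_nonneg (ae_of_all _ fun _ => sq_nonneg _) (integrable_const _)
        (ae_of_all _ fun ω => ?_)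
      simp only
      rw [sq_le_one_iff_abs_le_one, abs_mul]
      exact mul_le_one₀ (abs_classWeight_le_one _ _) (abs_nonneg _) (abs_ramp_le_one _))
    (by
      refine tendsto_const_nhds.div_atTop ?_
      exact (((tendsto_pow_atTop (n := 16) (by norm_num)).comp tendsto_rateBase).atTop_mul_const
        he0).atTop_mul_const hη0)
    (by
      refine (tendsto_const_nhds (x := 1 / e ^ 2).div_atTop
        ((tendsto_pow_atTop (n := 16) (by norm_num)).comp tendsto_rateBase)).congr' ?_
      filter_upwards [hK.eventually_param 1] with n hn
      obtain ⟨w, x, -, hw, hx, hrb, hnw, hhx, hwx, hΔ⟩ := hn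
      simp only [Function.comp_apply]
      rw [hrb, hnw]
      field_simp)
  have hsmall : ∀ᶠ n in atTop, firstRate h n < r := hK.tendsto_firstRate.eventually_lt_const hr
  have hsmall' : ∀ᶠ n in atTop, firstRate h n / η * A₁ ≤ e := by
    have := (hK.tendsto_firstRate.div_const η).mul_const A₁
    rw [zero_div, zero_mul] at this
    exact this.eventually_le_const he0
  have q1 := q.eventually_const_le (show P / 2 < P by linarith)
  have q2 : ∀ᶠ z in inProb μ, |sampleMean Z z.1 (fun z => classWeight 0 z.1) z.2 - P| ≤ e := by
    have h1 := (q.sub_const P).abs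
    rw [sub_self, abs_zero] at h1
    exact h1.eventually_le_const he0
  filter_upwards [hβ, m1, lln, q1, q2, eventually_inProb_of_ae (μ := μ) (P := fun _ ω => ∀ i,
    IndexBound (G (X i ω)) βs r (L (X i ω)) M) fun _ => hIB,
    tendsto_fst_inProb.eventually hsmall, tendsto_fst_inProb.eventually hsmall',
    tendsto_fst_inProb.eventually (hK.eventually_param 1),
    tendsto_fst_inProb.eventually (eventually_gt_atTop 0)]
    with ⟨n, ω⟩ hb m1 lln q1 q2 hIB hsm hsm' hpar hn c hc
  simp only at hb m1 lln q1 q2 hIB hsm hsm' hpar hn ⊢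
  obtain ⟨w, x, -, hw, hx, hrb, hnw, hhx, hwx, hΔ⟩ := hpar
  set Δ := firstRate h n with hΔdef
  have hΔ0 : 0 < Δ := by rw [hΔ]; positivity
  set β := βhat n ω
  have hβmem : β ∈ Metric.ball βs r := by rw [mem_ball_iff_norm]; linarith
  have hβs : βs ∈ Metric.ball βs r := Metric.mem_ball_self hr
  set F := falsePos μ (Y 0) (X 0) G c βs with hF
  have hFtail : F = ∫ u, (Ioi c).indicator (fun _ => (1 : ℝ)) u * f u := hf.real_tail hGX c
  have hF0 : 0 ≤ F := measureReal_nonneg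
  have hF1 : F ≤ 1 := measureReal_le_one
  have hswap : ∀ c' : ℝ, |sampleMean Z n (densSummand ramp G 0 η c' β) ω -
      sampleMean Z n (densSummand ramp G 0 η c' βs) ω| ≤ e := by
    intro c'
    refine (abs_sampleMean_sub_le (D := fun z => Δ / η * L z.2) fun i _ => ?_).trans ?_
    · have hi := hIB i
      have e1 : densSummand ramp G 0 η c' β (Z i ω) - densSummand ramp G 0 η c' βs (Z i ω) =
          classWeight 0 (Y i ω) *
            (ramp ((G (X i ω) β - c') / η) - ramp ((G (X i ω) βs - c') / η)) := by
        simp only [densSummand, hZdef]; ring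
      have e2 : (G (X i ω) β - c') / η - (G (X i ω) βs - c') / η =
          (G (X i ω) β - G (X i ω) βs) / η := by ring
      have hL0 : 0 ≤ L (X i ω) := (norm_nonneg _).trans (hi.grad _ hβs)
      rw [e1, abs_mul]
      calc _ ≤ 1 * |ramp ((G (X i ω) β - c') / η) - ramp ((G (X i ω) βs - c') / η)| := by
            gcongr
            exact abs_classWeight_le_one _ _
        _ ≤ |G (X i ω) β - G (X i ω) βs| / η := by
            rw [one_mul]
            refine (abs_ramp_sub_le _ _).trans_eq ?_
            rw [e2, one_mul, abs_div, abs_of_pos hη0]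
        _ ≤ L (X i ω) * Δ / η := by
            gcongr
            exact (hi.abs_sub_le hβmem hβs).trans (by gcongr)
        _ = Δ / η * L (Z i ω).2 := by simp only [hZdef]; ring
    · rw [sampleMean_const_mul]
      refine le_trans ?_ hsm'
      gcongr
  have hdev : ∀ c' ∈ Icc (a - 1) b, c' ≤ c → c ≤ c' + η →
      |sampleMean Z n (densSummand ramp G 0 η c' β) ω - P * F| ≤ 3 * e := by
    intro c' hc' h1 h2
    have d1 := lln c' hc'
    have e1 : ∫ ω, classWeight 0 (Z 0 ω).1 * ramp ((G (Z 0 ω).2 βs - c') / η) ∂μ =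
        P * ∫ u, ramp ((u - c') / η) * f u :=
      hf.integral_classWeight (hiid.measurable_Y 0) hGX hiid.pos_zero
        (φ := fun u => ramp ((u - c') / η))
        (continuous_ramp.comp (by fun_prop : Continuous fun u => (u - c') / η)).measurable
    rw [e1] at d1
    have d2 := hf.abs_ramp_sub_tail_le hfb hη0 h1 h2
    rw [← hFtail] at d2
    have d3 : |P * (∫ u, ramp ((u - c') / η) * f u) - P * F| ≤ e := by
      rw [← mul_sub, abs_mul, abs_of_pos hP]
      calc _ ≤ 1 * (Cf * η) := by gcongr
        _ ≤ e := by rw [one_mul]; exact hCη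
    have d4 := hswap c'
    change |sampleMean Z n (densSummand ramp G 0 η c' βs) ω - _| ≤ e at d1
    rw [abs_le] at d1 d3 d4 ⊢
    constructor <;> linarith [d1.1, d1.2, d3.1, d3.2, d4.1, d4.2]
  set N := sampleMean Z n
    (fun z => classWeight 0 z.1 * (Ioi c).indicator (fun _ => 1) (G z.2 β)) ω with hN
  set D := sampleMean Z n (fun z => classWeight 0 z.1) ω with hD
  have hD0 : 0 < D := by linarith
  -- The indicator is discontinuous in the index, so `βhat` cannot be replaced by `βs` in it
  -- directly; the two Lipschitz ramps allow this.
  have hlow : sampleMean Z n (densSummand ramp G 0 η c β) ω ≤ N :=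
    sampleMean_mono fun i _ => mul_le_mul_of_nonneg_left (ramp_le_indicator hη0)
      (classWeight_nonneg _ _)
  have hupp : N ≤ sampleMean Z n (densSummand ramp G 0 η (c - η) β) ω :=
    sampleMean_mono fun i _ => mul_le_mul_of_nonneg_left (indicator_le_ramp hη0)
      (classWeight_nonneg _ _)
  have hNF : |N - P * F| ≤ 3 * e := by
    have d1 := hdev c ⟨by linarith [hc.1], hc.2⟩ le_rfl (by linarith)
    have d2 := hdev (c - η) ⟨by linarith [hc.1], by linarith [hc.2]⟩ (by linarith) (by linarith)
    rw [abs_le] at d1 d2 ⊢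
    constructor <;> linarith [d1.1, d2.2]
  rw [falsePosHat_eq n hn]
  change |N / D - F| ≤ ε
  have e3 : N / D - F = ((N - P * F) - (D - P) * F) / D := by field_simp; ring
  rw [e3, abs_div, abs_of_pos hD0, div_le_iff₀ hD0]
  calc |(N - P * F) - (D - P) * F| ≤ |N - P * F| + |(D - P) * F| := abs_sub _ _
    _ ≤ 3 * e + e * 1 := by
        rw [abs_mul, abs_of_nonneg hF0]
        gcongr
    _ ≤ ε * (P / 2) := by rw [he]; nlinarith [mul_pos hP hε]
    _ ≤ ε * D := by gcongr

end Cutoff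

/-! ### Boundary modification and Lipschitz continuity -/

section BoundaryModification

/-- The projection of the line onto `[a + d, b - d]`. -/
def marginClamp (a b d c : ℝ) : ℝ := max (a + d) (min c (b - d))

/-- Writing the modification as a composition reduces its Lipschitz and consistency properties to
those of the projection. -/
theorem boundaryMod_eq {E : Type*} {a b d : ℝ} (h : a + d ≤ b - d) (g : ℝ → E) (c : ℝ) :
    boundaryMod a b d g c = g (marginClamp a b d c) := by
  unfold boundaryMod marginClamp
  split_ifs with h1 h2
  · rw [min_eq_left (h1.trans h), max_eq_left h1]
  · rw [min_eq_left h2, max_eq_right (not_le.1 h1).le]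
  · rw [min_eq_right (not_le.1 h2).le, max_eq_right h]

theorem marginClamp_mem {a b d : ℝ} (h : a + d ≤ b - d) (c : ℝ) :
    marginClamp a b d c ∈ Icc (a + d) (b - d) :=
  ⟨le_max_left _ _, max_le h (min_le_right _ _)⟩

theorem abs_marginClamp_sub_le {a b d c : ℝ} (hd : 0 ≤ d) (h : a + d ≤ b - d) (hc : c ∈ Icc a b) :
    |marginClamp a b d c - c| ≤ d := by
  unfold marginClamp
  obtain ⟨h1, h2⟩ := hc
  rcases le_total c (b - d) with h3 | h3
  · rw [min_eq_left h3]
    rcases le_total (a + d) c with h4 | h4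
    · rw [max_eq_right h4, sub_self, abs_zero]; exact hd
    · rw [max_eq_left h4, abs_le]; constructor <;> linarith
  · rw [min_eq_right h3, max_eq_right h, abs_le]; constructor <;> linarith

theorem abs_marginClamp_sub_marginClamp_le (a b d c c' : ℝ) :
    |marginClamp a b d c - marginClamp a b d c'| ≤ |c - c'| := by
  unfold marginClamp
  calc _ ≤ |min c (b - d) - min c' (b - d)| := by
        simpa using abs_max_sub_max_le_max (a + d) (min c (b - d)) (a + d) (min c' (b - d))
    _ ≤ |c - c'| := by simpa using abs_min_sub_min_le_max c (b - d) c' (b - d)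

theorem eventually_margin {d : ℕ → ℝ} (hd : Tendsto d atTop (𝓝 0)) {a b : ℝ} (hab : a < b) :
    ∀ᶠ n in atTop, a + d n ≤ b - d n := by
  filter_upwards [hd.eventually_le_const (show (0 : ℝ) < (b - a) / 2 by linarith)] with n hn
  linarith

/-- Consistency inside the margin extends to the boundary-modified estimator. -/
theorem unifConsistent_boundaryMod {Ω E : Type*} [MeasurableSpace Ω] [NormedAddCommGroup E]
    {μ : Measure Ω} {a b : ℝ} (hab : a < b) {d : ℕ → ℝ} (hd : Tendsto d atTop (𝓝 0))
    (hd0 : ∀ᶠ n in atTop, 0 < d n) {g : ℕ → Ω → ℝ → E} {θ : ℝ → E}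
    (hθ : ContinuousOn θ (Icc a b))
    (h : ∀ ε : ℝ, 0 < ε → ∀ᶠ z in inProb μ, ∀ c ∈ Icc (a + d z.1) (b - d z.1),
      ‖g z.1 z.2 c - θ c‖ ≤ ε) :
    UnifConsistent μ (Icc a b) (fun n ω => boundaryMod a b (d n) (g n ω)) θ := by
  rw [unifConsistent_iff]
  intro ε hε
  obtain ⟨e, he, hmod⟩ := Metric.uniformContinuousOn_iff.1
    (isCompact_Icc.uniformContinuousOn_of_continuous hθ) (ε / 2) (half_pos hε)
  filter_upwards [h (ε / 2) (half_pos hε), tendsto_fst_inProb.eventually (eventually_margin hd hab),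
    tendsto_fst_inProb.eventually hd0,
    tendsto_fst_inProb.eventually (hd.eventually_lt_const he)] with z hz hm hz0 hze c hc
  rw [boundaryMod_eq hm]
  have hmem := marginClamp_mem hm c
  set c' := marginClamp a b (d z.1) c with hc'
  have h1 := hz c' hmem
  have h2 := hmod c' ⟨by linarith [hmem.1], by linarith [hmem.2]⟩ c hc (by
    rw [Real.dist_eq]
    exact (abs_marginClamp_sub_le hz0.le hm hc).trans_lt hze)
  rw [dist_eq_norm] at h2
  calc ‖g z.1 z.2 c' - θ c‖ = ‖(g z.1 z.2 c' - θ c') + (θ c' - θ c)‖ := by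
        rw [sub_add_sub_cancel]
    _ ≤ ε / 2 + ε / 2 := (norm_add_le _ _).trans (add_le_add h1 h2.le)
    _ = ε := by ring

theorem lipOn_of_norm_sub_le {E : Type*} [NormedAddCommGroup E] {S : Set ℝ} {g : ℝ → E} {M : ℝ}
    (h : ∀ c ∈ S, ∀ c' ∈ S, ‖g c - g c'‖ ≤ M * |c - c'|) : LipOn S g := by
  refine ⟨Real.toNNReal M, LipschitzOnWith.of_dist_le_mul fun c hc c' hc' => ?_⟩
  rw [dist_eq_norm, Real.dist_eq]
  refine (h c hc c' hc').trans ?_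
  gcongr
  exact Real.le_coe_toNNReal M

theorem lipOn_boundaryMod {E : Type*} [NormedAddCommGroup E] {a b d : ℝ} (hm : a + d ≤ b - d)
    {g : ℝ → E} {M : ℝ} (h : ∀ c c', ‖g c - g c'‖ ≤ M * |c - c'|) (S : Set ℝ) :
    LipOn S (boundaryMod a b d g) := by
  have hM : 0 ≤ M := by
    have := (norm_nonneg _).trans (h 0 1)
    simpa using this
  refine lipOn_of_norm_sub_le (M := M) fun c _ c' _ => ?_
  rw [boundaryMod_eq hm, boundaryMod_eq hm]
  exact (h _ _).trans (mul_le_mul_of_nonneg_left (abs_marginClamp_sub_marginClamp_le _ _ _ _ _) hM)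

/-- Kernel sums are Lipschitz in the location. -/
theorem exists_lipschitz_kernelSum {E : Type*} [NormedAddCommGroup E] [NormedSpace ℝ E]
    {K : ℝ → ℝ} {C : ℝ} (hKl : ∀ u v, |K u - K v| ≤ C * |u - v|) (s : Finset ℕ) (x w : ℕ → ℝ)
    (v : ℕ → E) (t A : ℝ) :
    ∃ M : ℝ, ∀ c c' : ℝ, ‖A • ∑ i ∈ s, (w i * K ((x i - c) / t)) • v i -
      A • ∑ i ∈ s, (w i * K ((x i - c') / t)) • v i‖ ≤ M * |c - c'| := by
  -- Only the kernel depends on the location. Weights, vectors and A are arbitrary, so degenerate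
  -- samples are included; for t = 0 division by zero makes both sides zero.
  refine ⟨|A| * ∑ i ∈ s, |w i| * (C / |t|) * ‖v i‖, fun c c' => ?_⟩
  rw [← smul_sub, ← Finset.sum_sub_distrib, norm_smul, Real.norm_eq_abs, mul_assoc, Finset.sum_mul]
  gcongr
  refine norm_sum_le_of_le _ fun i _ => ?_
  rw [← sub_smul, ← mul_sub, norm_smul, norm_mul, Real.norm_eq_abs, Real.norm_eq_abs]
  have h1 : (x i - c) / t - (x i - c') / t = -((c - c') / t) := by ring
  have h2 := hKl ((x i - c) / t) ((x i - c') / t)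
  rw [h1, abs_neg, abs_div] at h2
  calc |w i| * |K ((x i - c) / t) - K ((x i - c') / t)| * ‖v i‖
      ≤ |w i| * (C * (|c - c'| / |t|)) * ‖v i‖ := by gcongr
    _ = _ := by ring

theorem LipOn.continuousOn {E : Type*} [NormedAddCommGroup E] {S : Set ℝ} {g : ℝ → E}
    (h : LipOn S g) : ContinuousOn g S := by
  obtain ⟨M, hM⟩ := h
  exact hM.continuousOn

/-- A ratio of Lipschitz functions with positive denominator is Lipschitz on a compact interval. -/
theorem LipOn.div {a b : ℝ} {f g : ℝ → ℝ} (hab : a ≤ b) (hf : LipOn (Icc a b) f)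
    (hg : LipOn (Icc a b) g) (hpos : ∀ c ∈ Icc a b, 0 < g c) :
    LipOn (Icc a b) (fun c => f c / g c) := by
  obtain ⟨Bf, hBf⟩ := isCompact_Icc.exists_bound_of_continuousOn hf.continuousOn
  obtain ⟨Bg, hBg⟩ := isCompact_Icc.exists_bound_of_continuousOn hg.continuousOn
  obtain ⟨c₀, hc₀, hmin⟩ := isCompact_Icc.exists_isMinOn (nonempty_Icc.2 hab) hg.continuousOn
  have hm := hpos c₀ hc₀
  set m := g c₀
  obtain ⟨Mf, hMf⟩ := hf
  obtain ⟨Mg, hMg⟩ := hg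
  refine lipOn_of_norm_sub_le (M := (Mf * Bg + Bf * Mg) / (m * m)) fun c hc c' hc' => ?_
  have h1 := hMf.dist_le_mul c hc c' hc'
  have h2 := hMg.dist_le_mul c hc c' hc'
  rw [Real.dist_eq, Real.dist_eq] at h1 h2
  have p1 := hpos c hc
  have p2 := hpos c' hc'
  have q1 : m ≤ g c := hmin hc
  have q2 : m ≤ g c' := hmin hc'
  have b1 := hBf c' hc'
  have b2 := hBg c' hc'
  rw [Real.norm_eq_abs] at b1 b2
  have e : f c / g c - f c' / g c' =
      ((f c - f c') * g c' - f c' * (g c - g c')) / (g c * g c') := by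
    field_simp
    ring
  rw [Real.norm_eq_abs, e, abs_div, abs_of_pos (mul_pos p1 p2)]
  have num : |(f c - f c') * g c' - f c' * (g c - g c')| ≤ (Mf * Bg + Bf * Mg) * |c - c'| := by
    have hBf0 : 0 ≤ Bf := (abs_nonneg _).trans b1
    calc _ ≤ |(f c - f c') * g c'| + |f c' * (g c - g c')| := abs_sub _ _
      _ ≤ (Mf * |c - c'|) * Bg + Bf * (Mg * |c - c'|) := by
        rw [abs_mul, abs_mul]
        gcongr
      _ = _ := by ring
  have hnum0 := (abs_nonneg _).trans num
  calc _ ≤ (Mf * Bg + Bf * Mg) * |c - c'| / (m * m) := by gcongr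
    _ = _ := by ring

end BoundaryModification

/-! ### The estimators in terms of class indicators -/

section ClassForm

variable {Ω : Type*} {k p : ℕ} {Y : ℕ → Ω → ℝ} {X : ℕ → Ω → Vec k} {G : Vec k → Vec p → ℝ}
  {K : ℝ → ℝ} {n : ℕ} {ω : Ω}

/-- The kernel estimator of the gradient of a rate in class `y`. -/
def gradClassTilde (K : ℝ → ℝ) (t : ℝ) (G : Vec k → Vec p → ℝ) (n : ℕ) (Y : ℕ → Ω → ℝ)
    (X : ℕ → Ω → Vec k) (y : ℝ) (β : Vec p) (ω : Ω) (c : ℝ) : Vec p :=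
  ((1 / sampleMean (fun i ω => (Y i ω, X i ω)) n (fun z => classWeight y z.1) ω) *
    (1 / ((n : ℝ) * t))) •
    ∑ i ∈ Finset.range n,
      (classWeight y (Y i ω) * K ((G (X i ω) β - c) / t)) • gradient (G (X i ω)) β

theorem gradClassTilde_apply (K : ℝ → ℝ) (t : ℝ) (G : Vec k → Vec p → ℝ) (n : ℕ) (Y : ℕ → Ω → ℝ)
    (X : ℕ → Ω → Vec k) (y : ℝ) (β : Vec p) (ω : Ω) (c : ℝ) (j : Fin p) :
    gradClassTilde K t G n Y X y β ω c j =
      1 / sampleMean (fun i ω => (Y i ω, X i ω)) n (fun z => classWeight y z.1) ω *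
      (1 / t * sampleMean (fun i ω => (Y i ω, X i ω)) n (gradSummand K G y t c β j) ω) := by
  have h1 : (∑ i ∈ Finset.range n, (classWeight y (Y i ω) * K ((G (X i ω) β - c) / t)) •
      gradient (G (X i ω)) β) j =
      ∑ i ∈ Finset.range n, gradSummand K G y t c β j (Y i ω, X i ω) := by
    rw [WithLp.ofLp_sum, Finset.sum_apply]
    refine Finset.sum_congr rfl fun i _ => ?_
    simp only [gradSummand, PiLp.smul_apply, smul_eq_mul]
    ring
  unfold gradClassTilde
  rw [PiLp.smul_apply, h1, smul_eq_mul]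
  unfold sampleMean
  rw [show 1 / ((n : ℝ) * t) = 1 / t * (1 / n) by rw [one_div_mul_one_div, mul_comm]]
  ring

theorem piHat_eq (hY : ∀ i, Y i ω = 0 ∨ Y i ω = 1) :
    piHat n (fun i => Y i ω) =
      sampleMean (fun i ω => (Y i ω, X i ω)) n (fun z => classWeight 1 z.1) ω := by
  unfold piHat sampleMean
  congr 1
  refine Finset.sum_congr rfl fun i _ => ?_
  rcases hY i with h | h <;> simp [classWeight, h]

theorem one_sub_eq_classWeight {t : ℝ} (h : t = 0 ∨ t = 1) : 1 - t = classWeight 0 t := by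
  rcases h with h | h <;> simp [classWeight, h]

theorem eq_classWeight {t : ℝ} (h : t = 0 ∨ t = 1) : t = classWeight 1 t := by
  rcases h with h | h <;> simp [classWeight, h]

/-- For n = 0 the left side would be 1 and the right side 0. -/
theorem one_sub_piHat_eq (hn : 0 < n) (hY : ∀ i, Y i ω = 0 ∨ Y i ω = 1) :
    1 - piHat n (fun i => Y i ω) =
      sampleMean (fun i ω => (Y i ω, X i ω)) n (fun z => classWeight 0 z.1) ω := by
  have hn' : (n : ℝ) ≠ 0 := by positivity
  unfold piHat sampleMean
  simp only [← one_sub_eq_classWeight (hY _), Finset.sum_sub_distrib, mul_sub]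
  simp [hn']

theorem gradTPTilde_eq (hY : ∀ i, Y i ω = 0 ∨ Y i ω = 1) (t : ℝ) (β : Vec p) :
    gradTPTilde K t G n (fun i => Y i ω) (fun i => X i ω) β =
      gradClassTilde K t G n Y X 1 β ω := by
  funext c
  unfold gradTPTilde gradClassTilde
  rw [piHat_eq (X := X) hY]
  simp only [← eq_classWeight (hY _)]

theorem gradFPTilde_eq (hn : 0 < n) (hY : ∀ i, Y i ω = 0 ∨ Y i ω = 1) (t : ℝ) (β : Vec p) :
    gradFPTilde K t G n (fun i => Y i ω) (fun i => X i ω) β =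
      gradClassTilde K t G n Y X 0 β ω := by
  funext c
  unfold gradFPTilde gradClassTilde
  rw [one_sub_piHat_eq (X := X) hn hY]
  simp only [one_sub_eq_classWeight (hY _)]

theorem densOneTilde_eq (hY : ∀ i, Y i ω = 0 ∨ Y i ω = 1) (t : ℝ) (β : Vec p) (c : ℝ) :
    densOneTilde K t G n (fun i => Y i ω) (fun i => X i ω) β c =
      1 / sampleMean (fun i ω => (Y i ω, X i ω)) n (fun z => classWeight 1 z.1) ω *
      (1 / t * sampleMean (fun i ω => (Y i ω, X i ω)) n (densSummand K G 1 t c β) ω) := by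
  unfold densOneTilde
  rw [piHat_eq (X := X) hY]
  unfold sampleMean densSummand
  simp only [← eq_classWeight (hY _)]
  rw [show 1 / ((n : ℝ) * t) = 1 / t * (1 / n) by rw [one_div_mul_one_div, mul_comm]]
  ring

theorem densZeroTilde_eq (hn : 0 < n) (hY : ∀ i, Y i ω = 0 ∨ Y i ω = 1) (t : ℝ) (β : Vec p)
    (c : ℝ) :
    densZeroTilde K t G n (fun i => Y i ω) (fun i => X i ω) β c =
      1 / sampleMean (fun i ω => (Y i ω, X i ω)) n (fun z => classWeight 0 z.1) ω *
      (1 / t * sampleMean (fun i ω => (Y i ω, X i ω)) n (densSummand K G 0 t c β) ω) := by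
  unfold densZeroTilde
  rw [one_sub_piHat_eq (X := X) hn hY]
  unfold sampleMean densSummand
  simp only [one_sub_eq_classWeight (hY _)]
  rw [show 1 / ((n : ℝ) * t) = 1 / t * (1 / n) by rw [one_div_mul_one_div, mul_comm]]
  ring

end ClassForm

/-! ### Assembly of the conclusions -/

section Assembly

variable {Ω : Type*} [MeasurableSpace Ω] {μ : Measure Ω} {k p : ℕ} {Y : ℕ → Ω → ℝ}
  {X : ℕ → Ω → Vec k} {G : Vec k → Vec p → ℝ} {βs : Vec p} {βhat : ℕ → Ω → Vec p} {r : ℝ}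
  {K : ℝ → ℝ} {h : ℕ → ℝ}

/-- Uniform consistency of the kernel estimator of the gradient away from the end points. -/
theorem eventually_gradClassTilde_consistent [IsProbabilityMeasure μ] (hr : 0 < r)
    (hiid : IIDSample μ Y X) (hG : IndexSmooth μ (X 0) G βs r) (hK : KernelBandwidth K h)
    (hβ : ∀ᶠ z in inProb μ, ‖βhat z.1 z.2 - βs‖ ≤ firstRate h z.1) {y : ℝ}
    (hy : 0 < μ {ω | Y 0 ω = y}) {a b : ℝ} (hab : a < b) {R : ℝ → Vec p → ℝ}
    (hR : ∀ c β, R c β = (ProbabilityTheory.cond μ {ω | Y 0 ω = y}).real {ω | c < G (X 0 ω) β})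
    (hgrad : GradientUnif R (Icc a b) βs r) {ε : ℝ} (hε : 0 < ε) :
    ∀ᶠ z in inProb μ, ∀ c ∈ Icc (a + h z.1) (b - h z.1),
      ‖gradClassTilde K (h z.1) G z.1 Y X y (βhat z.1 z.2) z.2 c - gradient (R c) βs‖ ≤ ε := by
  set P := μ.real {ω | Y 0 ω = y} with hPdef
  have hP : 0 < P := ENNReal.toReal_pos hy.ne' (measure_ne_top _ _)
  obtain ⟨M, hM, hRb⟩ := hgrad.bounded
  have q := hiid.tendsto_classFrequency hy
  set e : ℝ := ε / (p + 1) with he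
  have he0 : 0 < e := by positivity
  have hT := fun j => eventually_gradSummand_consistent hr hiid hG hK hβ hy hab hR hgrad j
    (ε := e / 2 * (P / 2)) (by positivity)
  have q1 := q.eventually_const_le (show P / 2 < P by linarith)
  have q2 : ∀ᶠ z in inProb μ, |P / sampleMean (fun i ω => (Y i ω, X i ω)) z.1
      (fun z => classWeight y z.1) z.2 - 1| * M ≤ e / 2 := by
    have h1 := (((tendsto_const_nhds (x := P)).div q hP.ne').sub_const 1).abs.mul_const M
    rw [div_self hP.ne', sub_self, abs_zero, zero_mul] at h1
    exact h1.eventually_le_const (by positivity)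
  filter_upwards [eventually_all.2 hT, q1, q2, tendsto_fst_inProb.eventually hK.eventually_pos]
    with ⟨n, ω⟩ hT q1 q2 hh c hc
  simp only at hT q1 q2 hh hc ⊢
  have hcI : c ∈ Icc a b := ⟨by linarith [hc.1], by linarith [hc.2]⟩
  have hj : ∀ j, |(gradClassTilde K (h n) G n Y X y (βhat n ω) ω c - gradient (R c) βs) j| ≤ e := by
    intro j
    rw [PiLp.sub_apply, gradClassTilde_apply]
    have hTj := hT j c hc
    have hg : |gradient (R c) βs j| ≤ M :=
      (abs_apply_le_norm _ _).trans (hRb c hcI βs (Metric.mem_ball_self hr))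
    set D := sampleMean (fun i ω => (Y i ω, X i ω)) n (fun z => classWeight y z.1) ω
    set T := 1 / h n * sampleMean (fun i ω => (Y i ω, X i ω)) n
      (gradSummand K G y (h n) c (βhat n ω) j) ω
    set g := gradient (R c) βs j
    have hD : 0 < D := by linarith
    -- This separates the error of the kernel average from the error of the class frequency. The
    -- latter is multiplied by the bounded population gradient.
    have e1 : 1 / D * T - g = (T - P * g) / D + (P / D - 1) * g := by field_simp; ring
    rw [e1]
    refine (abs_add_le _ _).trans ?_
    rw [abs_div, abs_of_pos hD, abs_mul]
    calc |T - P * g| / D + |P / D - 1| * |g| ≤ e / 2 * (P / 2) / (P / 2) + |P / D - 1| * M := by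
          gcongr
      _ ≤ e / 2 + e / 2 := by
          refine add_le_add (le_of_eq ?_) q2
          field_simp
      _ = e := by ring
  refine (norm_le_sum_abs _).trans ?_
  calc _ ≤ ∑ _j : Fin p, e := Finset.sum_le_sum fun j _ => hj j
    _ = p * e := by simp
    _ ≤ (p + 1) * e := by gcongr; linarith
    _ = ε := by rw [he]; field_simp

theorem continuousOn_gradient {R : ℝ → Vec p → ℝ} {C : Set ℝ} (hr : 0 < r)
    (h : GradientUnif R C βs r) : ContinuousOn (fun c => gradient (R c) βs) C :=
  h.continuous.comp (f := fun u : ℝ => (u, βs)) (Continuous.continuousOn (by fun_prop))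
    fun _ hu => ⟨hu, Metric.mem_ball_self hr⟩

end Assembly

end

theorem mainTheorem9 {Ω : Type*} [MeasurableSpace Ω] (μ : Measure Ω) [IsProbabilityMeasure μ]
    {k p : ℕ} (Y : ℕ → Ω → ℝ) (X : ℕ → Ω → Vec k) (G : Vec k → Vec p → ℝ)
    (B : Set (Vec p)) (q : ℝ → Vec k → Vec p → ℝ) (ψ : ℝ → Vec k → Vec p → Vec p)
    (βs : Vec p) (βhat : ℕ → Ω → Vec p) (r : ℝ)
    (K : ℝ → ℝ) (h δ : ℕ → ℝ) (a₀ b₀ a₁ b₁ : ℝ) (f₀ f₁ lr : ℝ → ℝ)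
    (hr : 0 < r)
    (hiid : IIDSample μ Y X)
    (hβ : FirstStage μ Y X B q ψ βs βhat)
    (hK : KernelBandwidth K h)
    (hG : IndexSmooth μ (X 0) G βs r)
    (hTP : GradientUnif (truePos μ (Y 0) (X 0) G) (Icc a₀ b₀) βs r)
    (hFP : GradientUnif (falsePos μ (Y 0) (X 0) G) (Icc a₀ b₀) βs r)
    (hf₀ : CondDensity μ (Y 0) (X 0) G βs 0 a₀ b₀ f₀)
    (hdecay : DensityDecay a₀ b₀ f₀)
    (hf₁ : CondDensity μ (Y 0) (X 0) G βs 1 a₁ b₁ f₁)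
    (hsub : Icc a₁ b₁ ⊆ Icc a₀ b₀)
    (hlr : LikelihoodRatio a₀ b₀ f₀ f₁ lr)
    (hδ : MarginRate δ) :
    let gradFP : ℕ → Ω → ℝ → Vec p := fun n ω =>
      boundaryMod a₀ b₀ (h n)
        (gradFPTilde K (h n) G n (fun i => Y i ω) (fun i => X i ω) (βhat n ω))
    let gradTP : ℕ → Ω → ℝ → Vec p := fun n ω =>
      boundaryMod a₀ b₀ (h n)
        (gradTPTilde K (h n) G n (fun i => Y i ω) (fun i => X i ω) (βhat n ω))
    let dens₁ : ℕ → Ω → ℝ → ℝ := fun n ω =>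
      boundaryMod a₀ b₀ (δ n)
        (densOneTilde K (h n) G n (fun i => Y i ω) (fun i => X i ω) (βhat n ω))
    let dens₀ : ℕ → Ω → ℝ → ℝ := fun n ω =>
      boundaryMod a₀ b₀ (δ n)
        (densZeroTilde K (h n) G n (fun i => Y i ω) (fun i => X i ω) (βhat n ω))
    let ratio : ℕ → Ω → ℝ → ℝ := fun n ω c => dens₁ n ω c / dens₀ n ω c
    let cHat : ℕ → Ω → ℝ → ℝ := fun n ω =>
      cutoff a₀ b₀ (fun c => falsePosHat G n (fun i => Y i ω) (fun i => X i ω) c (βhat n ω))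
    let cStar : ℝ → ℝ := cutoff a₀ b₀ (fun c => falsePos μ (Y 0) (X 0) G c βs)
    -- Lipschitz continuity in `c` on `[a₀, b₀]`
    (∀ᶠ n in atTop, ∀ ω, LipOn (Icc a₀ b₀) (gradFP n ω)) ∧
    (∀ᶠ n in atTop, ∀ ω, LipOn (Icc a₀ b₀) (gradTP n ω)) ∧
    Tendsto (fun n => μ {ω | ¬ ((∀ c ∈ Icc a₀ b₀, 0 < dens₀ n ω c) ∧
      LipOn (Icc a₀ b₀) (ratio n ω))}) atTop (𝓝 0) ∧
    -- uniform consistency on `[a₀, b₀]`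
    UnifConsistent μ (Icc a₀ b₀) gradFP
      (fun c => gradient (fun β => falsePos μ (Y 0) (X 0) G c β) βs) ∧
    UnifConsistent μ (Icc a₀ b₀) gradTP
      (fun c => gradient (fun β => truePos μ (Y 0) (X 0) G c β) βs) ∧
    UnifConsistent μ (Icc a₀ b₀) ratio lr ∧
    -- uniform consistency of the estimated cutoffs
    UnifConsistent μ (Icc 0 1) cHat cStar := by
  intro gradFP gradTP dens₁ dens₀ ratio cHat cStar
  have hab := hf₀.lt
  have hrate := hβ.eventually_norm_le hiid hK
  obtain ⟨C, hC, hKb, hKl⟩ := hK.exists_bound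
  have hbin : ∀ᶠ z in inProb μ, ∀ i, Y i z.2 = 0 ∨ Y i z.2 = 1 :=
    eventually_inProb_of_ae (P := fun _ ω => ∀ i, Y i ω = 0 ∨ Y i ω = 1) fun _ =>
      ae_all_iff.2 hiid.binary
  have hn := tendsto_fst_inProb (μ := μ).eventually (eventually_gt_atTop 0)
  have hGX : Measurable fun ω => G (X 0 ω) βs := (hG.measurable_G βs).comp (hiid.measurable_X 0)
  have hmh := eventually_margin hK.bandwidth_zero hab
  have hmδ := eventually_margin hδ.tendsto_zero hab
  have hratioEq : ∀ n, a₀ + δ n ≤ b₀ - δ n → ∀ ω, ratio n ω = boundaryMod a₀ b₀ (δ n) (fun c =>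
      densOneTilde K (h n) G n (fun i => Y i ω) (fun i => X i ω) (βhat n ω) c /
        densZeroTilde K (h n) G n (fun i => Y i ω) (fun i => X i ω) (βhat n ω) c) := by
    intro n hn ω
    funext c
    simp only [ratio, dens₁, dens₀, boundaryMod_eq hn]
  have hq₀ := (hiid.tendsto_classFrequency hiid.pos_zero).eventually_const_lt
    (ENNReal.toReal_pos hiid.pos_zero.ne' (measure_ne_top _ _))
  refine ⟨?_, ?_, ?_, ?_, ?_, ?_, ?_⟩
  · filter_upwards [hmh] with n hm ω
    obtain ⟨M, hM⟩ := exists_lipschitz_kernelSum hKl (Finset.range n)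
      (fun i => G (X i ω) (βhat n ω)) (fun i => 1 - Y i ω)
      (fun i => gradient (G (X i ω)) (βhat n ω)) (h n)
      ((1 / (1 - piHat n fun i => Y i ω)) * (1 / ((n : ℝ) * h n)))
    exact lipOn_boundaryMod hm hM _
  · filter_upwards [hmh] with n hm ω
    obtain ⟨M, hM⟩ := exists_lipschitz_kernelSum hKl (Finset.range n)
      (fun i => G (X i ω) (βhat n ω)) (fun i => Y i ω)
      (fun i => gradient (G (X i ω)) (βhat n ω)) (h n)
      ((1 / piHat n fun i => Y i ω) * (1 / ((n : ℝ) * h n)))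
    exact lipOn_boundaryMod hm hM _
  · refine (eventually_inProb_iff (P := fun n ω => (∀ c ∈ Icc a₀ b₀, 0 < dens₀ n ω c) ∧
      LipOn (Icc a₀ b₀) (ratio n ω))).1 ?_
    filter_upwards [eventually_densRatio_consistent hr hiid hG hK hrate hf₀ hdecay hf₁ hsub hlr hδ
      one_pos, hbin, hn, hq₀, tendsto_fst_inProb.eventually hmδ,
      tendsto_fst_inProb.eventually hK.eventually_pos] with ⟨n, ω⟩ hrat hY hn hq hm hh
    simp only at hrat hY hn hq hm hh ⊢
    have hpos : ∀ c ∈ Icc a₀ b₀, 0 < dens₀ n ω c := by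
      intro c _
      simp only [dens₀]
      rw [boundaryMod_eq hm, densZeroTilde_eq hn hY]
      have := (hrat _ (marginClamp_mem hm c)).1
      positivity
    refine ⟨hpos, LipOn.div hab.le ?_ ?_ hpos⟩
    · obtain ⟨M, hM⟩ := exists_lipschitz_kernelSum hKl (Finset.range n)
        (fun i => G (X i ω) (βhat n ω)) (fun i => Y i ω) (fun _ => (1 : ℝ)) (h n)
        ((1 / piHat n fun i => Y i ω) * (1 / ((n : ℝ) * h n)))
      refine lipOn_boundaryMod hm (M := M) (fun c c' => ?_) _
      simpa only [smul_eq_mul, mul_one] using! hM c c'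
    · obtain ⟨M, hM⟩ := exists_lipschitz_kernelSum hKl (Finset.range n)
        (fun i => G (X i ω) (βhat n ω)) (fun i => 1 - Y i ω) (fun _ => (1 : ℝ)) (h n)
        ((1 / (1 - piHat n fun i => Y i ω)) * (1 / ((n : ℝ) * h n)))
      refine lipOn_boundaryMod hm (M := M) (fun c c' => ?_) _
      simpa only [smul_eq_mul, mul_one] using! hM c c'
  · refine unifConsistent_boundaryMod hab hK.bandwidth_zero hK.eventually_pos
      (continuousOn_gradient hr hFP) fun ε hε => ?_
    filter_upwards [eventually_gradClassTilde_consistent hr hiid hG hK hrate hiid.pos_zero hab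
      (fun _ _ => rfl) hFP hε, hbin, hn] with z hz hY hn c hc
    rw [gradFPTilde_eq hn hY]
    exact hz c hc
  · refine unifConsistent_boundaryMod hab hK.bandwidth_zero hK.eventually_pos
      (continuousOn_gradient hr hTP) fun ε hε => ?_
    filter_upwards [eventually_gradClassTilde_consistent hr hiid hG hK hrate hiid.pos_one hab
      (fun _ _ => rfl) hTP hε, hbin] with z hz hY c hc
    rw [gradTPTilde_eq hY]
    exact hz c hc
  · have hcons := unifConsistent_boundaryMod (μ := μ) hab hδ.tendsto_zero
      (Eventually.of_forall hδ.pos) (g := fun n ω c =>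
        densOneTilde K (h n) G n (fun i => Y i ω) (fun i => X i ω) (βhat n ω) c /
        densZeroTilde K (h n) G n (fun i => Y i ω) (fun i => X i ω) (βhat n ω) c)
      hlr.continuous fun ε hε => by
        filter_upwards [eventually_densRatio_consistent hr hiid hG hK hrate hf₀ hdecay hf₁ hsub hlr
          hδ hε, hbin, hn, tendsto_fst_inProb.eventually hK.eventually_pos]
          with z hz hY hn hh c hc
        refine le_of_eq_of_le ?_ (hz c hc).2
        rw [Real.norm_eq_abs, densOneTilde_eq hY, densZeroTilde_eq hn hY]
        -- The factors 1/h cancel in the quotient, which leaves the ratio of class frequencies times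
        -- the ratio of kernel averages.
        congr 2
        have hh' : h z.1 ≠ 0 := hh.ne'
        rw [mul_div_mul_comm, mul_div_mul_left _ _ (one_div_ne_zero hh')]
        congr 1
        rw [div_div_eq_mul_div, div_one, one_div_mul_eq_div]
    rw [unifConsistent_iff] at hcons ⊢
    intro ε hε
    filter_upwards [hcons ε hε, tendsto_fst_inProb.eventually hmδ] with z hz hm
    rw [hratioEq z.1 hm z.2]
    exact hz
  · rw [unifConsistent_iff]
    intro ε hε
    -- Inversion loses a factor 2, hence ε/2 here; it tolerates a discrepancy of η/2 between the
    -- rates.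
    obtain ⟨η, hη, hdec⟩ := hf₀.exists_tail_decrease hGX hdecay (half_pos hε)
    filter_upwards [eventually_falsePosHat_consistent hr hiid hG hK hrate hf₀ (half_pos hη)]
      with z hz t _
    have := abs_cutoff_sub_le hab.le (half_pos hε) hη hdec hz t
    rwa [mul_div_cancel₀ ε two_ne_zero] at this
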